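/- **Setting.** Work in dimension $D=4$ with mostly-plus signature. A theory is a Lagrangian $\mathcal L(g^{ab},R_{abcd})$ without covariant derivatives of the curvature. Conventions: $\nabla_a\nabla_b\omega_c-\nabla_b\nabla_a\omega_c=R_{abc}{}^{d}\omega_d$, $R_{ac}=R_{abc}{}^{b}$, $R=R_a{}^a$. With $P^{abcd}=\partial\mathcal L/\partial R_{abcd}$ (with the symmetries of the Riemann tensor), its field equations are $\mathcal E^{ab}=0$, where $$\mathcal E^{ab}=P^{acde}R^{b}{}_{cde}-\tfrac12 g^{ab}\mathcal L-2\nabla_c\nabla_dP^{acdb}.$$ * $\mathcal L$ is a *Cosmological Gravity* if, for $k\in\{-1,0,1\}$, all components $\mathcal E^{ab}$ on the metrics $-F(t)\,dt^2+a(t)^2\big(\tfrac{dr^2}{1-kr^2}+r^2(d\theta^2+\sin^2\theta\,d\varphi^2)\big)$, with $a,F>0$ smooth, depend on $a$ and $F$ only through $a,\dot a,\ddot a,F,\dot F,\ddot F$ (second order in time derivatives). * $\mathcal L$ is a *Generalized Quasitopological Gravity* (GQTG) if there is a function $H(r,f,f',f'')$ such that, for every smooth nowhere-vanishing $f$ on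 an open interval $I\subseteq(0,\infty)$, on the metric $ds_f^2=-f(r)\,dt^2+\tfrac{dr^2}{f(r)}+r^2(d\theta^2+\sin^2\theta\,d\varphi^2)$ one has identically $\mathcal E^t{}_t=\mathcal E^r{}_r$ and $r^2\mathcal E^t{}_t=\tfrac{d}{dr}H(r,f,f',f'')$, and all field equations $\mathcal E^{ab}=0$ hold on $I$ if and only if $H(r,f,f',f'')$ is constant on $I$. (The solution is fully described by the single function $f$, whose equation integrates to one of order at most two.) * $\mathcal L$ is a *Cosmological GQTG* if it is both. **Invariants.** Let $Z_{ab}=R_{ab}-\tfrac14 g_{ab}R$, let $W_{abcd}$ be the Weyl tensor, and put $Z_2=Z_{ab}Z^{ab}$, $Z_3=Z_{ab}Z^b{}_cZ^{ca}$, $Z_4=Z_{ab}Z^b{}_cZ^c{}_dZ^{da}$. Let $\pi_l=0$ for $l$ even and $\pi_l=1$ for $l$ odd, and $$\mathcal W_l=(W_{mnop}W^{mnop})^{\frac{l-\pi_l}2}\big((1-\pi_l)W_{abcd}W^{abcd}+2\pi_l W_{abcd}W^{cdef}W_{ef}{}^{ab}\big).$$ For $n\ge3$ define $$\begin{aligned}\mathcal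 S_{(n)}={}&R^n-6n(n-1)R^{n-2}Z_2+18n(n-1)(n-2)R^{n-3}W_{abcd}Z^{ac}Z^{bd}\\&+\sum_{l=0}^{n-2}\lambda^{(1)}_l\,\mathcal W_l\,R^{n-l-4}\big(R^2+\lambda^{(2)}_lZ_2\big),\end{aligned}$$ $$\lambda^{(1)}_l=\frac{(-1)^l3^{l/2+\pi_l/2+1}(l+1)(3l+4)\,n!}{2(l+2)!\,(n-l-2)!},\qquad \lambda^{(2)}_l=-12\,\frac{(n-l-2)(n-l-3)}{(l+1)(3l+4)}$$ (the product $R^{n-l-4}(R^2+\lambda^{(2)}_lZ_2)$ is expanded; since $\lambda^{(2)}_l=0$ for $l=n-2,n-3$, it is a polynomial). Further $\mathcal T^{\mathcal S}_{(3)}=144\,Z_3$ and, for $n\ge4$, $$\mathcal T^{\mathcal S}_{(n)}=\tfrac{8\omega_{n,3}}3R^{n-3}Z_3+\sum_{l=4}^n\omega_{n,l}R^{n-l}Z_2^{\frac{l-4-\pi_l}2}\Big((1-\pi_l)(Z_2^2-4Z_4)+\tfrac{8\pi_l}3Z_2Z_3\Big),$$ $$\omega_{n,l}=2^{\,l-2-\pi_l}\,3^{(2+l+\pi_l)/2}\binom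 nl(l-1).$$ **Theorem.** Let $\mathcal Q_{(1)}=R$, $\mathcal Q_{(2)}=R^2+6W_{abcd}W^{abcd}-12Z_{ab}Z^{ab}$, and $\mathcal Q_{(n)}=\mathcal S_{(n)}+\mathcal T^{\mathcal S}_{(n)}$ for $n\ge3$. Then for every curvature order $n\ge1$ the theory $\mathcal Q_{(n)}$ is a Cosmological GQTG in $D=4$. Moreover, for every $n\ge3$, $\mathcal T^{\mathcal S}_{(n)}$ vanishes identically on all metrics $ds_f^2$. -/

import Mathlib

open scoped ContDiff

noncomputable section

namespace CosmoGQTG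

/-! ## Component tensor calculus in a four-dimensional coordinate chart -/

/-- Coordinates of a point of the chart. -/
abbrev Pt := Fin 4 → ℝ

/-- Components `g_ab` of a metric at a point. -/
abbrev Mat := Matrix (Fin 4) (Fin 4) ℝ

/-- Components of a rank-four tensor at a point. -/
abbrev Tensor4 := Fin 4 → Fin 4 → Fin 4 → Fin 4 → ℝ

/-- The partial derivative `∂_d φ`. -/
def pd (d : Fin 4) (φ : Pt → ℝ) (x : Pt) : ℝ :=
  deriv (fun s => φ (Function.update x d s)) (x d)

/-- Christoffel symbols: `christoffel g c a b` is `Γ^c_{ab}`. -/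
def christoffel (g : Pt → Mat) (c a b : Fin 4) (x : Pt) : ℝ :=
  (1 / 2) * ∑ d, ((g x)⁻¹ c d) *
    (pd a (fun y => g y b d) x + pd b (fun y => g y a d) x - pd d (fun y => g y a b) x)

/-- `R_{abc}{}^d = ∂_b Γ^d_{ac} - ∂_a Γ^d_{bc} + Γ^e_{ca} Γ^d_{be} - Γ^e_{cb} Γ^d_{ae}`. -/
def riemannUp (g : Pt → Mat) (a b c d : Fin 4) (x : Pt) : ℝ :=
  pd b (christoffel g d a c) x - pd a (christoffel g d b c) x
    + ∑ e, (christoffel g e c a x * christoffel g d b e x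
      - christoffel g e c b x * christoffel g d a e x)

/-- `R_{abcd} = R_{abc}{}^e g_{ed}`. -/
def riemann (g : Pt → Mat) (x : Pt) : Tensor4 := fun a b c d =>
  ∑ e, riemannUp g a b c e x * g x e d

/-! ## Algebraic curvature invariants

In this part `g` is the metric and `Rm` the tensor `R_{abcd}` at a point. -/

/-- `R_{ac} = R_{abc}{}^b`. -/
def ricci (g : Mat) (Rm : Tensor4) : Mat := fun a c =>
  ∑ b, ∑ d, g⁻¹ b d * Rm a b c d

/-- The Ricci scalar. -/
def scalarR (g : Mat) (Rm : Tensor4) : ℝ :=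
  ∑ a, ∑ b, g⁻¹ a b * ricci g Rm a b

/-- The traceless Ricci tensor `Z_{ab} = R_{ab} - g_{ab} R / 4`. -/
def tracelessRicci (g : Mat) (Rm : Tensor4) : Mat := fun a b =>
  ricci g Rm a b - (1 / 4) * g a b * scalarR g Rm

/-- The Weyl tensor `W_{abcd}` in dimension four. -/
def weyl (g : Mat) (Rm : Tensor4) : Tensor4 := fun a b c d =>
  Rm a b c d
    + (1 / 2) * ((g b c * ricci g Rm d a - g b d * ricci g Rm c a)
      - (g a c * ricci g Rm d b - g a d * ricci g Rm c b))
    + (1 / 6) * scalarR g Rm * (g c a * g b d - g c b * g a d)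

/-- `Z^a{}_b`. -/
def zMixed (g : Mat) (Rm : Tensor4) : Mat := g⁻¹ * tracelessRicci g Rm

/-- `Z^{ab}`. -/
def zUp (g : Mat) (Rm : Tensor4) : Mat := g⁻¹ * tracelessRicci g Rm * g⁻¹

/-- `weylMixed g Rm a b c d` is `W_{ab}{}^{cd}`. -/
def weylMixed (g : Mat) (Rm : Tensor4) : Tensor4 := fun a b c d =>
  ∑ e, ∑ f, weyl g Rm a b e f * g⁻¹ e c * g⁻¹ f d

/-- `Z_2 = Z_{ab} Z^{ab}`. -/
def Z2 (g : Mat) (Rm : Tensor4) : ℝ := (zMixed g Rm ^ 2).trace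

/-- `Z_3 = Z_{ab} Z^b{}_c Z^{ca}`. -/
def Z3 (g : Mat) (Rm : Tensor4) : ℝ := (zMixed g Rm ^ 3).trace

/-- `Z_4 = Z_{ab} Z^b{}_c Z^c{}_d Z^{da}`. -/
def Z4 (g : Mat) (Rm : Tensor4) : ℝ := (zMixed g Rm ^ 4).trace

/-- `W_{abcd} W^{abcd}`, written as `W_{ab}{}^{cd} W_{cd}{}^{ab}` (pair symmetry). -/
def weylSq (g : Mat) (Rm : Tensor4) : ℝ :=
  ∑ a, ∑ b, ∑ c, ∑ d, weylMixed g Rm a b c d * weylMixed g Rm c d a b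

/-- `W_{abcd} W^{cdef} W_{ef}{}^{ab}`, written as `W_{ab}{}^{cd} W_{cd}{}^{ef} W_{ef}{}^{ab}`. -/
def weylCube (g : Mat) (Rm : Tensor4) : ℝ :=
  ∑ a, ∑ b, ∑ c, ∑ d, ∑ e, ∑ f,
    weylMixed g Rm a b c d * weylMixed g Rm c d e f * weylMixed g Rm e f a b

/-- `W_{abcd} Z^{ac} Z^{bd}`. -/
def weylZZ (g : Mat) (Rm : Tensor4) : ℝ :=
  ∑ a, ∑ b, ∑ c, ∑ d, weyl g Rm a b c d * zUp g Rm a c * zUp g Rm b d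

/-! ## Higher-curvature theories and their field equations -/

/-- A Lagrangian `L(g^{ab}, R_{abcd})` without derivatives of the curvature. -/
abbrev Lagrangian := Mat → Tensor4 → ℝ

/-- The Lagrangian evaluated on a metric. -/
def onMetric (L : Lagrangian) (g : Pt → Mat) (x : Pt) : ℝ := L (g x) (riemann g x)

/-- The unit array at position `(a, b, c, d)`. -/
def unit4 (a b c d : Fin 4) : Tensor4 := fun i j k l =>
  if i = a ∧ j = b ∧ k = c ∧ l = d then 1 else 0

/-- Antisymmetrization in the first and in the second pair of indices. -/
def antisymPairs (T : Tensor4) : Tensor4 := fun i j k l =>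
  (1 / 4) * (T i j k l - T j i k l - T i j l k + T j i l k)

/-- Symmetrization under exchange of the two pairs. -/
def symPairs (T : Tensor4) : Tensor4 := fun i j k l => (1 / 2) * (T i j k l + T k l i j)

/-- Removal of the totally antisymmetric part of an array with the symmetries
`T_{ijkl} = -T_{jikl} = -T_{ijlk} = T_{klij}`. -/
def removeCyclic (T : Tensor4) : Tensor4 := fun i j k l =>
  T i j k l - (1 / 3) * (T i j k l + T i k l j + T i l j k)

/-- The orthogonal projection onto the arrays with the algebraic symmetries of a Riemann tensor. -/
def curvProj (T : Tensor4) : Tensor4 := removeCyclic (symPairs (antisymPairs T))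

/-- `P^{abcd} = ∂L/∂R_{abcd}` along a metric: the tensor with the symmetries of the Riemann tensor
such that `δL = P^{abcd} δR_{abcd}` for variations `δR_{abcd}` with these symmetries. -/
def momentum (L : Lagrangian) (g : Pt → Mat) (a b c d : Fin 4) (x : Pt) : ℝ :=
  deriv (fun ε : ℝ => L (g x) (riemann g x + ε • curvProj (unit4 a b c d))) 0

/-- `∇_d P^{acdb}` (the arguments are in the order `a c b`). -/
def divMomentum (L : Lagrangian) (g : Pt → Mat) (a c b : Fin 4) (x : Pt) : ℝ :=
  ∑ d, (pd d (momentum L g a c d b) x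
    + ∑ m, (christoffel g a d m x * momentum L g m c d b x
      + christoffel g c d m x * momentum L g a m d b x
      + christoffel g d d m x * momentum L g a c m b x
      + christoffel g b d m x * momentum L g a c d m x))

/-- `∇_c ∇_d P^{acdb}`. -/
def divDivMomentum (L : Lagrangian) (g : Pt → Mat) (a b : Fin 4) (x : Pt) : ℝ :=
  ∑ c, (pd c (divMomentum L g a c b) x
    + ∑ m, (christoffel g a c m x * divMomentum L g m c b x
      + christoffel g c c m x * divMomentum L g a m b x
      + christoffel g b c m x * divMomentum L g a c m x))

/-- The gravitational field equations of the action `∫ √|g| L(g^{ab}, R_{abcd})`,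
`E^{ab} = P^{acde} R^b{}_{cde} - (1/2) g^{ab} L - 2 ∇_c ∇_d P^{acdb}`,
where `δ(√|g| L) = √|g| E_{ab} δg^{ab}` up to a total divergence. -/
def fieldEq (L : Lagrangian) (g : Pt → Mat) (a b : Fin 4) (x : Pt) : ℝ :=
  (∑ c, ∑ d, ∑ e, ∑ m, momentum L g a c d e x * (g x)⁻¹ b m * riemann g x m c d e)
    - (1 / 2) * (g x)⁻¹ a b * onMetric L g x
    - 2 * divDivMomentum L g a b x

/-- The mixed components `E^a{}_b` of the field equations. -/
def fieldEqMixed (L : Lagrangian) (g : Pt → Mat) (a b : Fin 4) (x : Pt) : ℝ :=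
  ∑ c, fieldEq L g a c x * g x c b

/-! ## FLRW and static spherically symmetric configurations -/

/-- The FLRW metric `-F(t) dt² + a(t)² (dr² / (1 - k r²) + r² (dθ² + sin² θ dφ²))`
in the coordinates `(t, r, θ, φ) = (x 0, x 1, x 2, x 3)`. -/
def flrw (k : ℝ) (a F : ℝ → ℝ) (x : Pt) : Mat :=
  Matrix.diagonal ![-F (x 0), (a (x 0)) ^ 2 / (1 - k * (x 1) ^ 2), (a (x 0)) ^ 2 * (x 1) ^ 2,
    (a (x 0)) ^ 2 * (x 1) ^ 2 * (Real.sin (x 2)) ^ 2]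

/-- The metric `-f(r) dt² + dr² / f(r) + r² (dθ² + sin² θ dφ²)`. -/
def sss (f : ℝ → ℝ) (x : Pt) : Mat :=
  Matrix.diagonal ![-f (x 1), (f (x 1))⁻¹, (x 1) ^ 2, (x 1) ^ 2 * (Real.sin (x 2)) ^ 2]

/-- Cosmological Gravity: on FLRW metrics the field equations contain time derivatives of the scale
factor `a` and of the lapse function `F` up to second order only. -/
def IsCosmologicalGravity (L : Lagrangian) : Prop :=
  ∀ k : ℝ, (k = -1 ∨ k = 0 ∨ k = 1) →
    ∃ e : Fin 4 → Fin 4 → Pt → ℝ → ℝ → ℝ → ℝ → ℝ → ℝ → ℝ,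
      ∀ (a F : ℝ → ℝ) (J : Set ℝ), IsOpen J →
        ContDiffOn ℝ ∞ a J → ContDiffOn ℝ ∞ F J →
        (∀ t ∈ J, 0 < a t) → (∀ t ∈ J, 0 < F t) →
        ∀ x : Pt, x 0 ∈ J → 0 < x 1 → 0 < 1 - k * (x 1) ^ 2 → Real.sin (x 2) ≠ 0 →
          ∀ i j : Fin 4,
            fieldEq L (flrw k a F) i j x =
              e i j x (a (x 0)) (deriv a (x 0)) (deriv (deriv a) (x 0))
                (F (x 0)) (deriv F (x 0)) (deriv (deriv F) (x 0))

/-- Generalized Quasitopological Gravity: on the metrics `sss f` the field equations satisfy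
`E^t{}_t = E^r{}_r` identically in `f` (the condition for solutions to be described by a single
function), the equation of motion `r² E^t{}_t = 0` of `f` is a total derivative `d/dr` of an
expression `H` of at most second order in derivatives of `f`, and the whole system of field
equations is equivalent to the integrated equation `H = const`. -/
def IsGQTG (L : Lagrangian) : Prop :=
  ∃ H : ℝ → ℝ → ℝ → ℝ → ℝ,
    ∀ (f : ℝ → ℝ) (I : Set ℝ), IsOpen I → IsPreconnected I → I ⊆ Set.Ioi 0 →
      ContDiffOn ℝ ∞ f I → (∀ r ∈ I, f r ≠ 0) →
      (∀ x : Pt, x 1 ∈ I → Real.sin (x 2) ≠ 0 →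
        fieldEqMixed L (sss f) 0 0 x = fieldEqMixed L (sss f) 1 1 x ∧
        HasDerivAt (fun r => H r (f r) (deriv f r) (deriv (deriv f) r))
          ((x 1) ^ 2 * fieldEqMixed L (sss f) 0 0 x) (x 1)) ∧
      ((∀ x : Pt, x 1 ∈ I → Real.sin (x 2) ≠ 0 → ∀ i j : Fin 4, fieldEq L (sss f) i j x = 0) ↔
        ∃ C : ℝ, ∀ r ∈ I, H r (f r) (deriv f r) (deriv (deriv f) r) = C)

/-- Cosmological GQTG: a Cosmological Gravity which is also a GQTG. -/
def IsCosmologicalGQTG (L : Lagrangian) : Prop := IsCosmologicalGravity L ∧ IsGQTG L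

/-! ## The explicit theories -/

/-- `𝒲_l`, equal to `(W²)^{l/2+1}` for even `l` and to `2 (W²)^{(l-1)/2} W³` for odd `l`. -/
def calW (l : ℕ) : Lagrangian := fun g Rm =>
  weylSq g Rm ^ ((l - l % 2) / 2) *
    ((1 - ((l % 2 : ℕ) : ℝ)) * weylSq g Rm + 2 * ((l % 2 : ℕ) : ℝ) * weylCube g Rm)

/-- `λ^{(1)}_l` at curvature order `n`. -/
def lambda1 (n l : ℕ) : ℝ :=
  (-1) ^ l * 3 ^ ((l + l % 2) / 2 + 1) * ((l : ℝ) + 1) * (3 * (l : ℝ) + 4) * (n.factorial : ℝ) /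
    (2 * ((l + 2).factorial : ℝ) * ((n - l - 2).factorial : ℝ))

/-- `λ^{(2)}_l` at curvature order `n`. -/
def lambda2 (n l : ℕ) : ℝ :=
  -12 * (((n : ℝ) - l - 2) * ((n : ℝ) - l - 3)) / (((l : ℝ) + 1) * (3 * (l : ℝ) + 4))

/-- The Lagrangians `S_(n)`. The factor `R^{n-l-4} (R² + λ^{(2)}_l Z_2)` is expanded; its second term
has coefficient zero when `n - l - 4 < 0`, so truncated subtraction is harmless there. -/
def theoryS (n : ℕ) : Lagrangian := fun g Rm =>
  if n = 1 then scalarR g Rm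
  else if n = 2 then scalarR g Rm ^ 2 + 6 * weylSq g Rm - 12 * Z2 g Rm
  else
    scalarR g Rm ^ n - 6 * (n : ℝ) * ((n : ℝ) - 1) * scalarR g Rm ^ (n - 2) * Z2 g Rm
      + 18 * (n : ℝ) * ((n : ℝ) - 1) * ((n : ℝ) - 2) * scalarR g Rm ^ (n - 3) * weylZZ g Rm
      + ∑ l ∈ Finset.range (n - 1), lambda1 n l * calW l g Rm *
          (scalarR g Rm ^ (n - l - 2) + lambda2 n l * scalarR g Rm ^ (n - l - 4) * Z2 g Rm)

/-- `ω_{n,l}`, used for `3 ≤ l ≤ n`. -/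
def omega (n l : ℕ) : ℝ :=
  2 ^ (l - 2 - l % 2) * 3 ^ ((2 + l + l % 2) / 2) * (n.choose l : ℝ) * ((l : ℝ) - 1)

/-- The combinations `T^S_(n)` of traceless Ricci tensors, used for `n ≥ 3`. -/
def theoryT (n : ℕ) : Lagrangian := fun g Rm =>
  if n = 3 then 144 * Z3 g Rm
  else
    8 * omega n 3 / 3 * scalarR g Rm ^ (n - 3) * Z3 g Rm
      + ∑ l ∈ Finset.Icc 4 n, omega n l * scalarR g Rm ^ (n - l) *
          Z2 g Rm ^ ((l - 4 - l % 2) / 2) *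
          ((1 - ((l % 2 : ℕ) : ℝ)) * (Z2 g Rm ^ 2 - 4 * Z4 g Rm)
            + 8 * ((l % 2 : ℕ) : ℝ) / 3 * (Z2 g Rm * Z3 g Rm))

/-- The Lagrangians `Q_(n)`. -/
def theoryQ (n : ℕ) : Lagrangian := fun g Rm =>
  if n = 1 then scalarR g Rm
  else if n = 2 then scalarR g Rm ^ 2 + 6 * weylSq g Rm - 12 * Z2 g Rm
  else theoryS n g Rm + theoryT n g Rm

end CosmoGQTG

end

noncomputable section

namespace CosmoGQTG

open Matrix

/-! Both families of metrics are diagonal, and in these coordinates their curvature is diagonal as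
well: it is given by one sectional curvature `K a b` for each coordinate plane (`diagCurv`). The
seven scalars from which the Lagrangian is built then depend on `K` alone and not on the metric
entries, so `theoryQ n` becomes a function `redQ n K`. Invariance under reflections of the axes
kills every component of P^{abcd} that is not of the form P^{abab} up to the antisymmetries
(`momentum_diagCurv`). Invariance under permutations identifies the remaining components along each
orbit, so P is already determined by the derivatives of the Lagrangian restricted to the two
families (`secP_secSSS`, `secP_secFLRW`).

The coefficients of the theory are chosen so that the restricted Lagrangians are binomial sums. Put
h(x) = (12x)^n, which is `pot n 0`. With static curvatures A (plane tr), B (the four mixed planes)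
and D (plane θφ), L = h(B) + (A+D-2B)/6 h'(B) + (A-B)(D-B)/6 h''(B) by `redQ_secSSS_eq_pot`; with
FLRW curvatures α (planes containing t) and β (spatial planes), L = h(β) + (α-β)/2 h'(β) by
`redQ_secFLRW_eq_pot`.

FLRW: the derivatives of L per plane are p = h'(β)/6 and q = h'(β)/6 + (α-β)h''(β)/6. Since β' =
2(a'/a)(α-β), one has p' = 2(a'/a)(q-p), which is the condition for P to be divergence free
(`divMomentum_flrw`). What is left of the field equations is algebraic in α and β, hence of second
order.

Static case: let u, v, w be the derivatives of L per plane. The relations B' = (A-B)/r and D' =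
2(B-D)/r give r u' = 4v - 2u - h'(B)/3 (`hasDerivAt_sssU`). This makes v' cancel in E^t_t - E^r_r
and the difference vanish (`sssEq_zero_eq_one`); the equation that is left is the derivative of the
explicit `sssH` (`hasDerivAt_sssH`). The contracted Bianchi identity (`hasDerivAt_sssE_one`) then
forces the angular equations once E^t_t = E^r_r = 0. -/

/-- The curvature tensor with sectional curvatures `K a b` in the coordinate planes of the diagonal
metric with entries `G`. -/
def diagCurv (G : Fin 4 → ℝ) (K : Fin 4 → Fin 4 → ℝ) : Tensor4 := fun a b c d =>
  K a b * G a * G b * ((if a = c then if b = d then 1 else 0 else 0)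
    - (if a = d then if b = c then 1 else 0 else 0))

/-- Ricci eigenvalues of `diagCurv G K`. -/
def secRic (K : Fin 4 → Fin 4 → ℝ) (a : Fin 4) : ℝ := ∑ b, K a b

/-- Ricci scalar of `diagCurv G K`. -/
def secR (K : Fin 4 → Fin 4 → ℝ) : ℝ := ∑ a, secRic K a

/-- Traceless Ricci eigenvalues of `diagCurv G K`. -/
def secZ (K : Fin 4 → Fin 4 → ℝ) (a : Fin 4) : ℝ := secRic K a - secR K / 4

/-- Weyl sectional curvatures of `diagCurv G K`. -/
def secW (K : Fin 4 → Fin 4 → ℝ) (a b : Fin 4) : ℝ :=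
  if a = b then 0 else K a b - (secRic K a + secRic K b) / 2 + secR K / 6

/-- Arrays of sectional curvatures: symmetric with zero diagonal. -/
structure IsSec (K : Fin 4 → Fin 4 → ℝ) : Prop where
  symm : ∀ a b, K a b = K b a
  diag : ∀ a, K a a = 0

theorem inv_diagonal_of_ne_zero {G : Fin 4 → ℝ} (hG : ∀ i, G i ≠ 0) :
    (diagonal G : Mat)⁻¹ = diagonal (fun i => (G i)⁻¹) := by
  apply Matrix.inv_eq_left_inv
  rw [diagonal_mul_diagonal, ← diagonal_one]
  congr 1
  funext i
  exact inv_mul_cancel₀ (hG i)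

/-! ### Curvature invariants in terms of sectional curvatures -/

section Diag

variable {G : Fin 4 → ℝ} {K : Fin 4 → Fin 4 → ℝ}

theorem ricci_diagCurv (hG : ∀ i, G i ≠ 0) (hK : IsSec K) :
    ricci (diagonal G) (diagCurv G K) = diagonal (fun a => G a * secRic K a) := by
  ext a c
  have key : ∀ b, ∑ d, (diagonal G : Mat)⁻¹ b d * diagCurv G K a b c d =
      if a = c then G a * K a b else 0 := by
    intro b
    rw [inv_diagonal_of_ne_zero hG]
    simp only [diagonal_apply, ite_mul, zero_mul, Finset.sum_ite_eq, Finset.mem_univ, if_true,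
      diagCurv]
    have := hG b
    by_cases h1 : a = c
    · subst h1
      by_cases h2 : a = b
      · subst h2; simp [hK.diag]
      · simp [h2]; field_simp
    · by_cases h2 : a = b
      · subst h2; simp [hK.diag]
      · simp [h1, h2]
  simp only [ricci, key, diagonal_apply, secRic, Finset.mul_sum]
  split_ifs <;> simp

theorem scalarR_diagCurv (hG : ∀ i, G i ≠ 0) (hK : IsSec K) :
    scalarR (diagonal G) (diagCurv G K) = secR K := by
  simp only [scalarR, ricci_diagCurv hG hK, inv_diagonal_of_ne_zero hG, diagonal_apply, ite_mul,
    zero_mul, Finset.sum_ite_eq, Finset.mem_univ, if_true, secR]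
  exact Finset.sum_congr rfl fun a _ => by have := hG a; field_simp

theorem tracelessRicci_diagCurv (hG : ∀ i, G i ≠ 0) (hK : IsSec K) :
    tracelessRicci (diagonal G) (diagCurv G K) = diagonal (fun a => G a * secZ K a) := by
  ext a b
  simp only [tracelessRicci, ricci_diagCurv hG hK, scalarR_diagCurv hG hK, diagonal_apply, secZ]
  split_ifs <;> ring

theorem zMixed_diagCurv (hG : ∀ i, G i ≠ 0) (hK : IsSec K) :
    zMixed (diagonal G) (diagCurv G K) = diagonal (secZ K) := by
  rw [zMixed, tracelessRicci_diagCurv hG hK, inv_diagonal_of_ne_zero hG, diagonal_mul_diagonal]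
  congr 1
  funext i
  have := hG i
  field_simp

theorem zUp_diagCurv (hG : ∀ i, G i ≠ 0) (hK : IsSec K) :
    zUp (diagonal G) (diagCurv G K) = diagonal (fun a => secZ K a * (G a)⁻¹) := by
  rw [zUp, ← zMixed, zMixed_diagCurv hG hK, inv_diagonal_of_ne_zero hG, diagonal_mul_diagonal]

/-- The trace terms are products of two diagonal matrices, antisymmetrised in each index pair, so
they live on coordinate planes just like the curvature itself. -/
theorem weyl_diagCurv (hG : ∀ i, G i ≠ 0) (hK : IsSec K) :
    weyl (diagonal G) (diagCurv G K) = diagCurv G (secW K) := by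
  funext a b c d
  simp only [weyl, ricci_diagCurv hG hK, scalarR_diagCurv hG hK, diagonal_apply, diagCurv, secW]
  by_cases hab : a = b
  · subst hab
    by_cases hac : a = c <;> by_cases had : a = d <;> simp [hac, had, eq_comm]
  · by_cases hac : a = c
    · subst hac
      by_cases hbd : b = d
      · subst hbd; simp [hab, Ne.symm hab]; ring
      · simp [hab, hbd, Ne.symm hab, Ne.symm hbd]
    · by_cases had : a = d
      · subst had
        by_cases hbc : b = c
        · subst hbc; simp [hab, Ne.symm hab]; ring
        · simp [hab, hbc, hac, Ne.symm hab, Ne.symm hac, Ne.symm hbc]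
      · simp [hac, had, Ne.symm hac, Ne.symm had]

theorem secW_symm (hK : IsSec K) (a b : Fin 4) : secW K a b = secW K b a := by
  simp only [secW, hK.symm a b, eq_comm (a := a), add_comm (secRic K a)]

theorem secW_self (a : Fin 4) : secW K a a = 0 := by simp [secW]

theorem weylMixed_diagCurv (hG : ∀ i, G i ≠ 0) (hK : IsSec K) (a b c d : Fin 4) :
    weylMixed (diagonal G) (diagCurv G K) a b c d =
      secW K a b * ((if a = c then if b = d then 1 else 0 else 0)
        - (if a = d then if b = c then 1 else 0 else 0)) := by
  simp only [weylMixed, weyl_diagCurv hG hK, inv_diagonal_of_ne_zero hG, diagonal_apply, mul_ite,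
    mul_zero, Finset.sum_ite_eq', Finset.mem_univ, if_true, diagCurv]
  have ha := hG a
  have hb := hG b
  have hc := hG c
  have hd := hG d
  by_cases h1 : a = c <;> by_cases h2 : b = d <;> by_cases h3 : a = d <;> by_cases h4 : b = c <;>
    simp [h1, h2, h3, h4] <;> grind

/-- On bivectors the Weyl operator is diagonal in the coordinate planes, so contracting with it
antisymmetrises and multiplies by an eigenvalue. The quadratic invariant uses this once and the
cubic one twice. -/
theorem sum_weylMixed_mul (hG : ∀ i, G i ≠ 0) (hK : IsSec K) (a b : Fin 4)
    (φ : Fin 4 → Fin 4 → ℝ) :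
    ∑ c, ∑ d, weylMixed (diagonal G) (diagCurv G K) a b c d * φ c d =
      secW K a b * (φ a b - φ b a) := by
  simp only [weylMixed_diagCurv hG hK, mul_sub, sub_mul, Finset.sum_sub_distrib, mul_ite, ite_mul,
    mul_one, mul_zero, zero_mul]
  congr 1
  · have : ∀ c, (∑ d, if a = c then if b = d then secW K a b * φ c d else 0 else 0) =
        if a = c then secW K a b * φ c b else 0 := by
      intro c; split_ifs <;> simp
    simp [this]
  · have : ∀ c, (∑ d, if a = d then if b = c then secW K a b * φ c d else 0 else 0) =
        if b = c then secW K a b * φ c a else 0 := by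
      intro c; simp
    simp [this]

theorem weylSq_diagCurv (hG : ∀ i, G i ≠ 0) (hK : IsSec K) :
    weylSq (diagonal G) (diagCurv G K) = 2 * ∑ a, ∑ b, secW K a b ^ 2 := by
  simp only [weylSq, Finset.mul_sum]
  refine Finset.sum_congr rfl fun a _ => Finset.sum_congr rfl fun b _ => ?_
  rw [sum_weylMixed_mul hG hK a b
    (fun c d => weylMixed (diagonal G) (diagCurv G K) c d a b)]
  simp only [weylMixed_diagCurv hG hK]
  by_cases h : a = b
  · subst h; simp [secW_self]
  · simp [h, Ne.symm h, secW_symm hK b a]; ring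

theorem weylCube_diagCurv (hG : ∀ i, G i ≠ 0) (hK : IsSec K) :
    weylCube (diagonal G) (diagCurv G K) = 4 * ∑ a, ∑ b, secW K a b ^ 3 := by
  simp only [weylCube, Finset.mul_sum]
  refine Finset.sum_congr rfl fun a _ => Finset.sum_congr rfl fun b _ => ?_
  have h1 : ∀ c d, (∑ e, ∑ f, weylMixed (diagonal G) (diagCurv G K) a b c d *
      weylMixed (diagonal G) (diagCurv G K) c d e f *
      weylMixed (diagonal G) (diagCurv G K) e f a b) =
      weylMixed (diagonal G) (diagCurv G K) a b c d * (secW K c d *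
        (weylMixed (diagonal G) (diagCurv G K) c d a b
          - weylMixed (diagonal G) (diagCurv G K) d c a b)) := by
    intro c d
    rw [← sum_weylMixed_mul hG hK c d
      (fun e f => weylMixed (diagonal G) (diagCurv G K) e f a b)]
    simp only [Finset.mul_sum, mul_assoc]
  simp only [h1]
  rw [sum_weylMixed_mul hG hK a b (fun c d => secW K c d *
        (weylMixed (diagonal G) (diagCurv G K) c d a b
          - weylMixed (diagonal G) (diagCurv G K) d c a b))]
  simp only [weylMixed_diagCurv hG hK]
  by_cases h : a = b
  · subst h; simp [secW_self]
  · simp [h, Ne.symm h, secW_symm hK b a]; ring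

theorem weylZZ_diagCurv (hG : ∀ i, G i ≠ 0) (hK : IsSec K) :
    weylZZ (diagonal G) (diagCurv G K) = ∑ a, ∑ b, secW K a b * secZ K a * secZ K b := by
  simp only [weylZZ]
  refine Finset.sum_congr rfl fun a _ => Finset.sum_congr rfl fun b _ => ?_
  simp only [zUp_diagCurv hG hK, diagonal_apply, weyl_diagCurv hG hK, mul_ite, mul_zero, ite_mul,
    zero_mul, Finset.sum_ite_eq, Finset.mem_univ, if_true, diagCurv]
  have ha := hG a
  have hb := hG b
  by_cases h : a = b
  · subst h; simp [secW_self]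
  · simp [h]; field_simp

theorem Z2_diagCurv (hG : ∀ i, G i ≠ 0) (hK : IsSec K) :
    Z2 (diagonal G) (diagCurv G K) = ∑ a, secZ K a ^ 2 := by
  simp [Z2, zMixed_diagCurv hG hK, diagonal_pow, trace_diagonal]

theorem Z3_diagCurv (hG : ∀ i, G i ≠ 0) (hK : IsSec K) :
    Z3 (diagonal G) (diagCurv G K) = ∑ a, secZ K a ^ 3 := by
  simp [Z3, zMixed_diagCurv hG hK, diagonal_pow, trace_diagonal]

theorem Z4_diagCurv (hG : ∀ i, G i ≠ 0) (hK : IsSec K) :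
    Z4 (diagonal G) (diagCurv G K) = ∑ a, secZ K a ^ 4 := by
  simp [Z4, zMixed_diagCurv hG hK, diagonal_pow, trace_diagonal]

end Diag

/-- The Lagrangian sees the metric and the curvature only through seven scalars, so every symmetry
of the theory can be checked on these. -/
theorem theoryQ_congr (n : ℕ) {g g' : Mat} {Rm Rm' : Tensor4}
    (hR : scalarR g Rm = scalarR g' Rm') (h2 : Z2 g Rm = Z2 g' Rm') (h3 : Z3 g Rm = Z3 g' Rm')
    (h4 : Z4 g Rm = Z4 g' Rm') (hW2 : weylSq g Rm = weylSq g' Rm')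
    (hW3 : weylCube g Rm = weylCube g' Rm') (hWZ : weylZZ g Rm = weylZZ g' Rm') :
    theoryQ n g Rm = theoryQ n g' Rm' := by
  simp only [theoryQ, theoryS, theoryT, calW, hR, h2, h3, h4, hW2, hW3, hWZ]

/-! ### Invariance under relabelling of the axes -/

section Permutation

variable (K : Fin 4 → Fin 4 → ℝ) (σ : Equiv.Perm (Fin 4))

theorem secRic_perm (a : Fin 4) : secRic (fun a b => K (σ a) (σ b)) a = secRic K (σ a) :=
  Equiv.sum_comp σ fun b => K (σ a) b

theorem secR_perm : secR (fun a b => K (σ a) (σ b)) = secR K := by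
  simp only [secR, secRic_perm]
  exact Equiv.sum_comp σ fun a => secRic K a

theorem secZ_perm (a : Fin 4) : secZ (fun a b => K (σ a) (σ b)) a = secZ K (σ a) := by
  simp only [secZ, secRic_perm, secR_perm]

theorem secW_perm (a b : Fin 4) : secW (fun a b => K (σ a) (σ b)) a b = secW K (σ a) (σ b) := by
  simp only [secW, secRic_perm, secR_perm, σ.injective.eq_iff]

variable {K}

theorem isSec_perm (hK : IsSec K) : IsSec (fun a b => K (σ a) (σ b)) :=
  ⟨fun _ _ => hK.symm _ _, fun _ => hK.diag _⟩

/-- On diagonal curvatures `theoryQ` only depends on the sectional curvatures up to a permutation of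
the axes. -/
theorem theoryQ_diagCurv_perm (n : ℕ) {G G' : Fin 4 → ℝ} (hG : ∀ i, G i ≠ 0) (hG' : ∀ i, G' i ≠ 0)
    (hK : IsSec K) :
    theoryQ n (diagonal G') (diagCurv G' fun a b => K (σ a) (σ b)) =
      theoryQ n (diagonal G) (diagCurv G K) := by
  have hσ := isSec_perm σ hK
  have h2 : ∀ φ : Fin 4 → Fin 4 → ℝ, ∑ a, ∑ b, φ (σ a) (σ b) = ∑ a, ∑ b, φ a b := by
    intro φ
    rw [← Equiv.sum_comp σ fun a => ∑ b, φ a b]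
    exact Finset.sum_congr rfl fun a _ => Equiv.sum_comp σ fun b => φ (σ a) b
  apply theoryQ_congr
  · rw [scalarR_diagCurv hG' hσ, scalarR_diagCurv hG hK, secR_perm]
  · rw [Z2_diagCurv hG' hσ, Z2_diagCurv hG hK]
    simp only [secZ_perm]
    exact Equiv.sum_comp σ fun a => secZ K a ^ 2
  · rw [Z3_diagCurv hG' hσ, Z3_diagCurv hG hK]
    simp only [secZ_perm]
    exact Equiv.sum_comp σ fun a => secZ K a ^ 3
  · rw [Z4_diagCurv hG' hσ, Z4_diagCurv hG hK]
    simp only [secZ_perm]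
    exact Equiv.sum_comp σ fun a => secZ K a ^ 4
  · rw [weylSq_diagCurv hG' hσ, weylSq_diagCurv hG hK]
    simp only [secW_perm]
    rw [h2 fun a b => secW K a b ^ 2]
  · rw [weylCube_diagCurv hG' hσ, weylCube_diagCurv hG hK]
    simp only [secW_perm]
    rw [h2 fun a b => secW K a b ^ 3]
  · rw [weylZZ_diagCurv hG' hσ, weylZZ_diagCurv hG hK]
    simp only [secW_perm, secZ_perm]
    rw [h2 fun a b => secW K a b * secZ K a * secZ K b]

end Permutation

/-! ### Invariance under reflections of the axes -/

section Parity

/-- The curvature array in reflected coordinates. -/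
def reflect (s : Fin 4 → ℝ) (T : Tensor4) : Tensor4 := fun a b c d =>
  s a * s b * s c * s d * T a b c d

variable {G s : Fin 4 → ℝ} {T : Tensor4}

theorem ricci_reflect (hG : ∀ i, G i ≠ 0) (hs : ∀ i, s i * s i = 1) (a c : Fin 4) :
    ricci (diagonal G) (reflect s T) a c = s a * s c * ricci (diagonal G) T a c := by
  simp only [ricci, inv_diagonal_of_ne_zero hG, diagonal_apply, ite_mul, zero_mul,
    Finset.sum_ite_eq, Finset.mem_univ, if_true, reflect, Finset.mul_sum]
  refine Finset.sum_congr rfl fun b _ => ?_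
  linear_combination (G b)⁻¹ * s a * s c * T a b c b * hs b

theorem scalarR_reflect (hG : ∀ i, G i ≠ 0) (hs : ∀ i, s i * s i = 1) :
    scalarR (diagonal G) (reflect s T) = scalarR (diagonal G) T := by
  simp only [scalarR, ricci_reflect hG hs, inv_diagonal_of_ne_zero hG, diagonal_apply, ite_mul,
    zero_mul, Finset.sum_ite_eq, Finset.mem_univ, if_true, hs, one_mul]

theorem tracelessRicci_reflect (hG : ∀ i, G i ≠ 0) (hs : ∀ i, s i * s i = 1) :
    tracelessRicci (diagonal G) (reflect s T) =
      diagonal s * tracelessRicci (diagonal G) T * diagonal s := by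
  ext a b
  simp only [tracelessRicci, ricci_reflect hG hs, scalarR_reflect hG hs, diagonal_mul,
    mul_diagonal, diagonal_apply]
  split_ifs with h
  · subst h
    linear_combination (1 / 4 * G a * scalarR (diagonal G) T) * hs a
  · ring

theorem zMixed_reflect (hG : ∀ i, G i ≠ 0) (hs : ∀ i, s i * s i = 1) :
    zMixed (diagonal G) (reflect s T) = diagonal s * zMixed (diagonal G) T * diagonal s := by
  rw [zMixed, zMixed, tracelessRicci_reflect hG hs, inv_diagonal_of_ne_zero hG]
  ext a b
  simp only [← mul_assoc, diagonal_mul_diagonal, diagonal_mul, mul_diagonal]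
  ring

theorem zUp_reflect (hG : ∀ i, G i ≠ 0) (hs : ∀ i, s i * s i = 1) (a b : Fin 4) :
    zUp (diagonal G) (reflect s T) a b = s a * s b * zUp (diagonal G) T a b := by
  rw [zUp, zUp, tracelessRicci_reflect hG hs, inv_diagonal_of_ne_zero hG]
  simp only [← mul_assoc, diagonal_mul_diagonal, diagonal_mul, mul_diagonal]
  ring

/-- A reflection conjugates the mixed tensor by the involution `diagonal s`, and conjugation
preserves traces of powers. -/
theorem trace_zMixed_pow_reflect (hG : ∀ i, G i ≠ 0) (hs : ∀ i, s i * s i = 1) (m : ℕ) :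
    (zMixed (diagonal G) (reflect s T) ^ m).trace = (zMixed (diagonal G) T ^ m).trace := by
  have h1 : (diagonal s : Mat) * diagonal s = 1 := by
    rw [diagonal_mul_diagonal, ← diagonal_one]
    congr 1
    exact funext hs
  have h2 : (diagonal s * zMixed (diagonal G) T * diagonal s) ^ m =
      diagonal s * zMixed (diagonal G) T ^ m * diagonal s := by
    induction m with
    | zero => simp [h1]
    | succ m ih =>
      rw [pow_succ, ih, pow_succ]
      simp only [mul_assoc]
      rw [← mul_assoc (diagonal s) (diagonal s), h1, one_mul]
  rw [zMixed_reflect hG hs, h2, trace_mul_comm, ← mul_assoc, h1, one_mul]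

theorem weyl_reflect (hG : ∀ i, G i ≠ 0) (hs : ∀ i, s i * s i = 1) :
    weyl (diagonal G) (reflect s T) = reflect s (weyl (diagonal G) T) := by
  have key : ∀ a b, (diagonal G : Mat) a b = s a * s b * (diagonal G : Mat) a b := by
    intro a b
    simp only [diagonal_apply]
    split_ifs with h
    · subst h; rw [hs, one_mul]
    · ring
  funext a b c d
  simp only [weyl, ricci_reflect hG hs, scalarR_reflect hG hs, reflect]
  linear_combination 1 / 2 * s d * s a * ricci (diagonal G) T d a * key b c
    - 1 / 2 * s c * s a * ricci (diagonal G) T c a * key b d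
    - 1 / 2 * s d * s b * ricci (diagonal G) T d b * key a c
    + 1 / 2 * s c * s b * ricci (diagonal G) T c b * key a d
    + 1 / 6 * scalarR (diagonal G) T * ((diagonal G : Mat) b d * key c a
      + s c * s a * (diagonal G : Mat) c a * key b d - (diagonal G : Mat) a d * key c b
      - s c * s b * (diagonal G : Mat) c b * key a d)

theorem weylMixed_reflect (hG : ∀ i, G i ≠ 0) (hs : ∀ i, s i * s i = 1) :
    weylMixed (diagonal G) (reflect s T) = reflect s (weylMixed (diagonal G) T) := by
  funext a b c d
  simp only [weylMixed, weyl_reflect hG hs, inv_diagonal_of_ne_zero hG, diagonal_apply, mul_ite,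
    ite_mul, zero_mul, mul_zero, Finset.sum_ite_eq', Finset.mem_univ, if_true, reflect]
  ring

/-- Every index occurs twice in the full contraction, so each sign enters squared. -/
theorem weylSq_reflect (hG : ∀ i, G i ≠ 0) (hs : ∀ i, s i * s i = 1) :
    weylSq (diagonal G) (reflect s T) = weylSq (diagonal G) T := by
  simp only [weylSq, weylMixed_reflect hG hs, reflect]
  refine Finset.sum_congr rfl fun a _ => Finset.sum_congr rfl fun b _ =>
    Finset.sum_congr rfl fun c _ => Finset.sum_congr rfl fun d _ => ?_
  have : s a * s b * s c * s d * (s c * s d * s a * s b) = 1 := by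
    calc _ = (s a * s a) * (s b * s b) * (s c * s c) * (s d * s d) := by ring
      _ = 1 := by simp [hs]
  linear_combination (weylMixed (diagonal G) T a b c d * weylMixed (diagonal G) T c d a b) * this

theorem weylCube_reflect (hG : ∀ i, G i ≠ 0) (hs : ∀ i, s i * s i = 1) :
    weylCube (diagonal G) (reflect s T) = weylCube (diagonal G) T := by
  simp only [weylCube, weylMixed_reflect hG hs, reflect]
  refine Finset.sum_congr rfl fun a _ => Finset.sum_congr rfl fun b _ =>
    Finset.sum_congr rfl fun c _ => Finset.sum_congr rfl fun d _ =>
    Finset.sum_congr rfl fun e _ => Finset.sum_congr rfl fun f _ => ?_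
  have : s a * s b * s c * s d * (s c * s d * s e * s f) * (s e * s f * s a * s b) = 1 := by
    calc _ = (s a * s a) * (s b * s b) * (s c * s c) * (s d * s d) * (s e * s e) * (s f * s f) := by
          ring
      _ = 1 := by simp [hs]
  linear_combination (weylMixed (diagonal G) T a b c d * weylMixed (diagonal G) T c d e f *
    weylMixed (diagonal G) T e f a b) * this

theorem weylZZ_reflect (hG : ∀ i, G i ≠ 0) (hs : ∀ i, s i * s i = 1) :
    weylZZ (diagonal G) (reflect s T) = weylZZ (diagonal G) T := by
  simp only [weylZZ, weyl_reflect hG hs, zUp_reflect hG hs, reflect]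
  refine Finset.sum_congr rfl fun a _ => Finset.sum_congr rfl fun b _ =>
    Finset.sum_congr rfl fun c _ => Finset.sum_congr rfl fun d _ => ?_
  have : s a * s b * s c * s d * (s a * s c) * (s b * s d) = 1 := by
    calc _ = (s a * s a) * (s b * s b) * (s c * s c) * (s d * s d) := by ring
      _ = 1 := by simp [hs]
  linear_combination (weyl (diagonal G) T a b c d * zUp (diagonal G) T a c *
    zUp (diagonal G) T b d) * this

theorem theoryQ_reflect (n : ℕ) (hG : ∀ i, G i ≠ 0) (hs : ∀ i, s i * s i = 1) :
    theoryQ n (diagonal G) (reflect s T) = theoryQ n (diagonal G) T :=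
  theoryQ_congr n (scalarR_reflect hG hs) (trace_zMixed_pow_reflect hG hs 2)
    (trace_zMixed_pow_reflect hG hs 3) (trace_zMixed_pow_reflect hG hs 4) (weylSq_reflect hG hs)
    (weylCube_reflect hG hs) (weylZZ_reflect hG hs)

end Parity

/-! ### Differentiability of the Lagrangian in the curvature -/

section Differentiability

variable (g : Mat)

@[fun_prop]
theorem differentiable_ricci (a c : Fin 4) : Differentiable ℝ fun T => ricci g T a c := by
  unfold ricci; fun_prop

@[fun_prop]
theorem differentiable_scalarR : Differentiable ℝ (scalarR g) := by
  unfold scalarR; fun_prop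

@[fun_prop]
theorem differentiable_weyl (a b c d : Fin 4) : Differentiable ℝ fun T => weyl g T a b c d := by
  unfold weyl; fun_prop

@[fun_prop]
theorem differentiable_weylMixed (a b c d : Fin 4) :
    Differentiable ℝ fun T => weylMixed g T a b c d := by
  unfold weylMixed; fun_prop

@[fun_prop]
theorem differentiable_weylSq : Differentiable ℝ (weylSq g) := by
  unfold weylSq; fun_prop

@[fun_prop]
theorem differentiable_weylCube : Differentiable ℝ (weylCube g) := by
  unfold weylCube; fun_prop

@[fun_prop]
theorem differentiable_tracelessRicci (a b : Fin 4) :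
    Differentiable ℝ fun T => tracelessRicci g T a b := by
  unfold tracelessRicci; fun_prop

@[fun_prop]
theorem differentiable_zMixed (a b : Fin 4) : Differentiable ℝ fun T => zMixed g T a b := by
  simp only [zMixed, mul_apply]; fun_prop

@[fun_prop]
theorem differentiable_zUp (a b : Fin 4) : Differentiable ℝ fun T => zUp g T a b := by
  simp only [zUp, mul_apply]; fun_prop

@[fun_prop]
theorem differentiable_weylZZ : Differentiable ℝ (weylZZ g) := by
  unfold weylZZ; fun_prop

theorem differentiable_zMixed_pow (m : ℕ) (a b : Fin 4) :
    Differentiable ℝ fun T => (zMixed g T ^ m) a b := by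
  induction m generalizing a b with
  | zero => simp only [pow_zero]; exact differentiable_const _
  | succ m ih =>
    simp only [pow_succ, mul_apply]
    exact Differentiable.fun_sum fun i _ => (ih a i).mul (differentiable_zMixed g i b)

theorem differentiable_trace_zMixed_pow (m : ℕ) :
    Differentiable ℝ fun T => (zMixed g T ^ m).trace := by
  simp only [trace, diag_apply]
  exact Differentiable.fun_sum fun i _ => differentiable_zMixed_pow g m i i

@[fun_prop]
theorem differentiable_Z2 : Differentiable ℝ (Z2 g) := differentiable_trace_zMixed_pow g 2

@[fun_prop]
theorem differentiable_Z3 : Differentiable ℝ (Z3 g) := differentiable_trace_zMixed_pow g 3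

@[fun_prop]
theorem differentiable_Z4 : Differentiable ℝ (Z4 g) := differentiable_trace_zMixed_pow g 4

@[fun_prop]
theorem differentiable_calW (l : ℕ) : Differentiable ℝ (calW l g) := by
  unfold calW; fun_prop

theorem differentiable_theoryS (n : ℕ) : Differentiable ℝ (theoryS n g) := by
  unfold theoryS
  split_ifs <;> fun_prop

theorem differentiable_theoryT (n : ℕ) : Differentiable ℝ (theoryT n g) := by
  unfold theoryT
  split_ifs <;> fun_prop

theorem differentiable_theoryQ (n : ℕ) : Differentiable ℝ (theoryQ n g) := by
  have h1 := differentiable_theoryS g n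
  have h2 := differentiable_theoryT g n
  unfold theoryQ
  split_ifs <;> fun_prop

end Differentiability

/-! ### Projection of unit arrays onto the curvature symmetries -/

section Projection

theorem curvProj_smul (c : ℝ) (T : Tensor4) : curvProj (c • T) = c • curvProj T := by
  funext i j k l
  simp only [curvProj, removeCyclic, symPairs, antisymPairs, Pi.smul_apply, smul_eq_mul]
  ring

theorem reflect_curvProj (s : Fin 4 → ℝ) (T : Tensor4) :
    reflect s (curvProj T) = curvProj (reflect s T) := by
  funext i j k l
  simp only [reflect, curvProj, removeCyclic, symPairs, antisymPairs]
  ring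

theorem reflect_unit4 (s : Fin 4 → ℝ) (a b c d : Fin 4) :
    reflect s (unit4 a b c d) = (s a * s b * s c * s d) • unit4 a b c d := by
  funext i j k l
  simp only [reflect, unit4, Pi.smul_apply, smul_eq_mul]
  split_ifs with h
  · obtain ⟨rfl, rfl, rfl, rfl⟩ := h; rfl
  · simp

theorem curvProj_unit4_swap_left (a b c d : Fin 4) :
    curvProj (unit4 b a c d) = -curvProj (unit4 a b c d) := by
  have h : ∀ i j k l, unit4 b a c d i j k l = unit4 a b c d j i k l := by
    intro i j k l; simp only [unit4]; congr 1; ext; tauto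
  funext i j k l
  simp only [curvProj, removeCyclic, symPairs, antisymPairs, Pi.neg_apply, h]
  ring

theorem curvProj_unit4_swap_right (a b c d : Fin 4) :
    curvProj (unit4 a b d c) = -curvProj (unit4 a b c d) := by
  have h : ∀ i j k l, unit4 a b d c i j k l = unit4 a b c d i j l k := by
    intro i j k l; simp only [unit4]; congr 1; ext; tauto
  funext i j k l
  simp only [curvProj, removeCyclic, symPairs, antisymPairs, Pi.neg_apply, h]
  ring

theorem curvProj_unit4_self_left (a c d : Fin 4) : curvProj (unit4 a a c d) = 0 := by
  have h := curvProj_unit4_swap_left a a c d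
  funext i j k l
  have := congrFun (congrFun (congrFun (congrFun h i) j) k) l
  simp only [Pi.neg_apply] at this
  simp only [Pi.zero_apply]
  linarith

theorem curvProj_unit4_self_right (a b c : Fin 4) : curvProj (unit4 a b c c) = 0 := by
  have h := curvProj_unit4_swap_right a b c c
  funext i j k l
  have := congrFun (congrFun (congrFun (congrFun h i) j) k) l
  simp only [Pi.neg_apply] at this
  simp only [Pi.zero_apply]
  linarith

/-- Unit sectional curvature in the plane spanned by the axes `a` and `b`. -/
def secUnit (a b : Fin 4) : Fin 4 → Fin 4 → ℝ := fun i j =>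
  if i = a ∧ j = b ∨ i = b ∧ j = a then 1 else 0

theorem isSec_secUnit {a b : Fin 4} (hab : a ≠ b) : IsSec (secUnit a b) where
  symm i j := by simp only [secUnit]; congr 1; ext; tauto
  diag i := by
    simp only [secUnit]
    rw [if_neg]
    rintro (⟨rfl, h⟩ | ⟨rfl, h⟩)
    · exact hab h
    · exact hab h.symm

/-- Antisymmetrising both pairs produces the factor 1/4. Pair symmetry and the cyclic identity then
hold already, because only the two indices `a`, `b` occur. The factors `G a * G b` undo the
normalisation in `diagCurv`. -/
theorem curvProj_unit4_plane {G : Fin 4 → ℝ} (hG : ∀ i, G i ≠ 0) {a b : Fin 4} (hab : a ≠ b) :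
    curvProj (unit4 a b a b) = (4 * G a * G b)⁻¹ • diagCurv G (secUnit a b) := by
  have ha := hG a
  have hb := hG b
  funext i j k l
  simp only [curvProj, removeCyclic, symPairs, antisymPairs, unit4, Pi.smul_apply, smul_eq_mul,
    diagCurv, secUnit]
  have split : ∀ i : Fin 4, i = a ∨ i = b ∨ (i ≠ a ∧ i ≠ b ∧ a ≠ i ∧ b ≠ i) := fun i => by tauto
  have hba := hab.symm
  rcases split i with rfl | rfl | ⟨_, _, _, _⟩ <;> rcases split j with rfl | rfl | ⟨_, _, _, _⟩ <;>
    rcases split k with rfl | rfl | ⟨_, _, _, _⟩ <;> rcases split l with rfl | rfl | ⟨_, _, _, _⟩ <;>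
    simp [*] <;> (field_simp; norm_num)

end Projection

/-! ### The Lagrangian as a function of sectional curvatures -/

section Reduced

/-- `theoryQ` as a function of the sectional curvatures. -/
def redQ (n : ℕ) (K : Fin 4 → Fin 4 → ℝ) : ℝ :=
  theoryQ n (diagonal fun _ => 1) (diagCurv (fun _ => 1) K)

/-- The derivative of `theoryQ` with respect to the sectional curvature `K a b`. -/
def secP (n : ℕ) (K : Fin 4 → Fin 4 → ℝ) (a b : Fin 4) : ℝ :=
  deriv (fun ε : ℝ => redQ n (K + ε • secUnit a b)) 0

/-- The identity permutation still permits a change of the diagonal metric, so all entries may be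
replaced by 1; in particular the signature does not matter. -/
theorem theoryQ_diagCurv (n : ℕ) {G : Fin 4 → ℝ} {K : Fin 4 → Fin 4 → ℝ} (hG : ∀ i, G i ≠ 0)
    (hK : IsSec K) : theoryQ n (diagonal G) (diagCurv G K) = redQ n K :=
  theoryQ_diagCurv_perm 1 n (fun _ => one_ne_zero) hG hK

theorem redQ_perm (n : ℕ) {K : Fin 4 → Fin 4 → ℝ} (σ : Equiv.Perm (Fin 4)) (hK : IsSec K) :
    redQ n (fun a b => K (σ a) (σ b)) = redQ n K :=
  theoryQ_diagCurv_perm σ n (fun _ => one_ne_zero) (fun _ => one_ne_zero) hK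

theorem diagCurv_add_smul (G : Fin 4 → ℝ) (K K' : Fin 4 → Fin 4 → ℝ) (ε : ℝ) :
    diagCurv G (K + ε • K') = diagCurv G K + ε • diagCurv G K' := by
  funext a b c d
  simp only [diagCurv, Pi.add_apply, Pi.smul_apply, smul_eq_mul]
  ring

theorem IsSec.add_smul {K K' : Fin 4 → Fin 4 → ℝ} (hK : IsSec K) (hK' : IsSec K') (ε : ℝ) :
    IsSec (K + ε • K') :=
  ⟨fun a b => by simp [hK.symm a b, hK'.symm a b], fun a => by simp [hK.diag, hK'.diag]⟩

theorem differentiable_redQ (n : ℕ) : Differentiable ℝ (redQ n) := by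
  have h : Differentiable ℝ (diagCurv fun _ => 1) := by
    refine differentiable_pi.2 fun a => differentiable_pi.2 fun b => differentiable_pi.2 fun c =>
      differentiable_pi.2 fun d => ?_
    unfold diagCurv
    fun_prop
  exact (differentiable_theoryQ _ n).comp h

theorem hasDerivAt_redQ_line (n : ℕ) (K K' : Fin 4 → Fin 4 → ℝ) :
    HasDerivAt (fun ε : ℝ => redQ n (K + ε • K')) (fderiv ℝ (redQ n) K K') 0 := by
  have h1 : HasDerivAt (fun ε : ℝ => K + ε • K') K' 0 := by
    simpa using ((hasDerivAt_id (0 : ℝ)).smul_const K').const_add K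
  have h2 : HasFDerivAt (redQ n) (fderiv ℝ (redQ n) K) (K + (0 : ℝ) • K') := by
    simpa using (differentiable_redQ n K).hasFDerivAt
  exact h2.comp_hasDerivAt (0 : ℝ) h1

/-- Expressing the line derivative through `fderiv` makes it linear in the direction: a derivative
that moves several planes at once is the sum of the contributions of the single planes. -/
theorem secP_eq_fderiv (n : ℕ) (K : Fin 4 → Fin 4 → ℝ) (a b : Fin 4) :
    secP n K a b = fderiv ℝ (redQ n) K (secUnit a b) :=
  (hasDerivAt_redQ_line n K (secUnit a b)).deriv

theorem secUnit_comm (a b : Fin 4) : secUnit a b = secUnit b a := by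
  funext i j
  simp only [secUnit, or_comm]

theorem secP_comm (n : ℕ) (K : Fin 4 → Fin 4 → ℝ) (a b : Fin 4) : secP n K a b = secP n K b a := by
  rw [secP, secP, secUnit_comm]

/-- A permutation fixing `K` carries the line through `K` in the direction of one plane to the line
for the image plane, and `redQ` agrees on both lines. -/
theorem secP_perm (n : ℕ) {K : Fin 4 → Fin 4 → ℝ} (hK : IsSec K) (σ : Equiv.Perm (Fin 4))
    (hσ : ∀ a b, K (σ a) (σ b) = K a b) {a b : Fin 4} (hab : a ≠ b) :
    secP n K (σ a) (σ b) = secP n K a b := by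
  simp only [secP]
  congr 1
  funext ε
  have h := (hK.add_smul (isSec_secUnit (σ.injective.ne hab)) ε)
  rw [← redQ_perm n σ h]
  congr 1
  funext i j
  simp only [Pi.add_apply, Pi.smul_apply, hσ, secUnit, σ.injective.eq_iff]

end Reduced

/-! ### The tensor P on diagonal curvatures -/

section Momentum

variable {G : Fin 4 → ℝ} {K : Fin 4 → Fin 4 → ℝ} {g : Pt → Mat} {x : Pt}

/-- Linearity in the direction lets the antisymmetries of the projected unit arrays pass to P. -/
theorem momentum_eq_fderiv (n : ℕ) (g : Pt → Mat) (a b c d : Fin 4) (x : Pt) :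
    momentum (theoryQ n) g a b c d x =
      fderiv ℝ (theoryQ n (g x)) (riemann g x) (curvProj (unit4 a b c d)) := by
  have h1 : HasDerivAt (fun ε : ℝ => riemann g x + ε • curvProj (unit4 a b c d))
      (curvProj (unit4 a b c d)) 0 := by
    simpa using ((hasDerivAt_id (0 : ℝ)).smul_const (curvProj (unit4 a b c d))).const_add
      (riemann g x)
  have h2 : HasFDerivAt (theoryQ n (g x)) (fderiv ℝ (theoryQ n (g x)) (riemann g x))
      (riemann g x + (0 : ℝ) • curvProj (unit4 a b c d)) := by
    simpa using (differentiable_theoryQ (g x) n (riemann g x)).hasFDerivAt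
  exact (h2.comp_hasDerivAt (0 : ℝ) h1).deriv

theorem reflect_diagCurv {s : Fin 4 → ℝ} (hs : ∀ i, s i * s i = 1) :
    reflect s (diagCurv G K) = diagCurv G K := by
  funext a b c d
  simp only [reflect, diagCurv]
  by_cases h1 : a = c ∧ b = d
  · obtain ⟨rfl, rfl⟩ := h1
    linear_combination (K a b * G a * G b * ((if a = a then if b = b then 1 else 0 else 0)
      - (if a = b then if b = a then 1 else 0 else 0))) * (s b * s b * hs a + hs b)
  · by_cases h2 : a = d ∧ b = c
    · obtain ⟨rfl, rfl⟩ := h2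
      linear_combination (K a b * G a * G b * ((if a = b then if b = a then 1 else 0 else 0)
        - (if a = a then if b = b then 1 else 0 else 0))) * (s b * s b * hs a + hs b)
    · simp only [← ite_and, h1, h2, if_false]
      ring

/-- Momentum components which are odd under a reflection of the coordinate axes vanish. -/
theorem momentum_eq_zero_of_odd (n : ℕ) (hG : ∀ i, G i ≠ 0) (hg : g x = diagonal G)
    (hR : riemann g x = diagCurv G K) {s : Fin 4 → ℝ} (hs : ∀ i, s i * s i = 1) {a b c d : Fin 4}
    (hodd : s a * s b * s c * s d = -1) : momentum (theoryQ n) g a b c d x = 0 := by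
  have h : ∀ ε : ℝ, theoryQ n (g x) (riemann g x + ε • curvProj (unit4 a b c d)) =
      theoryQ n (g x) (riemann g x + (-ε) • curvProj (unit4 a b c d)) := by
    intro ε
    rw [hg, ← theoryQ_reflect n hG hs, hR]
    congr 1
    calc reflect s (diagCurv G K + ε • curvProj (unit4 a b c d))
        = reflect s (diagCurv G K) + ε • reflect s (curvProj (unit4 a b c d)) := by
          funext i j k l
          simp only [reflect, Pi.add_apply, Pi.smul_apply, smul_eq_mul]
          ring
      _ = diagCurv G K + (-ε) • curvProj (unit4 a b c d) := by
          rw [reflect_diagCurv hs, reflect_curvProj, reflect_unit4, hodd, curvProj_smul, neg_smul,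
            one_smul, smul_neg, neg_smul]
  -- The Lagrangian is even along this line, so its derivative at 0 equals its own negative.
  have h1 : momentum (theoryQ n) g a b c d x = -momentum (theoryQ n) g a b c d x := by
    conv_lhs => rw [momentum, funext h]
    rw [deriv_comp_neg (fun ε : ℝ => theoryQ n (g x) (riemann g x + ε • curvProj (unit4 a b c d))),
      neg_zero, momentum]
  linarith

theorem momentum_plane (n : ℕ) (hG : ∀ i, G i ≠ 0) (hg : g x = diagonal G)
    (hR : riemann g x = diagCurv G K) (hK : IsSec K) {a b : Fin 4} (hab : a ≠ b) :
    momentum (theoryQ n) g a b a b x = secP n K a b / (4 * G a * G b) := by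
  have h1 : HasDerivAt (fun ε : ℝ => theoryQ n (diagonal G) (diagCurv G K
      + ε • diagCurv G (secUnit a b))) (secP n K a b) 0 := by
    simp only [← diagCurv_add_smul, theoryQ_diagCurv n hG (hK.add_smul (isSec_secUnit hab) _)]
    rw [secP_eq_fderiv]
    exact hasDerivAt_redQ_line n K (secUnit a b)
  have h2 : momentum (theoryQ n) g a b a b x = deriv (fun ε : ℝ => theoryQ n (diagonal G)
      (diagCurv G K + ((4 * G a * G b)⁻¹ * ε) • diagCurv G (secUnit a b))) 0 := by
    rw [momentum, hg, hR, curvProj_unit4_plane hG hab]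
    simp only [smul_smul, mul_comm]
  rw [h2, deriv_comp_mul_left (4 * G a * G b)⁻¹ (fun ε : ℝ => theoryQ n (diagonal G) (diagCurv G K
      + ε • diagCurv G (secUnit a b))), mul_zero, h1.deriv, smul_eq_mul, div_eq_inv_mul]

/-- The momentum on a diagonal curvature. -/
theorem momentum_diagCurv (n : ℕ) (hG : ∀ i, G i ≠ 0) (hg : g x = diagonal G)
    (hR : riemann g x = diagCurv G K) (hK : IsSec K) (a b c d : Fin 4) :
    momentum (theoryQ n) g a b c d x = (if a = b then 0 else secP n K a b / (4 * G a * G b)) *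
      ((if a = c then if b = d then 1 else 0 else 0)
        - (if a = d then if b = c then 1 else 0 else 0)) := by
  by_cases hab : a = b
  · subst hab
    rw [momentum_eq_fderiv, curvProj_unit4_self_left]
    simp
  by_cases hcd : c = d
  · subst hcd
    rw [momentum_eq_fderiv, curvProj_unit4_self_right, map_zero]
    have : ¬ (a = c ∧ b = c) := fun h => hab (h.1.trans h.2.symm)
    simp only [← ite_and, this, if_false, sub_self, mul_zero]
  by_cases h1 : a = c ∧ b = d
  · obtain ⟨rfl, rfl⟩ := h1
    rw [momentum_plane n hG hg hR hK hab]
    simp [hab]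
  by_cases h2 : a = d ∧ b = c
  · obtain ⟨rfl, rfl⟩ := h2
    rw [momentum_eq_fderiv, curvProj_unit4_swap_right, map_neg, ← momentum_eq_fderiv,
      momentum_plane n hG hg hR hK hab]
    simp [hab]
  -- When the two index pairs are proper and differ as unordered pairs, some axis `e` occurs an odd
  -- number of times among the four indices. Reflecting that axis makes the component odd.
  have h3 : ∃ e : Fin 4, (if a = e then (-1 : ℤ) else 1) * (if b = e then (-1 : ℤ) else 1) *
      (if c = e then (-1 : ℤ) else 1) * (if d = e then (-1 : ℤ) else 1) = -1 := by
    revert a b c d; decide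
  obtain ⟨e, he⟩ := h3
  rw [momentum_eq_zero_of_odd n hG hg hR (s := fun i => if i = e then -1 else 1)
    (fun i => by split_ifs <;> norm_num) (by exact_mod_cast congrArg (Int.cast : ℤ → ℝ) he)]
  simp only [← ite_and, h1, h2, if_false, sub_self, mul_zero]

end Momentum

/-! ### Binomial sums with polynomial weights -/

section BinomialSums

variable (R y : ℝ)

theorem sum_choose_mul_pow (n : ℕ) :
    ∑ m ∈ Finset.range (n + 1), (n.choose m : ℝ) * y ^ m * R ^ (n - m) = (R + y) ^ n := by
  rw [add_comm R y, add_pow]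
  exact Finset.sum_congr rfl fun m _ => by ring

/-- This is the binomial expansion differentiated in `y`, proved by the absorption identity for
binomial coefficients. The truncated exponent at `m = 0` is harmless because the weight is zero
there. -/
theorem sum_mul_choose_mul_pow (n : ℕ) :
    ∑ m ∈ Finset.range (n + 1), (m : ℝ) * n.choose m * y ^ (m - 1) * R ^ (n - m) =
      n * (R + y) ^ (n - 1) := by
  cases n with
  | zero => simp
  | succ n =>
    rw [Finset.sum_range_succ']
    simp only [Nat.cast_zero, zero_mul, add_zero, Nat.add_sub_cancel, Nat.add_sub_add_right]
    rw [← sum_choose_mul_pow, Finset.mul_sum]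
    refine Finset.sum_congr rfl fun m _ => ?_
    have h : ((n + 1 : ℕ) : ℝ) * n.choose m = (n + 1).choose (m + 1) * ((m + 1 : ℕ) : ℝ) := by
      exact_mod_cast Nat.add_one_mul_choose_eq n m
    linear_combination (-y ^ m * R ^ (n - m)) * h

theorem sum_mul_mul_choose_mul_pow (n : ℕ) :
    ∑ m ∈ Finset.range (n + 1), (m : ℝ) * ((m : ℝ) - 1) * n.choose m * y ^ (m - 2) * R ^ (n - m) =
      n * ((n : ℝ) - 1) * (R + y) ^ (n - 2) := by
  cases n with
  | zero => simp
  | succ n =>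
    rw [Finset.sum_range_succ']
    simp only [Nat.cast_zero, zero_mul, add_zero, Nat.add_sub_add_right]
    have key := sum_mul_choose_mul_pow R y n
    have e : ((n + 1 : ℕ) : ℝ) * (((n + 1 : ℕ) : ℝ) - 1) * (R + y) ^ (n + 1 - 2) =
        ((n + 1 : ℕ) : ℝ) * (n * (R + y) ^ (n - 1)) := by
      rw [show n + 1 - 2 = n - 1 by omega]; push_cast; ring
    rw [e, ← key, Finset.mul_sum]
    refine Finset.sum_congr rfl fun m _ => ?_
    have h : ((n + 1 : ℕ) : ℝ) * n.choose m = (n + 1).choose (m + 1) * ((m + 1 : ℕ) : ℝ) := by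
      exact_mod_cast Nat.add_one_mul_choose_eq n m
    rw [show m + 1 - 2 = m - 1 by omega]
    push_cast at h ⊢
    linear_combination (-(m : ℝ) * y ^ (m - 1) * R ^ (n - m)) * h

/-- This is the second derivative of the expansion in `R` instead of `y`; exchanging the two
variables and reversing the sum reduces it to the previous case. -/
theorem sum_compl_mul_choose_mul_pow (n : ℕ) :
    ∑ m ∈ Finset.range (n + 1), ((n : ℝ) - m) * ((n : ℝ) - m - 1) * n.choose m * y ^ m *
      R ^ (n - m - 2) = n * ((n : ℝ) - 1) * (R + y) ^ (n - 2) := by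
  rw [add_comm R y, ← sum_mul_mul_choose_mul_pow y R n, ← Finset.sum_range_reflect]
  refine Finset.sum_congr rfl fun m hm => ?_
  have hm' : m ≤ n := by simpa [Nat.lt_succ_iff] using hm
  rw [show n + 1 - 1 - m = n - m by omega, Nat.choose_symm hm', Nat.cast_sub hm',
    show n - (n - m) = m by omega]
  ring

end BinomialSums

/-! ### Resummation when the Weyl tensor is of type D -/

section TypeD

variable {g : Mat} {Rm : Tensor4} {c z : ℝ}

/-- A type D Weyl tensor has a single parameter `c`, and 3·12c² = (-6c)². The powers of 3 and the
extra factor 2 for odd `l` make both parities into the same geometric sequence. -/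
theorem calW_of_weyl (l : ℕ) (h2 : weylSq g Rm = 12 * c ^ 2) (h3 : weylCube g Rm = 12 * c ^ 3) :
    (-1) ^ l * 3 ^ ((l + l % 2) / 2 + 1) * calW l g Rm = (-6 * c) ^ (l + 2) := by
  simp only [calW, h2, h3]
  obtain ⟨j, rfl | rfl⟩ := Nat.even_or_odd' l
  · rw [show 2 * j % 2 = 0 by omega, show (2 * j + 0) / 2 = j by omega,
      show (2 * j - 0) / 2 = j by omega]
    calc _ = ((-1) ^ 2) ^ j * (3 * (12 * c ^ 2)) ^ (j + 1) := by
          rw [mul_pow 3 (12 * c ^ 2), pow_succ (12 * c ^ 2) j, pow_mul]; push_cast; ring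
      _ = _ := by rw [show 2 * j + 2 = 2 * (j + 1) by ring, pow_mul, neg_one_sq, one_pow]; ring
  · rw [show (2 * j + 1) % 2 = 1 by omega, show (2 * j + 1 + 1) / 2 = j + 1 by omega,
      show (2 * j + 1 - 1) / 2 = j by omega]
    calc _ = -((-1) ^ 2) ^ j * (3 * (12 * c ^ 2)) ^ j * (216 * c ^ 3) := by
          rw [mul_pow 3 (12 * c ^ 2), pow_succ (-1 : ℝ) (2 * j), pow_mul]; push_cast; ring
      _ = _ := by
          rw [show 2 * j + 1 + 2 = 2 * j + 3 by ring, pow_add, pow_mul, neg_one_sq, one_pow]; ring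

theorem lambda1_mul_calW {n l : ℕ} (hl : l + 2 ≤ n) (h2 : weylSq g Rm = 12 * c ^ 2)
    (h3 : weylCube g Rm = 12 * c ^ 3) :
    lambda1 n l * calW l g Rm =
      ((l : ℝ) + 1) * (3 * l + 4) / 2 * n.choose (l + 2) * (-6 * c) ^ (l + 2) := by
  rw [← calW_of_weyl l h2 h3, Nat.cast_choose ℝ hl, lambda1, Nat.sub_sub]
  have h4 : ((l + 2).factorial : ℝ) ≠ 0 := by positivity
  have h5 : ((n - (l + 2)).factorial : ℝ) ≠ 0 := by positivity
  field_simp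

/-- `theoryS` on curvatures with Weyl part of type D. -/
theorem theoryS_typeD {n : ℕ} (hn : 3 ≤ n) (h2 : weylSq g Rm = 12 * c ^ 2)
    (h3 : weylCube g Rm = 12 * c ^ 3) (hZ : weylZZ g Rm = 8 * c * z ^ 2)
    (hZ2 : Z2 g Rm = 4 * z ^ 2) :
    theoryS n g Rm = (scalarR g Rm - 6 * c) ^ n + 6 * n * c * (scalarR g Rm - 6 * c) ^ (n - 1)
      + n * ((n : ℝ) - 1) * (54 * c ^ 2 - 24 * z ^ 2) * (scalarR g Rm - 6 * c) ^ (n - 2) := by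
  set R := scalarR g Rm
  -- With m = l + 2 the two coefficients of the theory turn into polynomial weights times `n.choose
  -- m`.
  have hsum : ∑ l ∈ Finset.range (n - 1), lambda1 n l * calW l g Rm *
      (R ^ (n - l - 2) + lambda2 n l * R ^ (n - l - 4) * Z2 g Rm) =
      ∑ l ∈ Finset.range (n - 1), ((((l + 2 : ℕ) : ℝ) - 1) * (3 * ((l + 2 : ℕ) : ℝ) - 2) / 2 *
        n.choose (l + 2) * (-6 * c) ^ (l + 2) * R ^ (n - (l + 2))
        - 24 * z ^ 2 * (((n : ℝ) - (l + 2 : ℕ)) * ((n : ℝ) - (l + 2 : ℕ) - 1) *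
          n.choose (l + 2) * (-6 * c) ^ (l + 2) * R ^ (n - (l + 2) - 2))) := by
    refine Finset.sum_congr rfl fun l hl => ?_
    have hl' : l + 2 ≤ n := by have := Finset.mem_range.1 hl; omega
    rw [lambda1_mul_calW hl' h2 h3, hZ2, lambda2, show n - l - 2 = n - (l + 2) by omega,
      show n - l - 4 = n - (l + 2) - 2 by omega]
    have h1 : (l : ℝ) + 1 ≠ 0 := by positivity
    have h4 : 3 * (l : ℝ) + 4 ≠ 0 := by positivity
    push_cast
    field_simp
    ring
  obtain ⟨N, rfl⟩ : ∃ N, n = N + 3 := ⟨n - 3, by omega⟩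
  have e0 := sum_choose_mul_pow R (-6 * c) (N + 3)
  have e1 := sum_mul_choose_mul_pow R (-6 * c) (N + 3)
  have e2 := sum_mul_mul_choose_mul_pow R (-6 * c) (N + 3)
  have e3 := sum_compl_mul_choose_mul_pow R (-6 * c) (N + 3)
  -- The explicit terms of `theoryS` outside the sum are exactly what the summand would give at m =
  -- 0 and m = 1, so the range can be completed to a full binomial sum.
  have split : ∀ φ : ℕ → ℝ, ∑ l ∈ Finset.range (N + 3 - 1), φ (l + 2) =
      ∑ m ∈ Finset.range (N + 3 + 1), φ m - φ 0 - φ 1 := by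
    intro φ
    rw [show N + 3 + 1 = (N + 3 - 1) + 1 + 1 by omega, Finset.sum_range_succ',
      Finset.sum_range_succ']
    ring
  rw [theoryS, if_neg (by omega), if_neg (by omega), hsum, split (fun m => (((m : ℝ) - 1) * (3 * (m : ℝ) - 2) / 2 *
        (N + 3).choose m * (-6 * c) ^ m * R ^ (N + 3 - m)
        - 24 * z ^ 2 * ((((N + 3 : ℕ) : ℝ) - m) * (((N + 3 : ℕ) : ℝ) - m - 1) *
          (N + 3).choose m * (-6 * c) ^ m * R ^ (N + 3 - m - 2)))), hZ, hZ2]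
  -- Here (m-1)(3m-2)/2 = 1 - m + (3/2)m(m-1). Writing y = -6c, the factors are -y = 6c in front of
  -- the first derivative and (3/2)y² = 54c² in front of the second.
  have e4 : ∑ m ∈ Finset.range (N + 3 + 1), (((m : ℝ) - 1) * (3 * (m : ℝ) - 2) / 2 *
        (N + 3).choose m * (-6 * c) ^ m * R ^ (N + 3 - m)
        - 24 * z ^ 2 * ((((N + 3 : ℕ) : ℝ) - m) * (((N + 3 : ℕ) : ℝ) - m - 1) *
          (N + 3).choose m * (-6 * c) ^ m * R ^ (N + 3 - m - 2))) =
      ∑ m ∈ Finset.range (N + 3 + 1), (((N + 3).choose m : ℝ) * (-6 * c) ^ m * R ^ (N + 3 - m))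
      + 6 * c * ∑ m ∈ Finset.range (N + 3 + 1), ((m : ℝ) * (N + 3).choose m * (-6 * c) ^ (m - 1) *
          R ^ (N + 3 - m))
      + 54 * c ^ 2 * ∑ m ∈ Finset.range (N + 3 + 1), ((m : ℝ) * ((m : ℝ) - 1) * (N + 3).choose m *
          (-6 * c) ^ (m - 2) * R ^ (N + 3 - m))
      - 24 * z ^ 2 * ∑ m ∈ Finset.range (N + 3 + 1), ((((N + 3 : ℕ) : ℝ) - m) *
          (((N + 3 : ℕ) : ℝ) - m - 1) * (N + 3).choose m * (-6 * c) ^ m * R ^ (N + 3 - m - 2)) := by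
    simp only [Finset.mul_sum, ← Finset.sum_add_distrib, ← Finset.sum_sub_distrib]
    refine Finset.sum_congr rfl fun m _ => ?_
    rcases m with _ | _ | m
    · simp
    · simp; ring
    · rw [show m + 1 + 1 - 1 = m + 1 by omega, show m + 1 + 1 - 2 = m by omega]
      push_cast
      ring
  rw [e4, e0, e1, e2, e3]
  simp only [show N + 3 - 2 = N + 1 by omega, show N + 3 - 3 = N by omega,
    show N + 3 - 1 = N + 2 by omega, show N + 3 - 0 = N + 3 by omega,
    show N + 2 - 2 = N by omega, Nat.choose_zero_right, Nat.choose_one_right]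
  push_cast
  ring

theorem theoryT_eq_zero {n : ℕ} (h3 : Z3 g Rm = 0) (h4 : Z2 g Rm ^ 2 = 4 * Z4 g Rm) :
    theoryT n g Rm = 0 := by
  simp [theoryT, h3, h4]

end TypeD

/-! ### Resummation for conformally flat isotropic curvatures -/

section Isotropic

variable {g : Mat} {Rm : Tensor4} {z : ℝ}

/-- For even `l` the bracket is Z_2² - 4Z_4 = -192z⁴, for odd `l` it is (8/3)Z_2 Z_3 = 768z⁵. The
powers of 2 and 3 in `omega` complete both to a power of -12z. -/
theorem omega_mul_tracelessRicci {n l : ℕ} (hl : 4 ≤ l) (h2 : Z2 g Rm = 12 * z ^ 2)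
    (h3 : Z3 g Rm = 24 * z ^ 3) (h4 : Z4 g Rm = 84 * z ^ 4) :
    omega n l * Z2 g Rm ^ ((l - 4 - l % 2) / 2) *
      ((1 - ((l % 2 : ℕ) : ℝ)) * (Z2 g Rm ^ 2 - 4 * Z4 g Rm)
        + 8 * ((l % 2 : ℕ) : ℝ) / 3 * (Z2 g Rm * Z3 g Rm)) =
      -(((l : ℝ) - 1) * n.choose l * (-12 * z) ^ l) := by
  rw [h2, h3, h4, omega]
  obtain ⟨j, rfl | rfl⟩ := Nat.even_or_odd' l
  · obtain ⟨i, rfl⟩ : ∃ i, j = i + 2 := ⟨j - 2, by omega⟩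
    rw [show 2 * (i + 2) % 2 = 0 by omega, show (2 * (i + 2) - 4 - 0) / 2 = i by omega,
      show 2 * (i + 2) - 2 - 0 = 2 * (i + 1) by omega,
      show (2 + 2 * (i + 2) + 0) / 2 = i + 3 by omega, pow_mul, pow_mul]
    have : ((-12 * z) ^ 2) ^ (i + 2) = (2 ^ 2) ^ (i + 1) * 3 ^ (i + 3) * (12 * z ^ 2) ^ i * (192 * z ^ 4) := by
      rw [show (-12 * z) ^ 2 = 2 ^ 2 * 3 * (12 * z ^ 2) by ring, mul_pow, mul_pow]; ring
    rw [this]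
    push_cast
    ring
  · obtain ⟨i, rfl⟩ : ∃ i, j = i + 2 := ⟨j - 2, by omega⟩
    rw [show (2 * (i + 2) + 1) % 2 = 1 by omega, show (2 * (i + 2) + 1 - 4 - 1) / 2 = i by omega,
      show 2 * (i + 2) + 1 - 2 - 1 = 2 * (i + 1) by omega,
      show (2 + (2 * (i + 2) + 1) + 1) / 2 = i + 4 by omega, pow_mul (2 : ℝ),
      pow_succ (-12 * z), pow_mul (-12 * z)]
    have : ((-12 * z) ^ 2) ^ (i + 2) * (-12 * z) =
        -((2 ^ 2) ^ (i + 1) * 3 ^ (i + 4) * (12 * z ^ 2) ^ i * (768 * z ^ 5)) := by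
      rw [show (-12 * z) ^ 2 = 2 ^ 2 * 3 * (12 * z ^ 2) by ring, mul_pow, mul_pow]; ring
    rw [this]
    push_cast
    ring

/-- `theoryQ` on conformally flat curvatures with traceless Ricci eigenvalues `3 z, -z, -z, -z`. -/
theorem theoryQ_isotropic {n : ℕ} (hn : 3 ≤ n) (hW2 : weylSq g Rm = 0) (hW3 : weylCube g Rm = 0)
    (hWZ : weylZZ g Rm = 0) (h2 : Z2 g Rm = 12 * z ^ 2)
    (h3 : Z3 g Rm = 24 * z ^ 3) (h4 : Z4 g Rm = 84 * z ^ 4) :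
    theoryQ n g Rm = (scalarR g Rm - 12 * z) ^ n
      + 12 * n * z * (scalarR g Rm - 12 * z) ^ (n - 1) := by
  set R := scalarR g Rm
  have hW : ∀ l, calW l g Rm = 0 := fun l => by simp [calW, hW2, hW3]
  rw [theoryQ, if_neg (by omega), if_neg (by omega), theoryS, if_neg (by omega), if_neg (by omega)]
  simp only [hW, hWZ, mul_zero, zero_mul, Finset.sum_const_zero, add_zero]
  have e0 := sum_choose_mul_pow R (-12 * z) n
  have e1 := sum_mul_choose_mul_pow R (-12 * z) n
  have e : (R - 12 * z) ^ n + 12 * n * z * (R - 12 * z) ^ (n - 1) =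
      ∑ m ∈ Finset.range (n + 1), -(((m : ℝ) - 1) * n.choose m * (-12 * z) ^ m) * R ^ (n - m) := by
    calc _ = (R + -12 * z) ^ n + 12 * z * (n * (R + -12 * z) ^ (n - 1)) := by ring
      _ = _ := by
        rw [← e0, ← e1, Finset.mul_sum, ← Finset.sum_add_distrib]
        refine Finset.sum_congr rfl fun m _ => ?_
        rcases m with _ | m
        · simp
        · rw [Nat.add_sub_cancel]; push_cast; ring
  rw [e]
  have c2 : (n.choose 2 : ℝ) = n * ((n : ℝ) - 1) / 2 := Nat.cast_choose_two ℝ n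
  -- The weight m - 1 vanishes at m = 1, which is why the theory has no term linear in Z. The terms
  -- m = 0, 2 come from `theoryS`, the term m = 3 from the Z_3 term of `theoryT`.
  have hlow : ∑ m ∈ Finset.range 4, -(((m : ℝ) - 1) * n.choose m * (-12 * z) ^ m) * R ^ (n - m) =
      R ^ n - 6 * n * ((n : ℝ) - 1) * R ^ (n - 2) * Z2 g Rm
        + 8 * omega n 3 / 3 * R ^ (n - 3) * Z3 g Rm := by
    simp only [Finset.sum_range_succ, Finset.sum_range_zero, h2, h3, omega, c2]
    norm_num
    ring
  -- Order 3 is not an exception: 8ω_{3,3}/3 = 144, and the sum from 4 on is empty.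
  by_cases hn3 : n = 3
  · subst hn3
    rw [hlow, theoryT, if_pos rfl]
    simp only [omega]
    norm_num
    rfl
  · have hT : ∑ l ∈ Finset.Icc 4 n, omega n l * R ^ (n - l) * Z2 g Rm ^ ((l - 4 - l % 2) / 2) *
        ((1 - ((l % 2 : ℕ) : ℝ)) * (Z2 g Rm ^ 2 - 4 * Z4 g Rm)
          + 8 * ((l % 2 : ℕ) : ℝ) / 3 * (Z2 g Rm * Z3 g Rm)) =
        ∑ m ∈ Finset.Ico 4 (n + 1),
          -(((m : ℝ) - 1) * n.choose m * (-12 * z) ^ m) * R ^ (n - m) := by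
      refine Finset.sum_congr (by ext; simp) fun l hl => ?_
      rw [← omega_mul_tracelessRicci (n := n) (Finset.mem_Ico.1 hl).1 h2 h3 h4]
      ring
    rw [theoryT, if_neg hn3, hT, ← Finset.sum_range_add_sum_Ico _ (show 4 ≤ n + 1 by omega), hlow]
    ring

end Isotropic

/-! ### The restricted Lagrangians of the two families -/

section Reduced

/-- Sectional curvatures of static spherically symmetric metrics with `g_tt g_rr = -1`. -/
def secSSS (A B D : ℝ) : Fin 4 → Fin 4 → ℝ :=
  ![![0, A, B, B], ![A, 0, B, B], ![B, B, 0, D], ![B, B, D, 0]]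

/-- Sectional curvatures of FLRW metrics. -/
def secFLRW (α β : ℝ) : Fin 4 → Fin 4 → ℝ :=
  ![![0, α, α, α], ![α, 0, β, β], ![α, β, 0, β], ![α, β, β, 0]]

theorem isSec_secSSS (A B D : ℝ) : IsSec (secSSS A B D) where
  symm a b := by fin_cases a <;> fin_cases b <;> rfl
  diag a := by fin_cases a <;> rfl

theorem isSec_secFLRW (α β : ℝ) : IsSec (secFLRW α β) where
  symm a b := by fin_cases a <;> fin_cases b <;> rfl
  diag a := by fin_cases a <;> rfl

theorem secR_secSSS (A B D : ℝ) : secR (secSSS A B D) = 2 * (A + 4 * B + D) := by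
  simp [secR, secRic, secSSS, Fin.sum_univ_four]; ring

theorem secZ_secSSS (A B D : ℝ) : secZ (secSSS A B D) =
    ![(A - D) / 2, (A - D) / 2, -((A - D) / 2), -((A - D) / 2)] := by
  funext a
  fin_cases a <;> simp [secZ, secR_secSSS] <;> simp [secRic, secSSS, Fin.sum_univ_four] <;> ring

/-- The Weyl part has the pattern (c, -c/2, c) with c = (A-2B+D)/3, which is type D. -/
theorem secW_secSSS (A B D : ℝ) : secW (secSSS A B D) =
    secSSS ((A - 2 * B + D) / 3) (-((A - 2 * B + D) / 6)) ((A - 2 * B + D) / 3) := by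
  funext a b
  fin_cases a <;> fin_cases b <;> simp [secW, secR_secSSS] <;>
    simp [secRic, secSSS, Fin.sum_univ_four] <;> ring

theorem secR_secFLRW (α β : ℝ) : secR (secFLRW α β) = 6 * (α + β) := by
  simp [secR, secRic, secFLRW, Fin.sum_univ_four]; ring

theorem secZ_secFLRW (α β : ℝ) : secZ (secFLRW α β) =
    ![3 * ((α - β) / 2), -((α - β) / 2), -((α - β) / 2), -((α - β) / 2)] := by
  funext a
  fin_cases a <;> simp [secZ, secR_secFLRW] <;> simp [secRic, secFLRW, Fin.sum_univ_four] <;> ring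

theorem secW_secFLRW (α β : ℝ) : secW (secFLRW α β) = 0 := by
  funext a b
  fin_cases a <;> fin_cases b <;> simp [secW, secR_secFLRW] <;>
    simp [secRic, secFLRW, Fin.sum_univ_four] <;> ring

variable {G : Fin 4 → ℝ}

/-- The traceless Ricci eigenvalues are z, z, -z, -z, so the cubes cancel and (4z²)² = 4·(4z⁴).
Every term of `theoryT` contains one of these two vanishing factors. -/
theorem theoryT_secSSS (n : ℕ) (hG : ∀ i, G i ≠ 0) (A B D : ℝ) :
    theoryT n (diagonal G) (diagCurv G (secSSS A B D)) = 0 := by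
  have hK := isSec_secSSS A B D
  apply theoryT_eq_zero
  · rw [Z3_diagCurv hG hK, secZ_secSSS]
    simp [Fin.sum_univ_four]; ring
  · rw [Z2_diagCurv hG hK, Z4_diagCurv hG hK, secZ_secSSS]
    simp [Fin.sum_univ_four]; ring

/-- The base of the resummed powers is R - 6c = 12B. With a = A - B and d = D - B, the quadratic
coefficient is 54c² - 24z² = 6((a+d)² - (a-d)²) = 24ad, so L is affine in A and in D separately. -/
theorem redQ_secSSS {n : ℕ} (hn : 1 ≤ n) (A B D : ℝ) :
    redQ n (secSSS A B D) = (12 * B) ^ n + 2 * n * (A + D - 2 * B) * (12 * B) ^ (n - 1)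
      + 24 * n * ((n : ℝ) - 1) * (A - B) * (D - B) * (12 * B) ^ (n - 2) := by
  have hK := isSec_secSSS A B D
  have hG : ∀ i : Fin 4, (fun _ : Fin 4 => (1 : ℝ)) i ≠ 0 := fun _ => one_ne_zero
  have hR := scalarR_diagCurv hG hK
  have hZ2 : Z2 (diagonal fun _ => 1) (diagCurv (fun _ => 1) (secSSS A B D)) =
      4 * ((A - D) / 2) ^ 2 := by
    rw [Z2_diagCurv hG hK, secZ_secSSS]
    simp [Fin.sum_univ_four]; ring
  have hW2 : weylSq (diagonal fun _ => 1) (diagCurv (fun _ => 1) (secSSS A B D)) =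
      12 * ((A - 2 * B + D) / 3) ^ 2 := by
    rw [weylSq_diagCurv hG hK, secW_secSSS]
    simp [secSSS, Fin.sum_univ_four]; ring
  rw [secR_secSSS] at hR
  rw [redQ, theoryQ]
  split_ifs with h1 h2
  · subst h1
    rw [hR]; norm_num; ring
  · subst h2
    rw [hR, hZ2, hW2]; norm_num; ring
  · have hW3 : weylCube (diagonal fun _ => 1) (diagCurv (fun _ => 1) (secSSS A B D)) =
        12 * ((A - 2 * B + D) / 3) ^ 3 := by
      rw [weylCube_diagCurv hG hK, secW_secSSS]
      simp [secSSS, Fin.sum_univ_four]; ring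
    have hWZ : weylZZ (diagonal fun _ => 1) (diagCurv (fun _ => 1) (secSSS A B D)) =
        8 * ((A - 2 * B + D) / 3) * ((A - D) / 2) ^ 2 := by
      rw [weylZZ_diagCurv hG hK, secW_secSSS, secZ_secSSS]
      simp [secSSS, Fin.sum_univ_four]; ring
    rw [theoryT_secSSS n hG, theoryS_typeD (by omega) hW2 hW3 hWZ hZ2, hR,
      show 2 * (A + 4 * B + D) - 6 * ((A - 2 * B + D) / 3) = 12 * B by ring]
    obtain ⟨N, rfl⟩ : ∃ N, n = N + 2 := ⟨n - 2, by omega⟩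
    simp only [Nat.add_sub_cancel, show N + 2 - 1 = N + 1 by omega]
    push_cast
    ring

/-- Here the base is R - 12z = 12β, and α, which carries the second derivative of the scale factor,
enters only linearly. -/
theorem redQ_secFLRW {n : ℕ} (hn : 1 ≤ n) (α β : ℝ) :
    redQ n (secFLRW α β) = (12 * β) ^ n + 6 * n * (α - β) * (12 * β) ^ (n - 1) := by
  have hK := isSec_secFLRW α β
  have hG : ∀ i : Fin 4, (fun _ : Fin 4 => (1 : ℝ)) i ≠ 0 := fun _ => one_ne_zero
  have hR := scalarR_diagCurv hG hK
  have hZ2 : Z2 (diagonal fun _ => 1) (diagCurv (fun _ => 1) (secFLRW α β)) =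
      12 * ((α - β) / 2) ^ 2 := by
    rw [Z2_diagCurv hG hK, secZ_secFLRW]
    simp [Fin.sum_univ_four]; ring
  have hW2 : weylSq (diagonal fun _ => 1) (diagCurv (fun _ => 1) (secFLRW α β)) = 0 := by
    rw [weylSq_diagCurv hG hK, secW_secFLRW]; simp
  rw [secR_secFLRW] at hR
  by_cases h1 : n = 1
  · subst h1
    rw [redQ, theoryQ, if_pos rfl, hR]; norm_num; ring
  by_cases h2 : n = 2
  · subst h2
    rw [redQ, theoryQ, if_neg (by norm_num), if_pos rfl, hR, hZ2, hW2]; norm_num; ring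
  have hW3 : weylCube (diagonal fun _ => 1) (diagCurv (fun _ => 1) (secFLRW α β)) = 0 := by
    rw [weylCube_diagCurv hG hK, secW_secFLRW]; simp
  have hWZ : weylZZ (diagonal fun _ => 1) (diagCurv (fun _ => 1) (secFLRW α β)) = 0 := by
    rw [weylZZ_diagCurv hG hK, secW_secFLRW]; simp
  have hZ3 : Z3 (diagonal fun _ => 1) (diagCurv (fun _ => 1) (secFLRW α β)) =
      24 * ((α - β) / 2) ^ 3 := by
    rw [Z3_diagCurv hG hK, secZ_secFLRW]
    simp [Fin.sum_univ_four]; ring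
  have hZ4 : Z4 (diagonal fun _ => 1) (diagCurv (fun _ => 1) (secFLRW α β)) =
      84 * ((α - β) / 2) ^ 4 := by
    rw [Z4_diagCurv hG hK, secZ_secFLRW]
    simp [Fin.sum_univ_four]; ring
  rw [redQ, theoryQ_isotropic (by omega) hW2 hW3 hWZ hZ2 hZ3 hZ4, hR,
    show 6 * (α + β) - 12 * ((α - β) / 2) = 12 * β by ring]
  ring

end Reduced

/-! ### Derivatives of the restricted Lagrangians -/

/-- The `j`-th derivative of the function `x ↦ (12 x) ^ n`. -/
def pot (n j : ℕ) (x : ℝ) : ℝ := 12 ^ j * n.descFactorial j * (12 * x) ^ (n - j)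

/-- The falling factorial vanishes once `j` exceeds `n`, so the formula survives the truncated
exponent. -/
theorem hasDerivAt_pot (n j : ℕ) (x : ℝ) : HasDerivAt (pot n j) (pot n (j + 1) x) x := by
  have h := (((hasDerivAt_id x).const_mul 12).pow (n - j)).const_mul
    ((12 : ℝ) ^ j * n.descFactorial j)
  refine h.congr_deriv ?_
  rw [pot, Nat.descFactorial_succ, Nat.sub_sub]
  push_cast
  simp only [id]
  ring

theorem hasDerivAt_pot_const_add (n j : ℕ) (x : ℝ) :
    HasDerivAt (fun ε : ℝ => pot n j (x + ε)) (pot n (j + 1) x) 0 := by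
  have h1 : HasDerivAt (pot n j) (pot n (j + 1) x) (x + 0) := by
    simpa using hasDerivAt_pot n j x
  exact (h1.comp (0 : ℝ) ((hasDerivAt_id (0 : ℝ)).const_add x)).congr_deriv (mul_one _)

theorem contDiff_pot (n j : ℕ) : ContDiff ℝ ∞ (pot n j) := by
  unfold pot; fun_prop

theorem redQ_secSSS_eq_pot {n : ℕ} (hn : 1 ≤ n) (A B D : ℝ) :
    redQ n (secSSS A B D) = pot n 0 B + (A + D - 2 * B) / 6 * pot n 1 B
      + (A - B) * (D - B) / 6 * pot n 2 B := by
  rw [redQ_secSSS hn]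
  simp only [pot, Nat.descFactorial_zero, Nat.descFactorial_one, Nat.cast_descFactorial_two,
    Nat.sub_zero]
  push_cast
  ring

theorem redQ_secFLRW_eq_pot {n : ℕ} (hn : 1 ≤ n) (α β : ℝ) :
    redQ n (secFLRW α β) = pot n 0 β + (α - β) / 2 * pot n 1 β := by
  rw [redQ_secFLRW hn]
  simp only [pot, Nat.descFactorial_zero, Nat.descFactorial_one, Nat.sub_zero]
  push_cast
  ring

/-- The derivative of `theoryQ` in a direction of curvature space, from a curve of curvatures. -/
theorem fderiv_redQ_eq {n : ℕ} {K K' : Fin 4 → Fin 4 → ℝ} {φ : ℝ → ℝ} {φ' : ℝ}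
    (hφ : ∀ ε : ℝ, redQ n (K + ε • K') = φ ε) (h : HasDerivAt φ φ' 0) :
    fderiv ℝ (redQ n) K K' = φ' :=
  (hasDerivAt_redQ_line n K K').unique (by rw [funext hφ]; exact h)

/-- The derivative of the reduced Lagrangian with respect to `A`, and with `A` and `D` exchanged with
respect to `D`. -/
def uSSS (n : ℕ) (B D : ℝ) : ℝ := pot n 1 B / 6 + (D - B) * pot n 2 B / 6

/-- A quarter of the derivative of the reduced Lagrangian with respect to `B`. -/
def vSSS (n : ℕ) (A B D : ℝ) : ℝ := pot n 1 B / 6 + (A - B) * (D - B) * pot n 3 B / 24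

theorem secP_secSSS_01 {n : ℕ} (hn : 1 ≤ n) (A B D : ℝ) :
    secP n (secSSS A B D) 0 1 = uSSS n B D := by
  rw [secP_eq_fderiv]
  have h : ∀ ε : ℝ, secSSS A B D + ε • secUnit 0 1 = secSSS (A + ε) B D := by
    intro ε; funext i j
    fin_cases i <;> fin_cases j <;> simp [secSSS, secUnit]
  refine fderiv_redQ_eq (fun ε => by rw [h, redQ_secSSS_eq_pot hn]) ?_
  have h1 := (((((hasDerivAt_id (0 : ℝ)).const_add A).add_const D).sub_const (2 * B)).div_const 6
    |>.mul_const (pot n 1 B)).const_add (pot n 0 B)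
  have h2 := ((((hasDerivAt_id (0 : ℝ)).const_add A).sub_const B).mul_const (D - B)).div_const 6
    |>.mul_const (pot n 2 B)
  refine (h1.add h2).congr_deriv ?_
  rw [uSSS]; ring

theorem secP_secSSS_23 {n : ℕ} (hn : 1 ≤ n) (A B D : ℝ) :
    secP n (secSSS A B D) 2 3 = uSSS n B A := by
  rw [secP_eq_fderiv]
  have h : ∀ ε : ℝ, secSSS A B D + ε • secUnit 2 3 = secSSS A B (D + ε) := by
    intro ε; funext i j
    fin_cases i <;> fin_cases j <;> simp [secSSS, secUnit]
  refine fderiv_redQ_eq (fun ε => by rw [h, redQ_secSSS_eq_pot hn]) ?_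
  have h1 := (((((hasDerivAt_id (0 : ℝ)).const_add D).const_add A).sub_const (2 * B)).div_const 6
    |>.mul_const (pot n 1 B)).const_add (pot n 0 B)
  have h2 := ((((hasDerivAt_id (0 : ℝ)).const_add D).sub_const B).const_mul (A - B)).div_const 6
    |>.mul_const (pot n 2 B)
  refine (h1.add h2).congr_deriv ?_
  rw [uSSS]; ring

/-- Moving B moves four planes, which the swaps t↔r and θ↔φ identify, so each contributes a quarter.
The h'' terms of the B-derivative cancel; that is why `vSSS` contains only h' and h'''. -/
theorem secP_secSSS_02 {n : ℕ} (hn : 1 ≤ n) (A B D : ℝ) :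
    secP n (secSSS A B D) 0 2 = vSSS n A B D := by
  have hK := isSec_secSSS A B D
  have hσ : ∀ a b, secSSS A B D (Equiv.swap 0 1 a) (Equiv.swap 0 1 b) = secSSS A B D a b := by
    intro a b; fin_cases a <;> fin_cases b <;> rfl
  have hτ : ∀ a b, secSSS A B D (Equiv.swap 2 3 a) (Equiv.swap 2 3 b) = secSSS A B D a b := by
    intro a b; fin_cases a <;> fin_cases b <;> rfl
  have h03 : secP n (secSSS A B D) 0 3 = secP n (secSSS A B D) 0 2 :=
    secP_perm n hK (Equiv.swap 2 3) hτ (a := 0) (b := 2) (by decide)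
  have h12 : secP n (secSSS A B D) 1 2 = secP n (secSSS A B D) 0 2 :=
    secP_perm n hK (Equiv.swap 0 1) hσ (a := 0) (b := 2) (by decide)
  have h13 : secP n (secSSS A B D) 1 3 = secP n (secSSS A B D) 0 3 :=
    secP_perm n hK (Equiv.swap 0 1) hσ (a := 0) (b := 3) (by decide)
  have h : ∀ ε : ℝ, secSSS A B D + ε • (secUnit 0 2 + secUnit 0 3 + secUnit 1 2 + secUnit 1 3) =
      secSSS A (B + ε) D := by
    intro ε; funext i j
    fin_cases i <;> fin_cases j <;> simp [secSSS, secUnit]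
  have hB : HasDerivAt (fun ε : ℝ => B + ε) 1 0 := (hasDerivAt_id (0 : ℝ)).const_add B
  have hp := fun j => hasDerivAt_pot_const_add n j B
  have h1 := (((hB.const_mul 2).const_sub (A + D)).div_const 6).mul (hp 1)
  have h2 := (((hB.const_sub A).mul (hB.const_sub D)).div_const 6).mul (hp 2)
  have key := fderiv_redQ_eq (fun ε => by rw [h, redQ_secSSS_eq_pot hn]; rfl) (((hp 0).add h1).add h2)
  simp only [map_add, ← secP_eq_fderiv, h13, h12, h03] at key
  rw [vSSS]
  simp only [add_zero, Pi.mul_apply] at key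
  linear_combination key / 4

theorem secP_secSSS {n : ℕ} (hn : 1 ≤ n) (A B D : ℝ) {a b : Fin 4} (hab : a ≠ b) :
    secP n (secSSS A B D) a b = secSSS (uSSS n B D) (vSSS n A B D) (uSSS n B A) a b := by
  have hK := isSec_secSSS A B D
  have hσ : ∀ a b, secSSS A B D (Equiv.swap 0 1 a) (Equiv.swap 0 1 b) = secSSS A B D a b := by
    intro a b; fin_cases a <;> fin_cases b <;> rfl
  have hτ : ∀ a b, secSSS A B D (Equiv.swap 2 3 a) (Equiv.swap 2 3 b) = secSSS A B D a b := by
    intro a b; fin_cases a <;> fin_cases b <;> rfl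
  have h02 := secP_secSSS_02 hn A B D
  have h03 : secP n (secSSS A B D) 0 3 = vSSS n A B D :=
    (secP_perm n hK (Equiv.swap 2 3) hτ (a := 0) (b := 2) (by decide)).trans h02
  have h12 : secP n (secSSS A B D) 1 2 = vSSS n A B D :=
    (secP_perm n hK (Equiv.swap 0 1) hσ (a := 0) (b := 2) (by decide)).trans h02
  have h13 : secP n (secSSS A B D) 1 3 = vSSS n A B D :=
    (secP_perm n hK (Equiv.swap 0 1) hσ (a := 0) (b := 3) (by decide)).trans h03
  have h01 := secP_secSSS_01 hn A B D
  have h23 := secP_secSSS_23 hn A B D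
  fin_cases a <;> fin_cases b
  exacts [absurd rfl hab, h01, h02, h03, (secP_comm _ _ _ _).trans h01, absurd rfl hab, h12, h13,
    (secP_comm _ _ _ _).trans h02, (secP_comm _ _ _ _).trans h12, absurd rfl hab, h23,
    (secP_comm _ _ _ _).trans h03, (secP_comm _ _ _ _).trans h13, (secP_comm _ _ _ _).trans h23,
    absurd rfl hab]

/-- A third of the derivative of the reduced Lagrangian on FLRW metrics with respect to `β`. -/
def qFLRW (n : ℕ) (α β : ℝ) : ℝ := pot n 1 β / 6 + (α - β) * pot n 2 β / 6

theorem secP_secFLRW {n : ℕ} (hn : 1 ≤ n) (α β : ℝ) {a b : Fin 4} (hab : a ≠ b) :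
    secP n (secFLRW α β) a b = secFLRW (pot n 1 β / 6) (qFLRW n α β) a b := by
  have hK := isSec_secFLRW α β
  have hσ : ∀ a b, secFLRW α β (Equiv.swap 1 2 a) (Equiv.swap 1 2 b) = secFLRW α β a b := by
    intro a b; fin_cases a <;> fin_cases b <;> rfl
  have hτ : ∀ a b, secFLRW α β (Equiv.swap 2 3 a) (Equiv.swap 2 3 b) = secFLRW α β a b := by
    intro a b; fin_cases a <;> fin_cases b <;> rfl
  have h02 : secP n (secFLRW α β) 0 2 = secP n (secFLRW α β) 0 1 :=
    secP_perm n hK (Equiv.swap 1 2) hσ (a := 0) (b := 1) (by decide)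
  have h03 : secP n (secFLRW α β) 0 3 = secP n (secFLRW α β) 0 1 :=
    (secP_perm n hK (Equiv.swap 2 3) hτ (a := 0) (b := 2) (by decide)).trans h02
  have h13 : secP n (secFLRW α β) 1 3 = secP n (secFLRW α β) 1 2 :=
    secP_perm n hK (Equiv.swap 2 3) hτ (a := 1) (b := 2) (by decide)
  have h23 : secP n (secFLRW α β) 2 3 = secP n (secFLRW α β) 1 2 :=
    (secP_perm n hK (Equiv.swap 1 2) hσ (a := 1) (b := 3) (by decide)).trans h13
  have hα : ∀ ε : ℝ, secFLRW α β + ε • (secUnit 0 1 + secUnit 0 2 + secUnit 0 3) =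
      secFLRW (α + ε) β := by
    intro ε; funext i j
    fin_cases i <;> fin_cases j <;> simp [secFLRW, secUnit]
  have hβ : ∀ ε : ℝ, secFLRW α β + ε • (secUnit 1 2 + secUnit 1 3 + secUnit 2 3) =
      secFLRW α (β + ε) := by
    intro ε; funext i j
    fin_cases i <;> fin_cases j <;> simp [secFLRW, secUnit]
  have h01 : secP n (secFLRW α β) 0 1 = pot n 1 β / 6 := by
    have h1 := ((((hasDerivAt_id (0 : ℝ)).const_add α).sub_const β).div_const 2
      |>.mul_const (pot n 1 β)).const_add (pot n 0 β)
    have key := fderiv_redQ_eq (fun ε => by rw [hα, redQ_secFLRW_eq_pot hn]; rfl) h1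
    simp only [map_add, ← secP_eq_fderiv, h02, h03] at key
    linear_combination key / 3
  have h12 : secP n (secFLRW α β) 1 2 = qFLRW n α β := by
    have hB : HasDerivAt (fun ε : ℝ => β + ε) 1 0 := (hasDerivAt_id (0 : ℝ)).const_add β
    have hp := fun j => hasDerivAt_pot_const_add n j β
    have key := fderiv_redQ_eq (fun ε => by rw [hβ, redQ_secFLRW_eq_pot hn]; rfl)
      ((hp 0).add (((hB.const_sub α).div_const 2).mul (hp 1)))
    simp only [map_add, ← secP_eq_fderiv, h13, h23, add_zero] at key
    rw [qFLRW]
    linear_combination key / 3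
  rw [h01] at h02 h03
  rw [h12] at h13 h23
  fin_cases a <;> fin_cases b
  exacts [absurd rfl hab, h01, h02, h03, (secP_comm _ _ _ _).trans h01, absurd rfl hab, h12, h13,
    (secP_comm _ _ _ _).trans h02, (secP_comm _ _ _ _).trans h12, absurd rfl hab, h23,
    (secP_comm _ _ _ _).trans h03, (secP_comm _ _ _ _).trans h13, (secP_comm _ _ _ _).trans h23,
    absurd rfl hab]

/-! ### Coordinate partial derivatives -/

section PartialDerivatives

/-- `φ` has the partial derivatives `φ' d` at `x`. -/
def HasPD (φ : Pt → ℝ) (φ' : Fin 4 → ℝ) (x : Pt) : Prop :=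
  ∀ d, HasDerivAt (fun s => φ (Function.update x d s)) (φ' d) (x d)

variable {φ ψ : Pt → ℝ} {φ' : Fin 4 → ℝ} {x : Pt}

theorem HasPD.pd_eq (h : HasPD φ φ' x) (d : Fin 4) : pd d φ x = φ' d := (h d).deriv

/-- Coordinate lines through `x` stay in `U` near `x`, so an explicit formula valid only on the
regular part of the chart may be differentiated there. -/
theorem HasPD.congr_on {U : Set Pt} (h : HasPD φ φ' x) (hU : IsOpen U) (hx : x ∈ U)
    (hφ : ∀ y ∈ U, ψ y = φ y) : HasPD ψ φ' x := by
  intro d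
  refine (h d).congr_of_eventuallyEq ?_
  have h1 : Filter.Tendsto (fun s => Function.update x d s) (nhds (x d)) (nhds x) := by
    have : Continuous fun s : ℝ => Function.update x d s := by fun_prop
    simpa using this.tendsto (x d)
  filter_upwards [h1.eventually (hU.mem_nhds hx)] with s hs
  exact hφ _ hs

theorem hasPD_const (c : ℝ) : HasPD (fun _ => c) 0 x := fun d => hasDerivAt_const (x d) c

theorem hasPD_zero : HasPD 0 0 x := hasPD_const 0

theorem HasPD.sub {ψ' : Fin 4 → ℝ} (h : HasPD φ φ' x) (h' : HasPD ψ ψ' x) :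
    HasPD (fun y => φ y - ψ y) (fun d => φ' d - ψ' d) x := fun d => (h d).sub (h' d)

theorem HasPD.mul_const (h : HasPD φ φ' x) (c : ℝ) :
    HasPD (fun y => φ y * c) (fun d => φ' d * c) x := fun d => (h d).mul_const c

/-- Partial derivatives of a function which separates in the first three coordinates. -/
theorem hasPD_separable {A B C : ℝ → ℝ} {A' B' C' : ℝ} (hA : HasDerivAt A A' (x 0))
    (hB : HasDerivAt B B' (x 1)) (hC : HasDerivAt C C' (x 2)) :
    HasPD (fun y => A (y 0) * B (y 1) * C (y 2))
      ![A' * B (x 1) * C (x 2), A (x 0) * B' * C (x 2), A (x 0) * B (x 1) * C', 0] x := by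
  intro d
  fin_cases d
  · simpa using (hA.mul_const (B (x 1))).mul_const (C (x 2))
  · simpa using (hB.const_mul (A (x 0))).mul_const (C (x 2))
  · simpa using hC.const_mul (A (x 0) * B (x 1))
  · simpa using hasDerivAt_const (x 3) (A (x 0) * B (x 1) * C (x 2))

end PartialDerivatives

/-! ### Connection, divergences and field equations for diagonal metrics -/

section DiagonalMetric

variable {g : Pt → Mat} {G : Fin 4 → Pt → ℝ} {x : Pt}

/-- Christoffel symbols of a diagonal metric. -/
theorem christoffel_diagonal (hg : ∀ y, g y = diagonal fun i => G i y) (hG : ∀ i, G i x ≠ 0)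
    {dG : Fin 4 → Fin 4 → ℝ} (hd : ∀ i, HasPD (G i) (dG i) x) (c a b : Fin 4) :
    christoffel g c a b x = 1 / 2 * (G c x)⁻¹ * ((if b = c then dG c a else 0)
      + (if a = c then dG c b else 0) - (if a = b then dG a c else 0)) := by
  have h : ∀ i j k, pd k (fun y => g y i j) x = if i = j then dG i k else 0 := by
    intro i j k
    split_ifs with hij
    · subst hij
      simpa [hg] using (hd i).pd_eq k
    · simpa [hg, hij] using (hasPD_const (x := x) 0).pd_eq k
  simp only [christoffel, h, hg x, inv_diagonal_of_ne_zero hG, diagonal_apply, ite_mul, zero_mul,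
    Finset.sum_ite_eq, Finset.mem_univ, if_true]
  by_cases h1 : b = c
  · subst h1
    by_cases h2 : a = b
    · subst h2; simp; ring
    · simp [h2]; ring
  · by_cases h2 : a = c
    · subst h2; simp [h1]; ring
    · simp [h1, h2]; ring

theorem riemann_diagonal (hg : g x = diagonal fun i => G i x) (a b c d : Fin 4) :
    riemann g x a b c d = riemannUp g a b c d x * G d x := by
  simp [riemann, hg, diagonal_apply]

theorem riemannUp_swap (a b c d : Fin 4) : riemannUp g a b c d x = -riemannUp g b a c d x := by
  simp only [riemannUp, Finset.sum_sub_distrib]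
  ring

theorem diagCurv_swap (G : Fin 4 → ℝ) {K : Fin 4 → Fin 4 → ℝ} (hK : IsSec K) (a b c d : Fin 4) :
    diagCurv G K a b c d = -diagCurv G K b a c d := by
  simp only [diagCurv, hK.symm a b]
  simp only [← ite_and, and_comm]
  ring

/-- To identify a curvature tensor as diagonal, one ordering of the first index pair suffices. -/
theorem riemann_eq_diagCurv (hg : g x = diagonal fun i => G i x) {K : Fin 4 → Fin 4 → ℝ}
    (hK : IsSec K) (h : ∀ a b, a < b → ∀ c d, riemannUp g a b c d x * G d x =
      diagCurv (fun i => G i x) K a b c d) : riemann g x = diagCurv (fun i => G i x) K := by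
  funext a b c d
  rw [riemann_diagonal hg]
  rcases lt_trichotomy a b with hab | hab | hab
  · exact h a b hab c d
  · subst hab
    have h1 := riemannUp_swap (g := g) (x := x) a a c d
    have h2 := diagCurv_swap (fun i => G i x) hK a a c d
    rw [show riemannUp g a a c d x = 0 by linarith, show diagCurv _ K a a c d = 0 by linarith,
      zero_mul]
  · rw [riemannUp_swap, diagCurv_swap _ hK, neg_mul, h b a hab c d]

/-- The divergence of a momentum of diagonal type. -/
theorem divMomentum_diagonal {L : Lagrangian} {π : Fin 4 → Fin 4 → Pt → ℝ}
    {dπ : Fin 4 → Fin 4 → Fin 4 → ℝ} {U : Set Pt} (hU : IsOpen U) (hx : x ∈ U)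
    (hP : ∀ y ∈ U, ∀ a b c d, momentum L g a b c d y = π a b y *
      ((if a = c then if b = d then 1 else 0 else 0)
        - (if a = d then if b = c then 1 else 0 else 0)))
    (hπ : ∀ a b, HasPD (π a b) (dπ a b) x) (hπs : ∀ a b, π a b = π b a)
    (hπd : ∀ a, π a a x = 0) {Γ : Fin 4 → Fin 4 → Fin 4 → ℝ}
    (hΓ : ∀ c a b, christoffel g c a b x = Γ c a b) (hΓs : ∀ c a b, Γ c a b = Γ c b a)
    (hΓ0 : ∀ c a b, c ≠ a → c ≠ b → a ≠ b → Γ c a b = 0) {v : Fin 4 → Fin 4 → ℝ}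
    (hv : ∀ a c, a ≠ c → v a c = dπ a c a + ∑ d, Γ d d a * π a c x + ∑ m, Γ a m m * π m c x
      + Γ c a c * π a c x) (a c b : Fin 4) :
    divMomentum L g a c b x = (if c = b then v a c else 0) - (if a = b then v c a else 0) := by
  have h1 : ∀ d, pd d (momentum L g a c d b) x = dπ a c d *
      ((if a = d then if c = b then 1 else 0 else 0)
        - (if a = b then if c = d then 1 else 0 else 0)) := by
    intro d
    exact (((hπ a c).mul_const _).congr_on hU hx fun y hy => hP y hy a c d b).pd_eq d
  have e0 : ∑ d, dπ a c d * ((if a = d then if c = b then 1 else 0 else 0)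
      - (if a = b then if c = d then 1 else 0 else 0)) =
      (if c = b then dπ a c a else 0) - (if a = b then dπ a c c else 0) := by
    simp only [mul_sub, mul_ite, mul_one, mul_zero, Finset.sum_sub_distrib, Finset.sum_ite_eq,
      Finset.mem_univ, if_true]
    congr 1
    split_ifs <;> simp
  have e1 : ∑ d, ∑ m, Γ a d m * (π m c x * ((if m = d then if c = b then 1 else 0 else 0)
      - (if m = b then if c = d then 1 else 0 else 0))) =
      (if c = b then ∑ m, Γ a m m * π m c x else 0) - Γ a c b * π b c x := by
    simp only [mul_sub, mul_ite, mul_one, mul_zero, Finset.sum_sub_distrib, Finset.sum_ite_eq,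
      Finset.sum_ite_eq', Finset.mem_univ, if_true]
    congr 1
    split_ifs <;> simp
  have e2 : ∑ d, ∑ m, Γ c d m * (π a m x * ((if a = d then if m = b then 1 else 0 else 0)
      - (if a = b then if m = d then 1 else 0 else 0))) =
      Γ c a b * π a b x - (if a = b then ∑ m, Γ c m m * π m a x else 0) := by
    simp only [mul_sub, mul_ite, mul_one, mul_zero, Finset.sum_sub_distrib]
    congr 1
    · rw [Finset.sum_comm]
      simp
    · split_ifs <;> simp [hπs a]
  have e3 : ∑ d, ∑ m, Γ d d m * (π a c x * ((if a = m then if c = b then 1 else 0 else 0)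
      - (if a = b then if c = m then 1 else 0 else 0))) =
      (if c = b then ∑ d, Γ d d a * π a c x else 0)
        - (if a = b then ∑ d, Γ d d c * π a c x else 0) := by
    simp only [mul_sub, mul_ite, mul_one, mul_zero, Finset.sum_sub_distrib, Finset.sum_ite_eq,
      Finset.mem_univ, if_true]
    congr 1
    · split_ifs <;> simp
    · split_ifs <;> simp
  -- The symmetric connection is contracted with an antisymmetric index pair of P.
  have e4 : ∑ d, ∑ m, Γ b d m * (π a c x * ((if a = d then if c = m then 1 else 0 else 0)
      - (if a = m then if c = d then 1 else 0 else 0))) = 0 := by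
    simp only [mul_sub, mul_ite, mul_one, mul_zero, Finset.sum_sub_distrib, Finset.sum_ite_eq,
      Finset.mem_univ, if_true]
    rw [Finset.sum_comm]
    simp [hΓs b a c]
  have hd : divMomentum L g a c b x = (if c = b then dπ a c a else 0)
      - (if a = b then dπ a c c else 0)
      + ((if c = b then ∑ m, Γ a m m * π m c x else 0) - Γ a c b * π b c x)
      + (Γ c a b * π a b x - (if a = b then ∑ m, Γ c m m * π m a x else 0))
      + ((if c = b then ∑ d, Γ d d a * π a c x else 0)
        - (if a = b then ∑ d, Γ d d c * π a c x else 0)) := by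
    simp only [divMomentum, h1, hΓ, hP x hx, Finset.sum_add_distrib]
    linear_combination e0 + e1 + e2 + e3 + e4
  have hdπ : dπ a c c = dπ c a c := by
    refine (hπ a c c).unique ?_
    rw [hπs a c]
    exact hπ c a c
  have hac : π a c x = π c a x := by rw [hπs a c]
  have hab : π a b x = π b a x := by rw [hπs a b]
  by_cases hne : a = c
  · subst hne
    rw [hd, hab]
    ring
  rw [hd, hv a c hne, hv c a (Ne.symm hne), hdπ]
  by_cases h2 : c = b
  · subst h2
    simp [hne, hπd]
    ring
  · by_cases h3 : a = b
    · subst h3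
      simp only [h2, if_true, if_false, hπd, hΓs a c a, hac]
      ring
    · have h4 : Γ a c b * π b c x = Γ c a b * π a b x := by
        rw [hΓ0 a c b hne h3 h2, hΓ0 c a b (Ne.symm hne) h2 h3, zero_mul, zero_mul]
      simp only [h2, h3, if_false, h4]
      ring

/-- The second divergence of a momentum of diagonal type. -/
theorem divDivMomentum_diagonal {L : Lagrangian} {v : Fin 4 → Fin 4 → Pt → ℝ}
    {dv : Fin 4 → Fin 4 → Fin 4 → ℝ} {U : Set Pt} (hU : IsOpen U) (hx : x ∈ U)
    (hV : ∀ y ∈ U, ∀ a c b, divMomentum L g a c b y =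
      (if c = b then v a c y else 0) - (if a = b then v c a y else 0))
    (hv : ∀ a b, HasPD (v a b) (dv a b) x) {Γ : Fin 4 → Fin 4 → Fin 4 → ℝ}
    (hΓ : ∀ c a b, christoffel g c a b x = Γ c a b) (hΓs : ∀ c a b, Γ c a b = Γ c b a)
    (a b : Fin 4) :
    divDivMomentum L g a b x = dv a b b + ∑ d, Γ d d b * v a b x + ∑ c, Γ b c c * v a c x
      - ∑ c, Γ b c a * v c a x
      - (if a = b then ∑ c, (dv c a c + ∑ d, Γ d d c * v c a x) else 0) := by
  have h1 : ∀ c, pd c (divMomentum L g a c b) x =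
      (if c = b then dv a c c else 0) - (if a = b then dv c a c else 0) := by
    intro c
    refine HasPD.pd_eq (φ' := fun d => (if c = b then dv a c d else 0)
      - (if a = b then dv c a d else 0)) (HasPD.congr_on ?_ hU hx fun y hy => hV y hy a c b) c
    refine HasPD.sub ?_ ?_
    · split_ifs
      · exact hv a c
      · exact hasPD_zero
    · split_ifs
      · exact hv c a
      · exact hasPD_zero
  have e0 : ∑ c, ((if c = b then dv a c c else 0) - (if a = b then dv c a c else 0)) =
      dv a b b - (if a = b then ∑ c, dv c a c else 0) := by
    rw [Finset.sum_sub_distrib]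
    congr 1
    · simp
    · split_ifs <;> simp
  -- The first divergence is antisymmetric in the two indices contracted with the symmetric
  -- connection.
  have e1 : ∑ c, ∑ m, Γ a c m * ((if c = b then v m c x else 0) - (if m = b then v c m x else 0)) =
      0 := by
    simp only [mul_sub, mul_ite, mul_zero, Finset.sum_sub_distrib]
    rw [Finset.sum_comm]
    simp [hΓs a b]
  have e2 : ∑ c, ∑ m, Γ c c m * ((if m = b then v a m x else 0) - (if a = b then v m a x else 0)) =
      ∑ d, Γ d d b * v a b x - (if a = b then ∑ c, ∑ d, Γ d d c * v c a x else 0) := by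
    simp only [mul_sub, mul_ite, mul_zero, Finset.sum_sub_distrib]
    congr 1
    · simp
    · rw [Finset.sum_comm]
      split_ifs <;> simp
  have e3 : ∑ c, ∑ m, Γ b c m * ((if c = m then v a c x else 0) - (if a = m then v c a x else 0)) =
      ∑ c, Γ b c c * v a c x - ∑ c, Γ b c a * v c a x := by
    simp [mul_sub, Finset.sum_sub_distrib]
  have e4 : (if a = b then ∑ c, (dv c a c + ∑ d, Γ d d c * v c a x) else 0) =
      (if a = b then ∑ c, dv c a c else 0)
        + (if a = b then ∑ c, ∑ d, Γ d d c * v c a x else 0) := by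
    split_ifs <;> simp [Finset.sum_add_distrib]
  simp only [divDivMomentum, h1, hΓ, hV x hx, Finset.sum_add_distrib] at e0 e1 e2 e3 e4 ⊢
  linear_combination e0 + e1 + e2 + e3 + e4

/-- The field equations on a diagonal metric with diagonal curvature. -/
theorem fieldEq_diagonal {n : ℕ} (hg : g x = diagonal fun i => G i x) (hG : ∀ i, G i x ≠ 0)
    {K : Fin 4 → Fin 4 → ℝ} (hK : IsSec K) (hR : riemann g x = diagCurv (fun i => G i x) K)
    (a b : Fin 4) :
    fieldEq (theoryQ n) g a b x = (if a = b then (G a x)⁻¹ *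
        (1 / 2 * ∑ c, secP n K a c * K a c - 1 / 2 * redQ n K) else 0)
      - 2 * divDivMomentum (theoryQ n) g a b x := by
  have h1 : ∀ c d e, ∑ m, momentum (theoryQ n) g a c d e x * (g x)⁻¹ b m * riemann g x m c d e =
      momentum (theoryQ n) g a c d e x * (G b x)⁻¹ *
        diagCurv (fun i => G i x) K b c d e := by
    intro c d e
    simp only [hg, hR, inv_diagonal_of_ne_zero hG, diagonal_apply, mul_ite, ite_mul, mul_zero,
      zero_mul, Finset.sum_ite_eq, Finset.mem_univ, if_true]
  -- The two orders of the pair (d, e) contribute equally, which turns the 1/4 in P^{acac} into 1/2.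
  have h2 : ∀ c, ∑ d, ∑ e, momentum (theoryQ n) g a c d e x * (G b x)⁻¹ *
      diagCurv (fun i => G i x) K b c d e =
      if a = b then (G a x)⁻¹ * (1 / 2 * (secP n K a c * K a c)) else 0 := by
    intro c
    have ha := hG a
    have hb := hG b
    have hc := hG c
    simp only [momentum_diagCurv n hG hg hR hK, diagCurv]
    by_cases hac : a = c
    · subst hac
      simp [hK.diag]
    · by_cases hab : a = b
      · subst hab
        simp [hac, mul_sub, sub_mul, Finset.sum_sub_distrib, Ne.symm hac]
        field_simp
        ring
      · by_cases hbc : b = c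
        · subst hbc
          simp [hK.diag, hab]
        · simp [hac, mul_sub, sub_mul, Finset.sum_sub_distrib, hab, Ne.symm hbc]
  have h3 : onMetric (theoryQ n) g x = redQ n K := by
    rw [onMetric, hR, hg, theoryQ_diagCurv n hG hK]
  simp only [fieldEq, h3]
  simp only [h1, h2]
  simp only [hg, inv_diagonal_of_ne_zero hG, diagonal_apply]
  split_ifs
  · rw [← Finset.mul_sum, ← Finset.mul_sum]; ring
  · simp

end DiagonalMetric

/-! ### Two tables of coefficients for a diagonal connection -/

section DiagonalConnection

/-- The connection coefficients `Γ^c_{ab}` of a diagonal metric in terms of `L a b = Γ^a_{ab}` and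
`M c a = Γ^c_{aa}`. -/
def diagChr (L M : Fin 4 → Fin 4 → ℝ) (c a b : Fin 4) : ℝ :=
  if a = b then (if a = c then L c c else M c a)
  else if c = a then L a b else if c = b then L b a else 0

theorem diagChr_symm (L M : Fin 4 → Fin 4 → ℝ) (c a b : Fin 4) :
    diagChr L M c a b = diagChr L M c b a := by
  by_cases h : a = b
  · rw [h]
  · simp only [diagChr, h, Ne.symm h, if_false]
    split_ifs with h1 h2
    · exact absurd (h1.symm.trans h2) h
    all_goals rfl

theorem diagChr_of_ne (L M : Fin 4 → Fin 4 → ℝ) (c a b : Fin 4) (h1 : c ≠ a) (h2 : c ≠ b)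
    (h3 : a ≠ b) : diagChr L M c a b = 0 := by
  simp [diagChr, h1, h2, h3]

variable {g : Pt → Mat} {G : Fin 4 → Pt → ℝ} {x : Pt}

theorem christoffel_eq_diagChr (hg : ∀ y, g y = diagonal fun i => G i y) (hG : ∀ i, G i x ≠ 0)
    {dG : Fin 4 → Fin 4 → ℝ} (hd : ∀ i, HasPD (G i) (dG i) x) {L M : Fin 4 → Fin 4 → ℝ}
    (hL : ∀ a b, dG a b = 2 * G a x * L a b) (hM : ∀ c a, c ≠ a → dG a c = -2 * G c x * M c a)
    (c a b : Fin 4) : christoffel g c a b x = diagChr L M c a b := by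
  rw [christoffel_diagonal hg hG hd]
  have hc := hG c
  by_cases hab : a = b
  · subst hab
    by_cases hac : a = c
    · subst hac
      simp [diagChr, hL]; field_simp
    · simp [diagChr, hac, hM c a (Ne.symm hac)]; field_simp
  · by_cases hac : a = c
    · subst hac
      simp [diagChr, hab, Ne.symm hab, hL]; field_simp
    · by_cases hbc : b = c
      · subst hbc
        simp [diagChr, hab, Ne.symm hab, hL]; field_simp
      · simp [diagChr, hab, hac, hbc, Ne.symm hac, Ne.symm hbc]

/-- `diagChr` only selects entries of its two tables, so its partial derivatives are obtained by
inserting the differentiated tables. -/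
theorem riemannUp_eq_diagChr {U : Set Pt} (hU : IsOpen U) (hx : x ∈ U)
    {L M : Fin 4 → Fin 4 → Pt → ℝ} {dL dM : Fin 4 → Fin 4 → Fin 4 → ℝ}
    (hΓ : ∀ y ∈ U, ∀ c a b, christoffel g c a b y = diagChr (fun i j => L i j y)
      (fun i j => M i j y) c a b)
    (hL : ∀ a b, HasPD (L a b) (dL a b) x) (hM : ∀ a b, HasPD (M a b) (dM a b) x)
    (a b c d : Fin 4) :
    riemannUp g a b c d x =
      diagChr (fun i j => dL i j b) (fun i j => dM i j b) d a c
      - diagChr (fun i j => dL i j a) (fun i j => dM i j a) d b c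
      + ∑ e, (diagChr (fun i j => L i j x) (fun i j => M i j x) e c a *
          diagChr (fun i j => L i j x) (fun i j => M i j x) d b e
        - diagChr (fun i j => L i j x) (fun i j => M i j x) e c b *
          diagChr (fun i j => L i j x) (fun i j => M i j x) d a e) := by
  have h : ∀ c a b k, pd k (christoffel g c a b) x =
      diagChr (fun i j => dL i j k) (fun i j => dM i j k) c a b := by
    intro c a b k
    refine HasPD.pd_eq (φ' := fun k => diagChr (fun i j => dL i j k) (fun i j => dM i j k) c a b)
      (HasPD.congr_on ?_ hU hx fun y hy => hΓ y hy c a b) k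
    simp only [diagChr]
    split_ifs
    · exact hL _ _
    · exact hM _ _
    · exact hL _ _
    · exact hL _ _
    · exact hasPD_zero
  simp only [riemannUp, h, hΓ x hx]

end DiagonalConnection

/-! ### Partial derivatives of functions of one or two coordinates -/

section Coordinates

variable {x : Pt}

theorem hasPD_coord_one {B : ℝ → ℝ} {B' : ℝ} (hB : HasDerivAt B B' (x 1)) :
    HasPD (fun y => B (y 1)) ![0, B', 0, 0] x := by
  have h := hasPD_separable (x := x) (hasDerivAt_const (x 0) (1 : ℝ)) hB
    (hasDerivAt_const (x 2) (1 : ℝ))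
  simpa using h

theorem hasPD_coord_two {C : ℝ → ℝ} {C' : ℝ} (hC : HasDerivAt C C' (x 2)) :
    HasPD (fun y => C (y 2)) ![0, 0, C', 0] x := by
  have h := hasPD_separable (x := x) (hasDerivAt_const (x 0) (1 : ℝ))
    (hasDerivAt_const (x 1) (1 : ℝ)) hC
  simpa using h

theorem hasPD_coord_one_mul_two {B C : ℝ → ℝ} {B' C' : ℝ} (hB : HasDerivAt B B' (x 1))
    (hC : HasDerivAt C C' (x 2)) :
    HasPD (fun y => B (y 1) * C (y 2)) ![0, B' * C (x 2), B (x 1) * C', 0] x := by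
  have h := hasPD_separable (x := x) (hasDerivAt_const (x 0) (1 : ℝ)) hB hC
  simpa using h

theorem hasDerivAt_sin_sq (θ : ℝ) :
    HasDerivAt (fun θ => Real.sin θ ^ 2) (2 * Real.sin θ * Real.cos θ) θ := by
  simpa using (Real.hasDerivAt_sin θ).fun_pow 2

end Coordinates

/-! ### Curvature of static spherically symmetric metrics -/

section StaticSpherical

/-- Diagonal entries of `sss f`. -/
def sssG (f : ℝ → ℝ) (i : Fin 4) (y : Pt) : ℝ :=
  ![-f (y 1), (f (y 1))⁻¹, (y 1) ^ 2, (y 1) ^ 2 * (Real.sin (y 2)) ^ 2] i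

/-- The coefficients `Γ^a_{ab}` of `sss f`, where `f₁` is the derivative of `f`. -/
def sssL (f f₁ : ℝ → ℝ) (a b : Fin 4) (y : Pt) : ℝ :=
  ![![0, f₁ (y 1) / (2 * f (y 1)), 0, 0], ![0, -(f₁ (y 1) / (2 * f (y 1))), 0, 0],
    ![0, (y 1)⁻¹, 0, 0], ![0, (y 1)⁻¹, Real.cos (y 2) / Real.sin (y 2), 0]] a b

/-- The coefficients `Γ^c_{aa}` of `sss f`, where `f₁` is the derivative of `f`. -/
def sssM (f f₁ : ℝ → ℝ) (c a : Fin 4) (y : Pt) : ℝ :=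
  ![![0, 0, 0, 0],
    ![f (y 1) * f₁ (y 1) / 2, 0, -(y 1 * f (y 1)), -(y 1 * f (y 1)) * Real.sin (y 2) ^ 2],
    ![0, 0, 0, -(Real.sin (y 2) * Real.cos (y 2))], ![0, 0, 0, 0]] c a

/-- The part of the chart over `I` in which `sss f` is regular. -/
def sssDom (I : Set ℝ) : Set Pt := {y | y 1 ∈ I ∧ Real.sin (y 2) ≠ 0}

theorem isOpen_sssDom {I : Set ℝ} (hI : IsOpen I) : IsOpen (sssDom I) := by
  refine (hI.preimage (continuous_apply 1)).inter (isOpen_ne_fun ?_ continuous_const)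
  fun_prop

theorem sss_eq_diagonal (f : ℝ → ℝ) (y : Pt) : sss f y = diagonal fun i => sssG f i y := rfl

variable {f f₁ f₂ : ℝ → ℝ} {x : Pt}

theorem sssG_ne_zero (hr : 0 < x 1) (hf : f (x 1) ≠ 0) (hs : Real.sin (x 2) ≠ 0) (i : Fin 4) :
    sssG f i x ≠ 0 := by
  have := hr.ne'
  fin_cases i <;> simp [sssG, *]

theorem christoffel_sss (hr : 0 < x 1) (hf : f (x 1) ≠ 0) (hs : Real.sin (x 2) ≠ 0)
    (h1 : HasDerivAt f (f₁ (x 1)) (x 1)) (c a b : Fin 4) :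
    christoffel (sss f) c a b x =
      diagChr (fun i j => sssL f f₁ i j x) (fun i j => sssM f f₁ i j x) c a b := by
  have hr' := hr.ne'
  have hsq : HasDerivAt (fun r : ℝ => r ^ 2) (2 * x 1) (x 1) := by
    simpa using hasDerivAt_pow 2 (x 1)
  have hsin := hasDerivAt_sin_sq (x 2)
  have hd : ∀ i, HasPD (sssG f i) (![![0, -f₁ (x 1), 0, 0], ![0, -f₁ (x 1) / f (x 1) ^ 2, 0, 0],
      ![0, 2 * x 1, 0, 0], ![0, 2 * x 1 * Real.sin (x 2) ^ 2,
        x 1 ^ 2 * (2 * Real.sin (x 2) * Real.cos (x 2)), 0]] i) x := by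
    intro i
    fin_cases i
    · exact hasPD_coord_one (B := fun r => -f r) h1.neg
    · exact hasPD_coord_one (B := fun r => (f r)⁻¹) (h1.inv hf)
    · exact hasPD_coord_one hsq
    · exact hasPD_coord_one_mul_two hsq hsin
  refine christoffel_eq_diagChr (sss_eq_diagonal f) (sssG_ne_zero hr hf hs) hd ?_ ?_ c a b
  · intro a b
    fin_cases a <;> fin_cases b <;> simp [sssG, sssL] <;> field_simp
  · intro c a hca
    fin_cases c <;> fin_cases a <;> first | exact absurd rfl hca | (simp [sssG, sssM] <;> field_simp)

/-- Sectional curvatures of `sss f` at radius `r`. -/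
def sssK (f f₁ f₂ : ℝ → ℝ) (r : ℝ) : Fin 4 → Fin 4 → ℝ :=
  secSSS (-f₂ r / 2) (-f₁ r / (2 * r)) ((1 - f r) / r ^ 2)

set_option maxHeartbeats 2000000 in
theorem riemann_sss {I : Set ℝ} (hI : IsOpen I) (hI0 : I ⊆ Set.Ioi 0) (hf : ∀ r ∈ I, f r ≠ 0)
    (h1 : ∀ r ∈ I, HasDerivAt f (f₁ r) r) (h2 : ∀ r ∈ I, HasDerivAt f₁ (f₂ r) r)
    (hx : x ∈ sssDom I) :
    riemann (sss f) x = diagCurv (fun i => sssG f i x) (sssK f f₁ f₂ (x 1)) := by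
  have hr : x 1 ≠ 0 := (Set.mem_Ioi.1 (hI0 hx.1)).ne'
  have hf0 := hf _ hx.1
  have hs : Real.sin (x 2) ≠ 0 := hx.2
  have d1 := h1 _ hx.1
  have d2 := h2 _ hx.1
  have hq : HasDerivAt (fun r => f₁ r / (2 * f r))
      ((f₂ (x 1) * (2 * f (x 1)) - f₁ (x 1) * (2 * f₁ (x 1))) / (2 * f (x 1)) ^ 2) (x 1) :=
    d2.div (d1.const_mul 2) (by positivity)
  have hinv : HasDerivAt (fun r : ℝ => r⁻¹) (-(x 1 ^ 2)⁻¹) (x 1) := hasDerivAt_inv hr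
  have hcot : HasDerivAt (fun θ => Real.cos θ / Real.sin θ)
      ((-Real.sin (x 2) * Real.sin (x 2) - Real.cos (x 2) * Real.cos (x 2)) / Real.sin (x 2) ^ 2)
      (x 2) := (Real.hasDerivAt_cos _).div (Real.hasDerivAt_sin _) hs
  have hrf : HasDerivAt (fun r => -(r * f r)) (-(1 * f (x 1) + x 1 * f₁ (x 1))) (x 1) :=
    ((hasDerivAt_id _).mul d1).neg
  have hff : HasDerivAt (fun r => f r * f₁ r / 2)
      ((f₁ (x 1) * f₁ (x 1) + f (x 1) * f₂ (x 1)) / 2) (x 1) := (d1.mul d2).div_const 2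
  have hsin := hasDerivAt_sin_sq (x 2)
  have hsc : HasDerivAt (fun θ => -(Real.sin θ * Real.cos θ))
      (-(Real.cos (x 2) * Real.cos (x 2) + Real.sin (x 2) * -Real.sin (x 2))) (x 2) :=
    ((Real.hasDerivAt_sin _).mul (Real.hasDerivAt_cos _)).neg
  set L01 := (f₂ (x 1) * (2 * f (x 1)) - f₁ (x 1) * (2 * f₁ (x 1))) / (2 * f (x 1)) ^ 2 with hL01
  have hL : ∀ a b, HasPD (sssL f f₁ a b) ((![![0, ![0, L01, 0, 0], 0, 0],
      ![0, ![0, -L01, 0, 0], 0, 0], ![0, ![0, -(x 1 ^ 2)⁻¹, 0, 0], 0, 0],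
      ![0, ![0, -(x 1 ^ 2)⁻¹, 0, 0], ![0, 0, (-Real.sin (x 2) * Real.sin (x 2)
        - Real.cos (x 2) * Real.cos (x 2)) / Real.sin (x 2) ^ 2, 0], 0]] :
        Fin 4 → Fin 4 → Fin 4 → ℝ) a b) x := by
    intro a b
    fin_cases a <;> fin_cases b
    exacts [hasPD_zero, hasPD_coord_one hq, hasPD_zero, hasPD_zero,
      hasPD_zero, hasPD_coord_one hq.neg, hasPD_zero, hasPD_zero,
      hasPD_zero, hasPD_coord_one hinv, hasPD_zero, hasPD_zero,
      hasPD_zero, hasPD_coord_one hinv, hasPD_coord_two hcot, hasPD_zero]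
  have hM : ∀ a b, HasPD (sssM f f₁ a b) ((![0, ![![0, (f₁ (x 1) * f₁ (x 1) + f (x 1) * f₂ (x 1)) / 2,
      0, 0], 0, ![0, -(1 * f (x 1) + x 1 * f₁ (x 1)), 0, 0],
      ![0, -(1 * f (x 1) + x 1 * f₁ (x 1)) * Real.sin (x 2) ^ 2,
        -(x 1 * f (x 1)) * (2 * Real.sin (x 2) * Real.cos (x 2)), 0]],
      ![0, 0, 0, ![0, 0, -(Real.cos (x 2) * Real.cos (x 2) + Real.sin (x 2) * -Real.sin (x 2)), 0]],
      0] : Fin 4 → Fin 4 → Fin 4 → ℝ) a b) x := by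
    intro a b
    fin_cases a <;> fin_cases b
    exacts [hasPD_zero, hasPD_zero, hasPD_zero, hasPD_zero,
      hasPD_coord_one hff, hasPD_zero, hasPD_coord_one hrf, hasPD_coord_one_mul_two hrf hsin,
      hasPD_zero, hasPD_zero, hasPD_zero, hasPD_coord_two hsc,
      hasPD_zero, hasPD_zero, hasPD_zero, hasPD_zero]
  have hΓ : ∀ y ∈ sssDom I, ∀ c a b, christoffel (sss f) c a b y =
      diagChr (fun i j => sssL f f₁ i j y) (fun i j => sssM f f₁ i j y) c a b := fun y hy =>
    christoffel_sss (hI0 hy.1) (hf _ hy.1) hy.2 (h1 _ hy.1)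
  refine riemann_eq_diagCurv (sss_eq_diagonal f x) (isSec_secSSS _ _ _) fun a b hab c d => ?_
  rw [riemannUp_eq_diagChr (isOpen_sssDom hI) hx hΓ hL hM]
  fin_cases a <;> fin_cases b <;> first | exact absurd hab (by decide) | skip
  all_goals
    fin_cases c <;> fin_cases d <;>
      simp [diagChr, Fin.sum_univ_four, sssL, sssM, sssG, diagCurv, sssK, secSSS, hL01] <;>
      field_simp <;> first | (ring; done) | (ring_nf; simp)

end StaticSpherical

/-! ### Divergences of P in the static case -/

section StaticSphericalDivergence

/-- Momentum coefficients of `sss f` when the derivatives of the Lagrangian with respect to the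
sectional curvatures are `secSSS u v w`. -/
def sssPi (f u v w : ℝ → ℝ) (a b : Fin 4) (y : Pt) : ℝ :=
  ![![0, -(u (y 1) / 4), -(v (y 1) / (4 * (f (y 1) * y 1 ^ 2))),
      -(v (y 1) / (4 * (f (y 1) * y 1 ^ 2))) * (Real.sin (y 2) ^ 2)⁻¹],
    ![-(u (y 1) / 4), 0, f (y 1) * v (y 1) / (4 * y 1 ^ 2),
      f (y 1) * v (y 1) / (4 * y 1 ^ 2) * (Real.sin (y 2) ^ 2)⁻¹],
    ![-(v (y 1) / (4 * (f (y 1) * y 1 ^ 2))), f (y 1) * v (y 1) / (4 * y 1 ^ 2), 0,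
      w (y 1) / (4 * y 1 ^ 4) * (Real.sin (y 2) ^ 2)⁻¹],
    ![-(v (y 1) / (4 * (f (y 1) * y 1 ^ 2))) * (Real.sin (y 2) ^ 2)⁻¹,
      f (y 1) * v (y 1) / (4 * y 1 ^ 2) * (Real.sin (y 2) ^ 2)⁻¹,
      w (y 1) / (4 * y 1 ^ 4) * (Real.sin (y 2) ^ 2)⁻¹, 0]] a b

theorem sssPi_symm (f u v w : ℝ → ℝ) (a b : Fin 4) : sssPi f u v w a b = sssPi f u v w b a := by
  fin_cases a <;> fin_cases b <;> rfl

theorem sssPi_eq {f u v w : ℝ → ℝ} {x : Pt} (hr : x 1 ≠ 0) (hf : f (x 1) ≠ 0)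
    (hs : Real.sin (x 2) ≠ 0) (a b : Fin 4) :
    (if a = b then 0 else secSSS (u (x 1)) (v (x 1)) (w (x 1)) a b /
      (4 * sssG f a x * sssG f b x)) = sssPi f u v w a b x := by
  fin_cases a <;> fin_cases b <;> simp [secSSS, sssG, sssPi] <;> field_simp

/-- Coefficients of the divergence of the momentum on `sss f`; here `f₁`, `u₁`, `v₁` are the
derivatives of `f`, `u`, `v`. -/
def sssDiv (f u v w u₁ v₁ : ℝ → ℝ) (a b : Fin 4) (y : Pt) : ℝ :=
  ![![0, 0, 0, 0],
    ![(v (y 1) - u (y 1)) / (2 * y 1) - u₁ (y 1) / 4, 0,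
      f (y 1) * (v (y 1) - w (y 1) + y 1 * v₁ (y 1)) / (4 * y 1 ^ 3),
      f (y 1) * (v (y 1) - w (y 1) + y 1 * v₁ (y 1)) / (4 * y 1 ^ 3) * (Real.sin (y 2) ^ 2)⁻¹],
    ![0, 0, 0, 0], ![0, 0, 0, 0]] a b

theorem hasDerivAt_inv_sin_sq {θ : ℝ} (h : Real.sin θ ≠ 0) :
    HasDerivAt (fun θ => (Real.sin θ ^ 2)⁻¹) (-(2 * Real.cos θ) / Real.sin θ ^ 3) θ := by
  refine ((hasDerivAt_sin_sq θ).fun_inv (pow_ne_zero 2 h)).congr_deriv ?_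
  field_simp

variable {f f₁ f₂ u v w u₁ v₁ w₁ u₂ v₂ : ℝ → ℝ} {I : Set ℝ} {x : Pt} {L : Lagrangian}

set_option maxHeartbeats 1000000 in
-- Only the coefficients whose first index is r survive: the profiles depend on r alone, and the
-- explicit θ-dependence is cancelled by the connection of the sphere.
theorem divMomentum_sss (hI : IsOpen I) (hI0 : I ⊆ Set.Ioi 0) (hf : ∀ r ∈ I, f r ≠ 0)
    (h1 : ∀ r ∈ I, HasDerivAt f (f₁ r) r) (hu : ∀ r ∈ I, HasDerivAt u (u₁ r) r)
    (hv : ∀ r ∈ I, HasDerivAt v (v₁ r) r) (hw : ∀ r ∈ I, HasDerivAt w (w₁ r) r)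
    (hP : ∀ y ∈ sssDom I, ∀ a b c d, momentum L (sss f) a b c d y = sssPi f u v w a b y *
      ((if a = c then if b = d then 1 else 0 else 0)
        - (if a = d then if b = c then 1 else 0 else 0)))
    (hx : x ∈ sssDom I) (a c b : Fin 4) :
    divMomentum L (sss f) a c b x = (if c = b then sssDiv f u v w u₁ v₁ a c x else 0)
      - (if a = b then sssDiv f u v w u₁ v₁ c a x else 0) := by
  have hr : x 1 ≠ 0 := (Set.mem_Ioi.1 (hI0 hx.1)).ne'
  have hf0 := hf _ hx.1
  have hs : Real.sin (x 2) ≠ 0 := hx.2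
  have d1 := h1 _ hx.1
  have hsq : HasDerivAt (fun r : ℝ => r ^ 2) (2 * x 1) (x 1) := by
    simpa using hasDerivAt_pow 2 (x 1)
  have hq : HasDerivAt (fun r : ℝ => r ^ 4) (4 * x 1 ^ 3) (x 1) := by
    simpa using hasDerivAt_pow 4 (x 1)
  have hC := hasDerivAt_inv_sin_sq hs
  set D02 := -(v₁ (x 1) / (4 * f (x 1) * x 1 ^ 2)) + v (x 1) * f₁ (x 1) / (4 * f (x 1) ^ 2 * x 1 ^ 2)
    + v (x 1) / (2 * f (x 1) * x 1 ^ 3) with hD02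
  set D12 := (f₁ (x 1) * v (x 1) + f (x 1) * v₁ (x 1)) / (4 * x 1 ^ 2)
    - f (x 1) * v (x 1) / (2 * x 1 ^ 3) with hD12
  set D23 := w₁ (x 1) / (4 * x 1 ^ 4) - w (x 1) / x 1 ^ 5 with hD23
  set S := (Real.sin (x 2) ^ 2)⁻¹ with hS
  set S' := -(2 * Real.cos (x 2)) / Real.sin (x 2) ^ 3 with hS'
  have e01 : HasDerivAt (fun r => -(u r / 4)) (-(u₁ (x 1) / 4)) (x 1) :=
    ((hu _ hx.1).div_const 4).fun_neg
  have e02 : HasDerivAt (fun r => -(v r / (4 * (f r * r ^ 2)))) D02 (x 1) := by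
    refine (((hv _ hx.1).fun_div ((d1.fun_mul hsq).const_mul 4)
      (by simp [hr, hf0])).fun_neg).congr_deriv ?_
    rw [hD02]; field_simp; ring
  have e12 : HasDerivAt (fun r => f r * v r / (4 * r ^ 2)) D12 (x 1) := by
    refine ((d1.fun_mul (hv _ hx.1)).fun_div (hsq.const_mul 4) (by simp [hr])).congr_deriv ?_
    rw [hD12]; field_simp; ring
  have e23 : HasDerivAt (fun r => w r / (4 * r ^ 4)) D23 (x 1) := by
    refine ((hw _ hx.1).fun_div (hq.const_mul 4) (by simp [hr])).congr_deriv ?_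
    rw [hD23]; field_simp
  have hπ : ∀ a b, HasPD (sssPi f u v w a b) ((![![0, ![0, -(u₁ (x 1) / 4), 0, 0],
      ![0, D02, 0, 0], ![0, D02 * S, -(v (x 1) / (4 * (f (x 1) * x 1 ^ 2))) * S', 0]],
      ![![0, -(u₁ (x 1) / 4), 0, 0], 0, ![0, D12, 0, 0],
        ![0, D12 * S, f (x 1) * v (x 1) / (4 * x 1 ^ 2) * S', 0]],
      ![![0, D02, 0, 0], ![0, D12, 0, 0], 0, ![0, D23 * S, w (x 1) / (4 * x 1 ^ 4) * S', 0]],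
      ![![0, D02 * S, -(v (x 1) / (4 * (f (x 1) * x 1 ^ 2))) * S', 0],
        ![0, D12 * S, f (x 1) * v (x 1) / (4 * x 1 ^ 2) * S', 0],
        ![0, D23 * S, w (x 1) / (4 * x 1 ^ 4) * S', 0], 0]] :
      Fin 4 → Fin 4 → Fin 4 → ℝ) a b) x := by
    intro a b
    fin_cases a <;> fin_cases b
    exacts [hasPD_zero, hasPD_coord_one e01, hasPD_coord_one e02, hasPD_coord_one_mul_two e02 hC,
      hasPD_coord_one e01, hasPD_zero, hasPD_coord_one e12, hasPD_coord_one_mul_two e12 hC,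
      hasPD_coord_one e02, hasPD_coord_one e12, hasPD_zero, hasPD_coord_one_mul_two e23 hC,
      hasPD_coord_one_mul_two e02 hC, hasPD_coord_one_mul_two e12 hC,
      hasPD_coord_one_mul_two e23 hC, hasPD_zero]
  refine divMomentum_diagonal (isOpen_sssDom hI) hx hP hπ (sssPi_symm f u v w)
    (fun a => by fin_cases a <;> rfl)
    (christoffel_sss (hI0 hx.1) hf0 hs d1) (diagChr_symm _ _) (diagChr_of_ne _ _)
    (v := fun a b => sssDiv f u v w u₁ v₁ a b x) ?_ a c b
  intro a c hac
  fin_cases a <;> fin_cases c <;> first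
    | exact absurd rfl hac
    | (simp [sssDiv, diagChr, Fin.sum_univ_four, sssL, sssM, sssPi, hD02, hD12, hD23, hS, hS'] <;>
        field_simp <;> ring)

/-- Mixed components of the second divergence of the momentum on `sss f`. -/
def sssDivDiv (f f₁ u v w u₁ v₁ w₁ u₂ v₂ : ℝ → ℝ) (r : ℝ) : Fin 4 → ℝ :=
  ![-(f r * (2 * u r - 2 * v r + 4 * r * u₁ r - 2 * r * v₁ r + r ^ 2 * u₂ r) / (4 * r ^ 2))
      - f₁ r * (2 * u r - 2 * v r + r * u₁ r) / (8 * r),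
    -(f r * (v r - w r + r * v₁ r) / (2 * r ^ 2)) - f₁ r * (2 * u r - 2 * v r + r * u₁ r) / (8 * r),
    -(f r * (2 * v₁ r - w₁ r + r * v₂ r) / (4 * r)) - f₁ r * (v r - w r + r * v₁ r) / (4 * r),
    -(f r * (2 * v₁ r - w₁ r + r * v₂ r) / (4 * r)) - f₁ r * (v r - w r + r * v₁ r) / (4 * r)]

set_option maxHeartbeats 1000000 in
theorem divDivMomentum_sss (hI : IsOpen I) (hI0 : I ⊆ Set.Ioi 0) (hf : ∀ r ∈ I, f r ≠ 0)
    (h1 : ∀ r ∈ I, HasDerivAt f (f₁ r) r) (hu : ∀ r ∈ I, HasDerivAt u (u₁ r) r)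
    (hv : ∀ r ∈ I, HasDerivAt v (v₁ r) r) (hw : ∀ r ∈ I, HasDerivAt w (w₁ r) r)
    (hu1 : ∀ r ∈ I, HasDerivAt u₁ (u₂ r) r) (hv1 : ∀ r ∈ I, HasDerivAt v₁ (v₂ r) r)
    (hP : ∀ y ∈ sssDom I, ∀ a b c d, momentum L (sss f) a b c d y = sssPi f u v w a b y *
      ((if a = c then if b = d then 1 else 0 else 0)
        - (if a = d then if b = c then 1 else 0 else 0)))
    (hx : x ∈ sssDom I) (a b : Fin 4) :
    divDivMomentum L (sss f) a b x =
      if a = b then (sssG f a x)⁻¹ * sssDivDiv f f₁ u v w u₁ v₁ w₁ u₂ v₂ (x 1) a else 0 := by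
  have hr : x 1 ≠ 0 := (Set.mem_Ioi.1 (hI0 hx.1)).ne'
  have hf0 := hf _ hx.1
  have hs : Real.sin (x 2) ≠ 0 := hx.2
  have d1 := h1 _ hx.1
  have hcube : HasDerivAt (fun r : ℝ => r ^ 3) (3 * x 1 ^ 2) (x 1) := by
    simpa using hasDerivAt_pow 3 (x 1)
  have hC := hasDerivAt_inv_sin_sq hs
  set D10 := (v₁ (x 1) - u₁ (x 1)) / (2 * x 1) - (v (x 1) - u (x 1)) / (2 * x 1 ^ 2) - u₂ (x 1) / 4
    with hD10
  set D12 := f₁ (x 1) * (v (x 1) - w (x 1) + x 1 * v₁ (x 1)) / (4 * x 1 ^ 3)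
    + f (x 1) * (2 * v₁ (x 1) - w₁ (x 1) + x 1 * v₂ (x 1)) / (4 * x 1 ^ 3)
    - 3 * f (x 1) * (v (x 1) - w (x 1) + x 1 * v₁ (x 1)) / (4 * x 1 ^ 4) with hD12
  set S := (Real.sin (x 2) ^ 2)⁻¹ with hS
  set S' := -(2 * Real.cos (x 2)) / Real.sin (x 2) ^ 3 with hS'
  have e10 : HasDerivAt (fun r => (v r - u r) / (2 * r) - u₁ r / 4) D10 (x 1) := by
    refine ((((hv _ hx.1).fun_sub (hu _ hx.1)).fun_div ((hasDerivAt_id (x 1)).const_mul 2)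
      (by simp [hr])).fun_sub ((hu1 _ hx.1).div_const 4)).congr_deriv ?_
    simp only [hD10, id]; field_simp
  have e12 : HasDerivAt (fun r => f r * (v r - w r + r * v₁ r) / (4 * r ^ 3)) D12 (x 1) := by
    refine ((d1.fun_mul (((hv _ hx.1).fun_sub (hw _ hx.1)).fun_add
      ((hasDerivAt_id (x 1)).fun_mul (hv1 _ hx.1)))).fun_div (hcube.const_mul 4)
      (by simp [hr])).congr_deriv ?_
    simp only [hD12, id]; field_simp; ring
  have hV : ∀ a b, HasPD (sssDiv f u v w u₁ v₁ a b) ((![0, ![![0, D10, 0, 0], 0, ![0, D12, 0, 0],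
      ![0, D12 * S, f (x 1) * (v (x 1) - w (x 1) + x 1 * v₁ (x 1)) / (4 * x 1 ^ 3) * S', 0]], 0, 0] :
      Fin 4 → Fin 4 → Fin 4 → ℝ) a b) x := by
    intro a b
    fin_cases a <;> fin_cases b
    exacts [hasPD_zero, hasPD_zero, hasPD_zero, hasPD_zero,
      hasPD_coord_one e10, hasPD_zero, hasPD_coord_one e12, hasPD_coord_one_mul_two e12 hC,
      hasPD_zero, hasPD_zero, hasPD_zero, hasPD_zero,
      hasPD_zero, hasPD_zero, hasPD_zero, hasPD_zero]
  rw [divDivMomentum_diagonal (isOpen_sssDom hI) hx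
    (fun y hy => divMomentum_sss hI hI0 hf h1 hu hv hw hP hy) hV
    (christoffel_sss (hI0 hx.1) hf0 hs d1) (diagChr_symm _ _)]
  fin_cases a <;> fin_cases b <;>
    simp [sssDiv, diagChr, Fin.sum_univ_four, sssL, sssM, sssG, sssDivDiv, hD10, hD12, hS, hS'] <;>
    field_simp <;> ring_nf

end StaticSphericalDivergence

/-! ### Static field equations and their first integral -/

section StaticSphericalEquations

theorem contDiffOn_deriv_of_isOpen {f : ℝ → ℝ} {I : Set ℝ} (hI : IsOpen I)
    (hf : ContDiffOn ℝ ∞ f I) : ContDiffOn ℝ ∞ (deriv f) I :=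
  hf.deriv_of_isOpen hI (by simp)

theorem hasDerivAt_of_contDiffOn {f : ℝ → ℝ} {I : Set ℝ} (hI : IsOpen I)
    (hf : ContDiffOn ℝ ∞ f I) (r : ℝ) (hr : r ∈ I) : HasDerivAt f (deriv f r) r :=
  ((hf.differentiableOn (by simp)).differentiableAt (hI.mem_nhds hr)).hasDerivAt

/-- Mixed diagonal components of the field equations on `sss f`, where the derivatives of the
Lagrangian `l` with respect to the sectional curvatures `K` are `secSSS u v w`. -/
def sssE (f f₁ f₂ l u v w u₁ v₁ w₁ u₂ v₂ : ℝ → ℝ) (r : ℝ) (a : Fin 4) : ℝ :=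
  1 / 2 * ∑ c, secSSS (u r) (v r) (w r) a c * sssK f f₁ f₂ r a c - 1 / 2 * l r
    - 2 * sssDivDiv f f₁ u v w u₁ v₁ w₁ u₂ v₂ r a

/-- The contracted Bianchi identity on `sss f`. -/
theorem hasDerivAt_sssE_one {f f₁ f₂ f₃ l u v w u₁ v₁ w₁ u₂ v₂ : ℝ → ℝ} {r : ℝ} (hr : r ≠ 0)
    (hf : f r ≠ 0) (h1 : HasDerivAt f (f₁ r) r) (h2 : HasDerivAt f₁ (f₂ r) r)
    (h3 : HasDerivAt f₂ (f₃ r) r) (hu : HasDerivAt u (u₁ r) r) (hv : HasDerivAt v (v₁ r) r)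
    (hw : HasDerivAt w (w₁ r) r) (hu1 : HasDerivAt u₁ (u₂ r) r) (hv1 : HasDerivAt v₁ (v₂ r) r)
    (hl : HasDerivAt l (u r * (-f₃ r / 2) + 4 * v r * (-f₂ r / (2 * r) + f₁ r / (2 * r ^ 2))
      + w r * (-f₁ r / r ^ 2 - 2 * (1 - f r) / r ^ 3)) r) :
    HasDerivAt (fun r => sssE f f₁ f₂ l u v w u₁ v₁ w₁ u₂ v₂ r 1)
      (-(f₁ r / (2 * f r)) * (sssE f f₁ f₂ l u v w u₁ v₁ w₁ u₂ v₂ r 1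
          - sssE f f₁ f₂ l u v w u₁ v₁ w₁ u₂ v₂ r 0)
        - 2 / r * (sssE f f₁ f₂ l u v w u₁ v₁ w₁ u₂ v₂ r 1
          - sssE f f₁ f₂ l u v w u₁ v₁ w₁ u₂ v₂ r 2)) r := by
  have hid := hasDerivAt_id r
  have hsq : HasDerivAt (fun r : ℝ => r ^ 2) (2 * r) r := by simpa using hasDerivAt_pow 2 r
  -- The rr component contains no second derivative of `u` or `v`, so one more derivative needs only
  -- the data at hand.
  have he : (fun r => sssE f f₁ f₂ l u v w u₁ v₁ w₁ u₂ v₂ r 1) = fun r =>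
      1 / 2 * (u r * (-f₂ r / 2) + 2 * (v r * (-f₁ r / (2 * r)))) - 1 / 2 * l r
        - 2 * (-(f r * (v r - w r + r * v₁ r) / (2 * r ^ 2))
          - f₁ r * (2 * u r - 2 * v r + r * u₁ r) / (8 * r)) := by
    funext r
    simp [sssE, sssK, secSSS, Fin.sum_univ_four, sssDivDiv]
    ring
  rw [he]
  have t1 := hu.fun_mul (h3.fun_neg.div_const 2)
  have t2 := (hv.fun_mul (h2.fun_neg.fun_div (hid.const_mul 2) (by simp [hr]))).const_mul 2
  have t3 := (h1.fun_mul ((hv.fun_sub hw).fun_add (hid.fun_mul hv1))).fun_div (hsq.const_mul 2)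
    (by simp [hr])
  have t4 := (h2.fun_mul (((hu.const_mul 2).fun_sub (hv.const_mul 2)).fun_add
    (hid.fun_mul hu1))).fun_div (hid.const_mul 8) (by simp [hr])
  refine ((((t1.fun_add t2).const_mul (1 / 2)).fun_sub (hl.const_mul (1 / 2))).fun_sub
    ((t3.fun_neg.fun_sub t4).const_mul 2)).congr_deriv ?_
  simp [sssE, sssK, secSSS, Fin.sum_univ_four, sssDivDiv]
  field_simp
  ring

variable {f : ℝ → ℝ} {I : Set ℝ} {n : ℕ}

section Profiles

variable (f)

/-- The sectional curvature of `sss f` in the `t r` plane. -/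
def sssA (r : ℝ) : ℝ := -deriv (deriv f) r / 2

/-- The sectional curvature of `sss f` in the planes mixing `t, r` and `θ, φ`. -/
def sssB (r : ℝ) : ℝ := -deriv f r / (2 * r)

/-- The sectional curvature of `sss f` in the `θ φ` plane. -/
def sssD (r : ℝ) : ℝ := (1 - f r) / r ^ 2

variable (n)

/-- The derivative of the Lagrangian with respect to `sssA`. -/
def sssU (r : ℝ) : ℝ := uSSS n (sssB f r) (sssD f r)

/-- The derivative of the Lagrangian with respect to one of the four curvatures `sssB`. -/
def sssV (r : ℝ) : ℝ := vSSS n (sssA f r) (sssB f r) (sssD f r)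

/-- The derivative of the Lagrangian with respect to `sssD`. -/
def sssW (r : ℝ) : ℝ := uSSS n (sssB f r) (sssA f r)

/-- The Lagrangian on `sss f`. -/
def sssLag (r : ℝ) : ℝ := redQ n (secSSS (sssA f r) (sssB f r) (sssD f r))

/-- The mixed diagonal components of the field equations of `theoryQ n` on `sss f`. -/
def sssEq (r : ℝ) (a : Fin 4) : ℝ :=
  sssE f (deriv f) (deriv (deriv f)) (sssLag f n) (sssU f n) (sssV f n) (sssW f n)
    (deriv (sssU f n)) (deriv (sssV f n)) (deriv (sssW f n)) (deriv (deriv (sssU f n)))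
    (deriv (deriv (sssV f n))) r a

end Profiles

section Smooth

theorem contDiffOn_sssA (hI : IsOpen I) (hf : ContDiffOn ℝ ∞ f I) : ContDiffOn ℝ ∞ (sssA f) I :=
  (contDiffOn_deriv_of_isOpen hI (contDiffOn_deriv_of_isOpen hI hf)).neg.div_const 2

theorem contDiffOn_sssB (hI : IsOpen I) (hI0 : I ⊆ Set.Ioi 0) (hf : ContDiffOn ℝ ∞ f I) :
    ContDiffOn ℝ ∞ (sssB f) I :=
  (contDiffOn_deriv_of_isOpen hI hf).neg.div (contDiffOn_const.mul contDiffOn_id) fun r hr => by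
    have := (Set.mem_Ioi.1 (hI0 hr)).ne'
    simpa using this

theorem contDiffOn_sssD (hI0 : I ⊆ Set.Ioi 0) (hf : ContDiffOn ℝ ∞ f I) :
    ContDiffOn ℝ ∞ (sssD f) I :=
  (contDiffOn_const.sub hf).div (contDiffOn_id.pow 2) fun r hr => by
    have := (Set.mem_Ioi.1 (hI0 hr)).ne'
    simpa using this

theorem contDiffOn_uSSS {B D : ℝ → ℝ} (hB : ContDiffOn ℝ ∞ B I) (hD : ContDiffOn ℝ ∞ D I) :
    ContDiffOn ℝ ∞ (fun r => uSSS n (B r) (D r)) I :=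
  (((contDiff_pot n 1).comp_contDiffOn hB).div_const 6).add
    (((hD.sub hB).mul ((contDiff_pot n 2).comp_contDiffOn hB)).div_const 6)

theorem contDiffOn_sssU (hI : IsOpen I) (hI0 : I ⊆ Set.Ioi 0) (hf : ContDiffOn ℝ ∞ f I) :
    ContDiffOn ℝ ∞ (sssU f n) I :=
  contDiffOn_uSSS (contDiffOn_sssB hI hI0 hf) (contDiffOn_sssD hI0 hf)

theorem contDiffOn_sssW (hI : IsOpen I) (hI0 : I ⊆ Set.Ioi 0) (hf : ContDiffOn ℝ ∞ f I) :
    ContDiffOn ℝ ∞ (sssW f n) I :=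
  contDiffOn_uSSS (contDiffOn_sssB hI hI0 hf) (contDiffOn_sssA hI hf)

theorem contDiffOn_sssV (hI : IsOpen I) (hI0 : I ⊆ Set.Ioi 0) (hf : ContDiffOn ℝ ∞ f I) :
    ContDiffOn ℝ ∞ (sssV f n) I := by
  have hA := contDiffOn_sssA hI hf
  have hB := contDiffOn_sssB hI hI0 hf
  have hD := contDiffOn_sssD hI0 hf
  exact (((contDiff_pot n 1).comp_contDiffOn hB).div_const 6).add
    ((((hA.sub hB).mul (hD.sub hB)).mul ((contDiff_pot n 3).comp_contDiffOn hB)).div_const 24)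

end Smooth

section Profile

variable {r : ℝ}

/-- All three curvatures come from the single function `f`, and B' and D' are algebraic in A, B, D.
The later identities rest on these relations. -/
theorem hasDerivAt_sssB (hr : r ≠ 0) (h2 : HasDerivAt (deriv f) (deriv (deriv f) r) r) :
    HasDerivAt (sssB f) ((sssA f r - sssB f r) / r) r := by
  refine (h2.fun_neg.fun_div ((hasDerivAt_id r).const_mul 2) (by simp [hr])).congr_deriv ?_
  simp only [sssA, sssB, id]
  field_simp

theorem hasDerivAt_sssD (hr : r ≠ 0) (h1 : HasDerivAt f (deriv f r) r) :
    HasDerivAt (sssD f) (2 * (sssB f r - sssD f r) / r) r := by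
  have hsq : HasDerivAt (fun r : ℝ => r ^ 2) (2 * r) r := by simpa using hasDerivAt_pow 2 r
  refine ((h1.const_sub 1).fun_div hsq (by simp [hr])).congr_deriv ?_
  simp only [sssD, sssB]
  field_simp

theorem hasDerivAt_pot_comp {B : ℝ → ℝ} {B' : ℝ} (hB : HasDerivAt B B' r) (j : ℕ) :
    HasDerivAt (fun r => pot n j (B r)) (pot n (j + 1) (B r) * B') r :=
  (hasDerivAt_pot n j (B r)).comp r hB

/-- This is the special property of the theory on static metrics: u' is algebraic in the curvatures
and is expressed through v itself. It comes from the h'' and h''' terms of L being tied to one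
function h. -/
theorem hasDerivAt_sssU (hr : r ≠ 0) (h1 : HasDerivAt f (deriv f r) r)
    (h2 : HasDerivAt (deriv f) (deriv (deriv f) r) r) :
    HasDerivAt (sssU f n) ((4 * sssV f n r - 2 * sssU f n r - pot n 1 (sssB f r) / 3) / r) r := by
  have hB := hasDerivAt_sssB hr h2
  have hD := hasDerivAt_sssD hr h1
  refine (((hasDerivAt_pot_comp hB 1).div_const 6).fun_add
    (((hD.fun_sub hB).fun_mul (hasDerivAt_pot_comp hB 2)).div_const 6)).congr_deriv ?_
  simp only [sssU, sssV, uSSS, vSSS]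
  field_simp
  ring

theorem hasDerivAt_sssLag (hn : 1 ≤ n) (hr : r ≠ 0) (h1 : HasDerivAt f (deriv f r) r)
    (h2 : HasDerivAt (deriv f) (deriv (deriv f) r) r) {A' : ℝ} (hA : HasDerivAt (sssA f) A' r) :
    HasDerivAt (sssLag f n) (sssU f n r * A' + 4 * sssV f n r * ((sssA f r - sssB f r) / r)
      + sssW f n r * (2 * (sssB f r - sssD f r) / r)) r := by
  have hB := hasDerivAt_sssB hr h2
  have hD := hasDerivAt_sssD hr h1
  have he : sssLag f n = fun r => pot n 0 (sssB f r)
      + (sssA f r + sssD f r - 2 * sssB f r) / 6 * pot n 1 (sssB f r)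
      + (sssA f r - sssB f r) * (sssD f r - sssB f r) / 6 * pot n 2 (sssB f r) :=
    funext fun r => redQ_secSSS_eq_pot hn _ _ _
  rw [he]
  refine (((hasDerivAt_pot_comp hB 0).fun_add
    ((((hA.fun_add hD).fun_sub (hB.const_mul 2)).div_const 6).fun_mul
      (hasDerivAt_pot_comp hB 1))).fun_add
    ((((hA.fun_sub hB).fun_mul (hD.fun_sub hB)).div_const 6).fun_mul
      (hasDerivAt_pot_comp hB 2))).congr_deriv ?_
  simp only [sssU, sssV, sssW, uSSS, vSSS]
  field_simp
  ring

end Profile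

theorem deriv_sssU (hI : IsOpen I) (hI0 : I ⊆ Set.Ioi 0) (hf : ContDiffOn ℝ ∞ f I) {r : ℝ}
    (hr : r ∈ I) :
    deriv (sssU f n) r = (4 * sssV f n r - 2 * sssU f n r - pot n 1 (sssB f r) / 3) / r :=
  (hasDerivAt_sssU (Set.mem_Ioi.1 (hI0 hr)).ne' (hasDerivAt_of_contDiffOn hI hf r hr)
    (hasDerivAt_of_contDiffOn hI (contDiffOn_deriv_of_isOpen hI hf) r hr)).deriv

theorem deriv_deriv_sssU (hI : IsOpen I) (hI0 : I ⊆ Set.Ioi 0) (hf : ContDiffOn ℝ ∞ f I) {r : ℝ}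
    (hr : r ∈ I) :
    deriv (deriv (sssU f n)) r = (4 * deriv (sssV f n) r - 3 * deriv (sssU f n) r
      - pot n 2 (sssB f r) * ((sssA f r - sssB f r) / r) / 3) / r := by
  have hr0 := (Set.mem_Ioi.1 (hI0 hr)).ne'
  have hB := hasDerivAt_sssB hr0
    (hasDerivAt_of_contDiffOn hI (contDiffOn_deriv_of_isOpen hI hf) r hr)
  have hu := hasDerivAt_of_contDiffOn hI (contDiffOn_sssU (n := n) hI hI0 hf) r hr
  have hv := hasDerivAt_of_contDiffOn hI (contDiffOn_sssV (n := n) hI hI0 hf) r hr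
  have h := (((hv.const_mul 4).fun_sub (hu.const_mul 2)).fun_sub
    ((hasDerivAt_pot_comp (n := n) hB 1).div_const 3)).fun_div (hasDerivAt_id r) hr0
  have h' := h.congr_of_eventuallyEq (f₁ := deriv (sssU f n)) (by
    filter_upwards [hI.mem_nhds hr] with s hs using deriv_sssU hI hI0 hf hs)
  rw [h'.deriv, deriv_sssU hI hI0 hf hr]
  simp only [id]
  field_simp
  ring

/-- The difference is f/(2r²) times 2u - 4v + 2w + 4ru' - 4rv' + r²u''. Inserting u' and u'' removes
v' and leaves 2w - h'/3 - (A-B)h''/3, which is zero by the formula for w. -/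
theorem sssEq_zero_eq_one (hI : IsOpen I) (hI0 : I ⊆ Set.Ioi 0) (hf : ContDiffOn ℝ ∞ f I) {r : ℝ}
    (hr : r ∈ I) : sssEq f n r 0 = sssEq f n r 1 := by
  have hr0 := (Set.mem_Ioi.1 (hI0 hr)).ne'
  simp only [sssEq, sssE, sssDivDiv, deriv_deriv_sssU hI hI0 hf hr, deriv_sssU hI hI0 hf hr]
  simp [sssK, secSSS, Fin.sum_univ_four, sssU, sssV, sssW, uSSS, vSSS]
  field_simp
  ring

theorem sssEq_two_eq_three (r : ℝ) : sssEq f n r 2 = sssEq f n r 3 := by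
  simp [sssEq, sssE, sssDivDiv, sssK, secSSS, Fin.sum_univ_four]

/-- The integrated equation of motion: `n` is the curvature order, `f₁` and `f₂` stand for the first
two derivatives of `f`. -/
def sssH (n : ℕ) (r f f₁ f₂ : ℝ) : ℝ :=
  f * r * ((-f₂ / 2 - -f₁ / (2 * r)) * ((1 - f) / r ^ 2 - -f₁ / (2 * r)) *
      pot n 3 (-f₁ / (2 * r)) / 24)
    + r ^ 3 / 12 * (-f₁ / (2 * r)) * ((1 - f) / r ^ 2 - -f₁ / (2 * r)) * pot n 2 (-f₁ / (2 * r))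
    - r ^ 3 / 12 * ((1 - f) / r ^ 2 - 2 * (-f₁ / (2 * r))) * pot n 1 (-f₁ / (2 * r))
    - r ^ 3 / 6 * pot n 0 (-f₁ / (2 * r))

/-- In r²E^r_r third derivatives of `f` occur only through f r v', which is the leading part of the
derivative of f r (v - h'/6). The other terms of `sssH` integrate the remainder. -/
theorem hasDerivAt_sssH (hn : 1 ≤ n) (hI : IsOpen I) (hI0 : I ⊆ Set.Ioi 0)
    (hf : ContDiffOn ℝ ∞ f I) {r : ℝ} (hr : r ∈ I) :
    HasDerivAt (fun r => sssH n r (f r) (deriv f r) (deriv (deriv f) r))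
      (r ^ 2 * sssEq f n r 0) r := by
  have hr0 := (Set.mem_Ioi.1 (hI0 hr)).ne'
  have h1 := hasDerivAt_of_contDiffOn hI hf r hr
  have hB := hasDerivAt_sssB hr0
    (hasDerivAt_of_contDiffOn hI (contDiffOn_deriv_of_isOpen hI hf) r hr)
  have hD := hasDerivAt_sssD hr0 h1
  have hv := hasDerivAt_of_contDiffOn hI (contDiffOn_sssV (n := n) hI hI0 hf) r hr
  have hid := hasDerivAt_id r
  have hcube : HasDerivAt (fun r : ℝ => r ^ 3) (3 * r ^ 2) r := by
    simpa using hasDerivAt_pow 3 r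
  have he : (fun r => sssH n r (f r) (deriv f r) (deriv (deriv f) r)) = fun r =>
      f r * id r * (sssV f n r - pot n 1 (sssB f r) / 6)
        + r ^ 3 / 12 * sssB f r * (sssD f r - sssB f r) * pot n 2 (sssB f r)
        - r ^ 3 / 12 * (sssD f r - 2 * sssB f r) * pot n 1 (sssB f r)
        - r ^ 3 / 6 * pot n 0 (sssB f r) := by
    funext r
    simp only [sssH, sssV, vSSS, sssA, sssB, sssD, id]
    ring
  rw [he]
  have t1 := (h1.fun_mul hid).fun_mul (hv.fun_sub ((hasDerivAt_pot_comp (n := n) hB 1).div_const 6))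
  have t2 := (((hcube.div_const 12).fun_mul hB).fun_mul (hD.fun_sub hB)).fun_mul
    (hasDerivAt_pot_comp (n := n) hB 2)
  have t3 := ((hcube.div_const 12).fun_mul (hD.fun_sub (hB.const_mul 2))).fun_mul
    (hasDerivAt_pot_comp (n := n) hB 1)
  have t4 := (hcube.div_const 6).fun_mul (hasDerivAt_pot_comp (n := n) hB 0)
  refine (((t1.fun_add t2).fun_sub t3).fun_sub t4).congr_deriv ?_
  rw [sssEq_zero_eq_one hI hI0 hf hr]
  have eA : sssK f (deriv f) (deriv (deriv f)) r = secSSS (sssA f r) (sssB f r) (sssD f r) := rfl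
  have e1 : deriv f r = -2 * r * sssB f r := by simp only [sssB]; field_simp
  have e0 : f r = 1 - sssD f r * r ^ 2 := by simp only [sssD]; field_simp; ring
  simp only [sssEq, sssE, sssDivDiv, eA, deriv_sssU hI hI0 hf hr, sssLag, redQ_secSSS_eq_pot hn]
  rw [e1, e0]
  -- With `f` and its derivative written through D and B, the claim is an algebraic identity in r,
  -- A, B, D, V' and the values of `pot`.
  generalize deriv (sssV f n) r = V'
  simp only [sssU, sssV, sssW, uSSS, vSSS]
  generalize sssA f r = A
  generalize sssB f r = B
  generalize sssD f r = D
  simp [secSSS, Fin.sum_univ_four]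
  field_simp
  ring

end StaticSphericalEquations

/-! ### The GQTG property -/

section StaticSphericalTheory

variable {f : ℝ → ℝ} {I : Set ℝ} {n : ℕ} {x : Pt}

theorem riemann_sss_of_contDiffOn (hI : IsOpen I) (hI0 : I ⊆ Set.Ioi 0) (hf : ContDiffOn ℝ ∞ f I)
    (hf0 : ∀ r ∈ I, f r ≠ 0) (hx : x ∈ sssDom I) :
    riemann (sss f) x = diagCurv (fun i => sssG f i x)
      (secSSS (sssA f (x 1)) (sssB f (x 1)) (sssD f (x 1))) :=
  riemann_sss hI hI0 hf0 (hasDerivAt_of_contDiffOn hI hf)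
    (hasDerivAt_of_contDiffOn hI (contDiffOn_deriv_of_isOpen hI hf)) hx

theorem fieldEq_sss (hn : 1 ≤ n) (hI : IsOpen I) (hI0 : I ⊆ Set.Ioi 0) (hf : ContDiffOn ℝ ∞ f I)
    (hf0 : ∀ r ∈ I, f r ≠ 0) (hx : x ∈ sssDom I) (a b : Fin 4) :
    fieldEq (theoryQ n) (sss f) a b x =
      if a = b then (sssG f a x)⁻¹ * sssEq f n (x 1) a else 0 := by
  have hG : ∀ y ∈ sssDom I, ∀ i, sssG f i y ≠ 0 := fun y hy =>
    sssG_ne_zero (hI0 hy.1) (hf0 _ hy.1) hy.2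
  have hu := contDiffOn_sssU (n := n) hI hI0 hf
  have hv := contDiffOn_sssV (n := n) hI hI0 hf
  have hw := contDiffOn_sssW (n := n) hI hI0 hf
  have hP : ∀ y ∈ sssDom I, ∀ a b c d, momentum (theoryQ n) (sss f) a b c d y =
      sssPi f (sssU f n) (sssV f n) (sssW f n) a b y *
        ((if a = c then if b = d then 1 else 0 else 0)
          - (if a = d then if b = c then 1 else 0 else 0)) := by
    intro y hy a b c d
    rw [momentum_diagCurv n (hG y hy) (sss_eq_diagonal f y)
      (riemann_sss_of_contDiffOn hI hI0 hf hf0 hy) (isSec_secSSS _ _ _),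
      ← sssPi_eq (Set.mem_Ioi.1 (hI0 hy.1)).ne' (hf0 _ hy.1) hy.2]
    congr 1
    split_ifs with hab
    · rfl
    · rw [secP_secSSS hn _ _ _ hab]; rfl
  rw [fieldEq_diagonal (sss_eq_diagonal f x) (hG x hx) (isSec_secSSS _ _ _)
    (riemann_sss_of_contDiffOn hI hI0 hf hf0 hx),
    divDivMomentum_sss hI hI0 hf0 (hasDerivAt_of_contDiffOn hI hf) (hasDerivAt_of_contDiffOn hI hu)
      (hasDerivAt_of_contDiffOn hI hv) (hasDerivAt_of_contDiffOn hI hw)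
      (hasDerivAt_of_contDiffOn hI (contDiffOn_deriv_of_isOpen hI hu))
      (hasDerivAt_of_contDiffOn hI (contDiffOn_deriv_of_isOpen hI hv)) hP hx]
  have hS : ∀ c, secP n (secSSS (sssA f (x 1)) (sssB f (x 1)) (sssD f (x 1))) a c *
      secSSS (sssA f (x 1)) (sssB f (x 1)) (sssD f (x 1)) a c =
      secSSS (sssU f n (x 1)) (sssV f n (x 1)) (sssW f n (x 1)) a c *
        secSSS (sssA f (x 1)) (sssB f (x 1)) (sssD f (x 1)) a c := by
    intro c
    by_cases hac : a = c
    · subst hac; simp [(isSec_secSSS _ _ _).diag]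
    · rw [secP_secSSS hn _ _ _ hac]; rfl
  simp only [hS]
  split_ifs
  · simp only [sssEq, sssE, sssLag]
    rw [show sssK f (deriv f) (deriv (deriv f)) (x 1) =
      secSSS (sssA f (x 1)) (sssB f (x 1)) (sssD f (x 1)) from rfl]
    ring
  · ring

theorem fieldEqMixed_sss (hn : 1 ≤ n) (hI : IsOpen I) (hI0 : I ⊆ Set.Ioi 0)
    (hf : ContDiffOn ℝ ∞ f I) (hf0 : ∀ r ∈ I, f r ≠ 0) (hx : x ∈ sssDom I) (a : Fin 4) :
    fieldEqMixed (theoryQ n) (sss f) a a x = sssEq f n (x 1) a := by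
  have hG := sssG_ne_zero (hI0 hx.1) (hf0 _ hx.1) hx.2 a
  simp only [fieldEqMixed, fieldEq_sss hn hI hI0 hf hf0 hx, ite_mul, zero_mul, Finset.sum_ite_eq,
    Finset.mem_univ, if_true, sss_eq_diagonal, diagonal_apply_eq]
  field_simp

/-- The contracted Bianchi identity applies because the chain rule gives L' = uA' + 4vB' + wD' along
`f`. -/
theorem hasDerivAt_sssEq_one (hn : 1 ≤ n) (hI : IsOpen I) (hI0 : I ⊆ Set.Ioi 0)
    (hf : ContDiffOn ℝ ∞ f I) (hf0 : ∀ r ∈ I, f r ≠ 0) {r : ℝ} (hr : r ∈ I) :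
    HasDerivAt (fun r => sssEq f n r 1)
      (-(deriv f r / (2 * f r)) * (sssEq f n r 1 - sssEq f n r 0)
        - 2 / r * (sssEq f n r 1 - sssEq f n r 2)) r := by
  have hr0 := (Set.mem_Ioi.1 (hI0 hr)).ne'
  have hf1 := contDiffOn_deriv_of_isOpen hI hf
  have hf2 := contDiffOn_deriv_of_isOpen hI hf1
  have hu := contDiffOn_sssU (n := n) hI hI0 hf
  have hv := contDiffOn_sssV (n := n) hI hI0 hf
  have h1 := hasDerivAt_of_contDiffOn hI hf r hr
  have h2 := hasDerivAt_of_contDiffOn hI hf1 r hr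
  have h3 := hasDerivAt_of_contDiffOn hI hf2 r hr
  have hA : HasDerivAt (sssA f) (-deriv (deriv (deriv f)) r / 2) r := h3.fun_neg.div_const 2
  refine hasDerivAt_sssE_one hr0 (hf0 r hr) h1 h2 h3 (hasDerivAt_of_contDiffOn hI hu r hr)
    (hasDerivAt_of_contDiffOn hI hv r hr)
    (hasDerivAt_of_contDiffOn hI (contDiffOn_sssW hI hI0 hf) r hr)
    (hasDerivAt_of_contDiffOn hI (contDiffOn_deriv_of_isOpen hI hu) r hr)
    (hasDerivAt_of_contDiffOn hI (contDiffOn_deriv_of_isOpen hI hv) r hr)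
    ((hasDerivAt_sssLag hn hr0 h1 h2 hA).congr_deriv ?_)
  simp only [sssA, sssB, sssD]
  field_simp
  ring

theorem isGQTG_theoryQ (hn : 1 ≤ n) : IsGQTG (theoryQ n) := by
  refine ⟨sssH n, fun f I hI hIc hI0 hf hf0 => ⟨fun x hx hs => ?_, ?_⟩⟩
  · have hx' : x ∈ sssDom I := ⟨hx, hs⟩
    rw [fieldEqMixed_sss hn hI hI0 hf hf0 hx', fieldEqMixed_sss hn hI hI0 hf hf0 hx']
    exact ⟨sssEq_zero_eq_one hI hI0 hf hx, hasDerivAt_sssH hn hI hI0 hf hx⟩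
  · constructor
    · intro h
      have h0 : ∀ r ∈ I, sssEq f n r 0 = 0 := by
        intro r hr
        -- An equatorial point at radius r, where the sine is 1.
        have hx : (![0, r, Real.pi / 2, 0] : Pt) ∈ sssDom I := ⟨hr, by simp⟩
        have h1 := h _ hx.1 hx.2 0 0
        rw [fieldEq_sss hn hI hI0 hf hf0 hx, if_pos rfl] at h1
        exact (mul_eq_zero.1 h1).resolve_left
          (inv_ne_zero (sssG_ne_zero (hI0 hx.1) (hf0 _ hx.1) hx.2 0))
      have hH := fun r hr => hasDerivAt_sssH hn hI hI0 hf (r := r) hr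
      rcases I.eq_empty_or_nonempty with rfl | ⟨r₀, hr₀⟩
      · exact ⟨0, fun r hr => absurd hr (Set.notMem_empty r)⟩
      · refine ⟨_, fun r hr => hI.is_const_of_deriv_eq_zero hIc
          (fun r hr => (hH r hr).differentiableAt.differentiableWithinAt) (fun r hr => ?_) hr hr₀⟩
        rw [(hH r hr).deriv, h0 r hr, mul_zero, Pi.zero_apply]
    · rintro ⟨C, hC⟩
      have h0 : ∀ r ∈ I, sssEq f n r 0 = 0 := by
        intro r hr
        have h1 := (hasDerivAt_sssH hn hI hI0 hf hr).unique
          ((hasDerivAt_const r C).congr_of_eventuallyEq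
            (by filter_upwards [hI.mem_nhds hr] with s hs using hC s hs))
        exact (mul_eq_zero.1 h1).resolve_left (pow_ne_zero 2 (Set.mem_Ioi.1 (hI0 hr)).ne')
      have h1 : ∀ r ∈ I, sssEq f n r 1 = 0 := fun r hr => by
        rw [← sssEq_zero_eq_one hI hI0 hf hr, h0 r hr]
      have h2 : ∀ r ∈ I, sssEq f n r 2 = 0 := by
        intro r hr
        have hr0 := (Set.mem_Ioi.1 (hI0 hr)).ne'
        -- Both E^t_t and E^r_r vanish on all of `I`, so the Bianchi identity reduces to (2/r) E^θ_θ
        -- = 0.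
        have h3 := (hasDerivAt_sssEq_one hn hI hI0 hf hf0 hr).unique
          ((hasDerivAt_const r (0 : ℝ)).congr_of_eventuallyEq
            (by filter_upwards [hI.mem_nhds hr] with s hs using h1 s hs))
        rw [h0 r hr, h1 r hr] at h3
        have h4 : 2 / r * sssEq f n r 2 = 0 := by linarith
        exact (mul_eq_zero.1 h4).resolve_left (div_ne_zero two_ne_zero hr0)
      intro x hx hs i j
      rw [fieldEq_sss hn hI hI0 hf hf0 ⟨hx, hs⟩]
      have h3 : sssEq f n (x 1) i = 0 := by
        fin_cases i
        exacts [h0 _ hx, h1 _ hx, h2 _ hx, (sssEq_two_eq_three _).symm.trans (h2 _ hx)]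
      rw [h3, mul_zero, ite_self]

end StaticSphericalTheory

/-! ### Curvature of FLRW metrics -/

section FLRW

variable {x : Pt}

theorem hasPD_coord_zero {A : ℝ → ℝ} {A' : ℝ} (hA : HasDerivAt A A' (x 0)) :
    HasPD (fun y => A (y 0)) ![A', 0, 0, 0] x := by
  have h := hasPD_separable (x := x) hA (hasDerivAt_const (x 1) (1 : ℝ))
    (hasDerivAt_const (x 2) (1 : ℝ))
  simpa using h

theorem hasPD_coord_zero_mul_one {A B : ℝ → ℝ} {A' B' : ℝ} (hA : HasDerivAt A A' (x 0))
    (hB : HasDerivAt B B' (x 1)) :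
    HasPD (fun y => A (y 0) * B (y 1)) ![A' * B (x 1), A (x 0) * B', 0, 0] x := by
  have h := hasPD_separable (x := x) hA hB (hasDerivAt_const (x 2) (1 : ℝ))
  simpa using h

/-- Diagonal entries of `flrw k a F`. -/
def flrwG (k : ℝ) (a F : ℝ → ℝ) (i : Fin 4) (y : Pt) : ℝ :=
  ![-F (y 0), a (y 0) ^ 2 / (1 - k * y 1 ^ 2), a (y 0) ^ 2 * y 1 ^ 2,
    a (y 0) ^ 2 * y 1 ^ 2 * Real.sin (y 2) ^ 2] i

/-- The coefficients `Γ^a_{ab}` of `flrw k a F`, where `a₁`, `F₁` are the derivatives of `a`, `F`. -/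
def flrwL (k : ℝ) (a F a₁ F₁ : ℝ → ℝ) (i j : Fin 4) (y : Pt) : ℝ :=
  ![![F₁ (y 0) / (2 * F (y 0)), 0, 0, 0],
    ![a₁ (y 0) / a (y 0), k * y 1 / (1 - k * y 1 ^ 2), 0, 0],
    ![a₁ (y 0) / a (y 0), (y 1)⁻¹, 0, 0],
    ![a₁ (y 0) / a (y 0), (y 1)⁻¹, Real.cos (y 2) / Real.sin (y 2), 0]] i j

/-- The coefficients `Γ^c_{aa}` of `flrw k a F`, where `a₁` is the derivative of `a`. -/
def flrwM (k : ℝ) (a F a₁ : ℝ → ℝ) (i j : Fin 4) (y : Pt) : ℝ :=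
  ![![0, a (y 0) * a₁ (y 0) / F (y 0) * (1 - k * y 1 ^ 2)⁻¹,
      a (y 0) * a₁ (y 0) / F (y 0) * y 1 ^ 2,
      a (y 0) * a₁ (y 0) / F (y 0) * y 1 ^ 2 * Real.sin (y 2) ^ 2],
    ![0, 0, -(y 1 * (1 - k * y 1 ^ 2)), -(y 1 * (1 - k * y 1 ^ 2)) * Real.sin (y 2) ^ 2],
    ![0, 0, 0, -(Real.sin (y 2) * Real.cos (y 2))], ![0, 0, 0, 0]] i j

/-- The part of the chart over `J` in which `flrw k a F` is regular. -/
def flrwDom (k : ℝ) (J : Set ℝ) : Set Pt :=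
  {y | y 0 ∈ J ∧ 0 < y 1 ∧ 0 < 1 - k * y 1 ^ 2 ∧ Real.sin (y 2) ≠ 0}

theorem isOpen_flrwDom (k : ℝ) {J : Set ℝ} (hJ : IsOpen J) : IsOpen (flrwDom k J) := by
  have h1 : IsOpen {y : Pt | 0 < y 1} := isOpen_lt continuous_const (by fun_prop)
  have h2 : IsOpen {y : Pt | 0 < 1 - k * y 1 ^ 2} := isOpen_lt continuous_const (by fun_prop)
  have h3 : IsOpen {y : Pt | Real.sin (y 2) ≠ 0} := isOpen_ne_fun (by fun_prop) continuous_const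
  exact (hJ.preimage (continuous_apply 0)).inter (h1.inter (h2.inter h3))

theorem flrw_eq_diagonal (k : ℝ) (a F : ℝ → ℝ) (y : Pt) :
    flrw k a F y = diagonal fun i => flrwG k a F i y := rfl

theorem hasDerivAt_inv_one_sub_mul_sq {k r : ℝ} (h : 1 - k * r ^ 2 ≠ 0) :
    HasDerivAt (fun r => (1 - k * r ^ 2)⁻¹) (2 * k * r / (1 - k * r ^ 2) ^ 2) r := by
  have hsq : HasDerivAt (fun r : ℝ => r ^ 2) (2 * r) r := by simpa using hasDerivAt_pow 2 r
  refine (((hsq.const_mul k).const_sub 1).fun_inv h).congr_deriv ?_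
  ring

variable {k : ℝ} {a F a₁ F₁ a₂ : ℝ → ℝ}

theorem flrwG_ne_zero (ha : a (x 0) ≠ 0) (hF : F (x 0) ≠ 0) (hr : x 1 ≠ 0)
    (hk : 1 - k * x 1 ^ 2 ≠ 0) (hs : Real.sin (x 2) ≠ 0) (i : Fin 4) : flrwG k a F i x ≠ 0 := by
  fin_cases i <;> simp [flrwG, *]

theorem christoffel_flrw (ha : a (x 0) ≠ 0) (hF : F (x 0) ≠ 0) (hr : x 1 ≠ 0)
    (hk : 1 - k * x 1 ^ 2 ≠ 0) (hs : Real.sin (x 2) ≠ 0) (ha1 : HasDerivAt a (a₁ (x 0)) (x 0))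
    (hF1 : HasDerivAt F (F₁ (x 0)) (x 0)) (c i j : Fin 4) :
    christoffel (flrw k a F) c i j x =
      diagChr (fun i j => flrwL k a F a₁ F₁ i j x) (fun i j => flrwM k a F a₁ i j x) c i j := by
  have hsq : HasDerivAt (fun r : ℝ => r ^ 2) (2 * x 1) (x 1) := by
    simpa using hasDerivAt_pow 2 (x 1)
  have hasq : HasDerivAt (fun t : ℝ => a t ^ 2) (2 * a (x 0) * a₁ (x 0)) (x 0) := by
    simpa using ha1.fun_pow 2
  have hd : ∀ i, HasPD (flrwG k a F i) (![![-F₁ (x 0), 0, 0, 0],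
      ![2 * a (x 0) * a₁ (x 0) * (1 - k * x 1 ^ 2)⁻¹,
        a (x 0) ^ 2 * (2 * k * x 1 / (1 - k * x 1 ^ 2) ^ 2), 0, 0],
      ![2 * a (x 0) * a₁ (x 0) * x 1 ^ 2, a (x 0) ^ 2 * (2 * x 1), 0, 0],
      ![2 * a (x 0) * a₁ (x 0) * x 1 ^ 2 * Real.sin (x 2) ^ 2,
        a (x 0) ^ 2 * (2 * x 1) * Real.sin (x 2) ^ 2,
        a (x 0) ^ 2 * x 1 ^ 2 * (2 * Real.sin (x 2) * Real.cos (x 2)), 0]] i) x := by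
    intro i
    fin_cases i
    · exact hasPD_coord_zero (A := fun t => -F t) hF1.fun_neg
    · exact hasPD_coord_zero_mul_one hasq (hasDerivAt_inv_one_sub_mul_sq hk)
    · exact hasPD_coord_zero_mul_one hasq hsq
    · exact hasPD_separable hasq hsq (hasDerivAt_sin_sq (x 2))
  have hk' : 1 - x 1 ^ 2 * k ≠ 0 := by rwa [mul_comm]
  refine christoffel_eq_diagChr (flrw_eq_diagonal k a F) (flrwG_ne_zero ha hF hr hk hs) hd ?_ ?_
    c i j
  · intro i j
    fin_cases i <;> fin_cases j <;> simp [flrwG, flrwL] <;> field_simp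
  · intro c i hci
    fin_cases c <;> fin_cases i <;> first
      | exact absurd rfl hci
      | (simp [flrwG, flrwM] <;> field_simp)

/-- Sectional curvature of `flrw k a F` in planes containing the time direction. -/
def flrwα (a F a₁ F₁ a₂ : ℝ) : ℝ := (a₂ / F - a₁ * F₁ / (2 * F ^ 2)) / a

/-- Sectional curvature of `flrw k a F` in spatial planes. -/
def flrwβ (k a F a₁ : ℝ) : ℝ := (a₁ ^ 2 / F + k) / a ^ 2

set_option maxHeartbeats 2000000 in
-- The second derivative of F enters through the derivative of Γ^t_{tt} and drops out of the
-- curvature; `hF2` only ensures that this coefficient is differentiable.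
theorem riemann_flrw {J : Set ℝ} (hJ : IsOpen J) (ha : ∀ t ∈ J, 0 < a t) (hF : ∀ t ∈ J, 0 < F t)
    (ha1 : ∀ t ∈ J, HasDerivAt a (a₁ t) t) (ha2 : ∀ t ∈ J, HasDerivAt a₁ (a₂ t) t)
    (hF1 : ∀ t ∈ J, HasDerivAt F (F₁ t) t) {F2 : ℝ} (hF2 : HasDerivAt F₁ F2 (x 0))
    (hx : x ∈ flrwDom k J) :
    riemann (flrw k a F) x = diagCurv (fun i => flrwG k a F i x)
      (secFLRW (flrwα (a (x 0)) (F (x 0)) (a₁ (x 0)) (F₁ (x 0)) (a₂ (x 0)))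
        (flrwβ k (a (x 0)) (F (x 0)) (a₁ (x 0)))) := by
  obtain ⟨hJx, hr', hk', hs⟩ := id hx
  have hr := hr'.ne'
  have hk := hk'.ne'
  have hk'' : 1 - x 1 ^ 2 * k ≠ 0 := by rwa [mul_comm]
  have ha0 := (ha _ hJx).ne'
  have hF0 := (hF _ hJx).ne'
  have d1 := ha1 _ hJx
  have d2 := ha2 _ hJx
  have e1 := hF1 _ hJx
  have hsq : HasDerivAt (fun r : ℝ => r ^ 2) (2 * x 1) (x 1) := by
    simpa using hasDerivAt_pow 2 (x 1)
  have hsin := hasDerivAt_sin_sq (x 2)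
  have hE := hasDerivAt_inv_one_sub_mul_sq hk
  set E := 2 * k * x 1 / (1 - k * x 1 ^ 2) ^ 2 with hEdef
  set L00 := F2 / (2 * F (x 0)) - F₁ (x 0) ^ 2 / (2 * F (x 0) ^ 2) with hL00
  have h00 : HasDerivAt (fun t => F₁ t / (2 * F t)) L00 (x 0) := by
    refine (hF2.fun_div (e1.const_mul 2) (by simp [hF0])).congr_deriv ?_
    rw [hL00]; field_simp
  set L10 := a₂ (x 0) / a (x 0) - a₁ (x 0) ^ 2 / a (x 0) ^ 2 with hL10
  have h10 : HasDerivAt (fun t => a₁ t / a t) L10 (x 0) := by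
    refine (d2.fun_div d1 ha0).congr_deriv ?_
    rw [hL10]; field_simp
  set L11 := k / (1 - k * x 1 ^ 2) + 2 * k ^ 2 * x 1 ^ 2 / (1 - k * x 1 ^ 2) ^ 2 with hL11
  have h11 : HasDerivAt (fun r => k * r / (1 - k * r ^ 2)) L11 (x 1) := by
    refine (((hasDerivAt_id (x 1)).const_mul k).fun_div ((hsq.const_mul k).const_sub 1)
      hk).congr_deriv ?_
    simp only [hL11, id]; field_simp; ring
  have hinv : HasDerivAt (fun r : ℝ => r⁻¹) (-(x 1 ^ 2)⁻¹) (x 1) := hasDerivAt_inv hr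
  have hcot : HasDerivAt (fun θ => Real.cos θ / Real.sin θ)
      ((-Real.sin (x 2) * Real.sin (x 2) - Real.cos (x 2) * Real.cos (x 2)) / Real.sin (x 2) ^ 2)
      (x 2) := (Real.hasDerivAt_cos _).div (Real.hasDerivAt_sin _) hs
  set C := (-Real.sin (x 2) * Real.sin (x 2) - Real.cos (x 2) * Real.cos (x 2)) /
    Real.sin (x 2) ^ 2 with hC
  set M0 := (a₁ (x 0) ^ 2 + a (x 0) * a₂ (x 0)) / F (x 0)
    - a (x 0) * a₁ (x 0) * F₁ (x 0) / F (x 0) ^ 2 with hM0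
  have m0 : HasDerivAt (fun t => a t * a₁ t / F t) M0 (x 0) := by
    refine ((d1.fun_mul d2).fun_div e1 hF0).congr_deriv ?_
    rw [hM0]; field_simp
  set M12 := -1 + 3 * k * x 1 ^ 2 with hM12
  have m12 : HasDerivAt (fun r => -(r * (1 - k * r ^ 2))) M12 (x 1) := by
    refine ((hasDerivAt_id (x 1)).fun_mul ((hsq.const_mul k).const_sub 1)).fun_neg.congr_deriv ?_
    simp only [hM12, id]; ring
  have hsc : HasDerivAt (fun θ => -(Real.sin θ * Real.cos θ))
      (-(Real.cos (x 2) * Real.cos (x 2) + Real.sin (x 2) * -Real.sin (x 2))) (x 2) :=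
    ((Real.hasDerivAt_sin _).mul (Real.hasDerivAt_cos _)).neg
  have hL : ∀ i j, HasPD (flrwL k a F a₁ F₁ i j) ((![![![L00, 0, 0, 0], 0, 0, 0],
      ![![L10, 0, 0, 0], ![0, L11, 0, 0], 0, 0],
      ![![L10, 0, 0, 0], ![0, -(x 1 ^ 2)⁻¹, 0, 0], 0, 0],
      ![![L10, 0, 0, 0], ![0, -(x 1 ^ 2)⁻¹, 0, 0], ![0, 0, C, 0], 0]] :
        Fin 4 → Fin 4 → Fin 4 → ℝ) i j) x := by
    intro i j
    fin_cases i <;> fin_cases j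
    exacts [hasPD_coord_zero h00, hasPD_zero, hasPD_zero, hasPD_zero,
      hasPD_coord_zero h10, hasPD_coord_one h11, hasPD_zero, hasPD_zero,
      hasPD_coord_zero h10, hasPD_coord_one hinv, hasPD_zero, hasPD_zero,
      hasPD_coord_zero h10, hasPD_coord_one hinv, hasPD_coord_two hcot, hasPD_zero]
  have hM : ∀ i j, HasPD (flrwM k a F a₁ i j) ((![![0,
        ![M0 * (1 - k * x 1 ^ 2)⁻¹, a (x 0) * a₁ (x 0) / F (x 0) * E, 0, 0],
        ![M0 * x 1 ^ 2, a (x 0) * a₁ (x 0) / F (x 0) * (2 * x 1), 0, 0],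
        ![M0 * x 1 ^ 2 * Real.sin (x 2) ^ 2,
          a (x 0) * a₁ (x 0) / F (x 0) * (2 * x 1) * Real.sin (x 2) ^ 2,
          a (x 0) * a₁ (x 0) / F (x 0) * x 1 ^ 2 * (2 * Real.sin (x 2) * Real.cos (x 2)), 0]],
      ![0, 0, ![0, M12, 0, 0], ![0, M12 * Real.sin (x 2) ^ 2,
        -(x 1 * (1 - k * x 1 ^ 2)) * (2 * Real.sin (x 2) * Real.cos (x 2)), 0]],
      ![0, 0, 0, ![0, 0, -(Real.cos (x 2) * Real.cos (x 2) + Real.sin (x 2) * -Real.sin (x 2)), 0]],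
      0] : Fin 4 → Fin 4 → Fin 4 → ℝ) i j) x := by
    intro i j
    fin_cases i <;> fin_cases j
    exacts [hasPD_zero, hasPD_coord_zero_mul_one m0 hE, hasPD_coord_zero_mul_one m0 hsq,
      hasPD_separable m0 hsq hsin,
      hasPD_zero, hasPD_zero, hasPD_coord_one m12, hasPD_coord_one_mul_two m12 hsin,
      hasPD_zero, hasPD_zero, hasPD_zero, hasPD_coord_two hsc,
      hasPD_zero, hasPD_zero, hasPD_zero, hasPD_zero]
  have hΓ : ∀ y ∈ flrwDom k J, ∀ c i j, christoffel (flrw k a F) c i j y =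
      diagChr (fun i j => flrwL k a F a₁ F₁ i j y) (fun i j => flrwM k a F a₁ i j y) c i j :=
    fun y hy => christoffel_flrw (ha _ hy.1).ne' (hF _ hy.1).ne' hy.2.1.ne' hy.2.2.1.ne' hy.2.2.2
      (ha1 _ hy.1) (hF1 _ hy.1)
  refine riemann_eq_diagCurv (flrw_eq_diagonal k a F x) (isSec_secFLRW _ _) fun b c hbc d e => ?_
  rw [riemannUp_eq_diagChr (isOpen_flrwDom k hJ) hx hΓ hL hM]
  fin_cases b <;> fin_cases c <;> first | exact absurd hbc (by decide) | skip
  all_goals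
    fin_cases d <;> fin_cases e <;>
      simp [diagChr, Fin.sum_univ_four, flrwL, flrwM, flrwG, diagCurv, secFLRW, flrwα, flrwβ, hL00,
        hL10, hL11, hC, hM0, hM12, hEdef] <;>
      field_simp <;> first | (ring; done) | (ring_nf; simp)

end FLRW

/-! ### Vanishing divergence of P on FLRW metrics -/

section FLRWEquations

variable {k : ℝ} {a F a₁ F₁ : ℝ → ℝ} {J : Set ℝ} {x : Pt} {L : Lagrangian} {n : ℕ}

/-- Momentum coefficients of `flrw k a F` when the derivatives of the Lagrangian with respect to the
sectional curvatures are `secFLRW p q`. -/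
def flrwPi (k : ℝ) (a F p q : ℝ → ℝ) (i j : Fin 4) (y : Pt) : ℝ :=
  ![![0, -(p (y 0) / (4 * (F (y 0) * a (y 0) ^ 2))) * (1 - k * y 1 ^ 2),
      -(p (y 0) / (4 * (F (y 0) * a (y 0) ^ 2))) * (y 1 ^ 2)⁻¹,
      -(p (y 0) / (4 * (F (y 0) * a (y 0) ^ 2))) * (y 1 ^ 2)⁻¹ * (Real.sin (y 2) ^ 2)⁻¹],
    ![-(p (y 0) / (4 * (F (y 0) * a (y 0) ^ 2))) * (1 - k * y 1 ^ 2), 0,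
      q (y 0) / (4 * a (y 0) ^ 4) * ((y 1 ^ 2)⁻¹ - k),
      q (y 0) / (4 * a (y 0) ^ 4) * ((y 1 ^ 2)⁻¹ - k) * (Real.sin (y 2) ^ 2)⁻¹],
    ![-(p (y 0) / (4 * (F (y 0) * a (y 0) ^ 2))) * (y 1 ^ 2)⁻¹,
      q (y 0) / (4 * a (y 0) ^ 4) * ((y 1 ^ 2)⁻¹ - k), 0,
      q (y 0) / (4 * a (y 0) ^ 4) * (y 1 ^ 4)⁻¹ * (Real.sin (y 2) ^ 2)⁻¹],
    ![-(p (y 0) / (4 * (F (y 0) * a (y 0) ^ 2))) * (y 1 ^ 2)⁻¹ * (Real.sin (y 2) ^ 2)⁻¹,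
      q (y 0) / (4 * a (y 0) ^ 4) * ((y 1 ^ 2)⁻¹ - k) * (Real.sin (y 2) ^ 2)⁻¹,
      q (y 0) / (4 * a (y 0) ^ 4) * (y 1 ^ 4)⁻¹ * (Real.sin (y 2) ^ 2)⁻¹, 0]] i j

theorem flrwPi_symm (k : ℝ) (a F p q : ℝ → ℝ) (i j : Fin 4) :
    flrwPi k a F p q i j = flrwPi k a F p q j i := by
  fin_cases i <;> fin_cases j <;> rfl

theorem flrwPi_eq {p q : ℝ → ℝ} (ha : a (x 0) ≠ 0) (hF : F (x 0) ≠ 0) (hr : x 1 ≠ 0)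
    (hk : 1 - k * x 1 ^ 2 ≠ 0) (hs : Real.sin (x 2) ≠ 0) (i j : Fin 4) :
    (if i = j then 0 else secFLRW (p (x 0)) (q (x 0)) i j /
      (4 * flrwG k a F i x * flrwG k a F j x)) = flrwPi k a F p q i j x := by
  have hk' : 1 - x 1 ^ 2 * k ≠ 0 := by rwa [mul_comm]
  fin_cases i <;> fin_cases j <;> simp [secFLRW, flrwG, flrwPi] <;> field_simp

set_option maxHeartbeats 1000000 in
/-- The momentum is divergence free on `flrw k a F` if its coefficients are balanced. -/
theorem divMomentum_flrw (hJ : IsOpen J) (ha : ∀ t ∈ J, 0 < a t) (hF : ∀ t ∈ J, 0 < F t)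
    (ha1 : ∀ t ∈ J, HasDerivAt a (a₁ t) t) (hF1 : ∀ t ∈ J, HasDerivAt F (F₁ t) t)
    {p q q₁ : ℝ → ℝ} (hp : ∀ t ∈ J, HasDerivAt p (2 * (a₁ t / a t) * (q t - p t)) t)
    (hq : ∀ t ∈ J, HasDerivAt q (q₁ t) t)
    (hP : ∀ y ∈ flrwDom k J, ∀ b c d e, momentum L (flrw k a F) b c d e y =
      flrwPi k a F p q b c y * ((if b = d then if c = e then 1 else 0 else 0)
        - (if b = e then if c = d then 1 else 0 else 0)))
    (hx : x ∈ flrwDom k J) (b d c : Fin 4) : divMomentum L (flrw k a F) b d c x = 0 := by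
  obtain ⟨hJx, hr', hk', hs⟩ := id hx
  have hr := hr'.ne'
  have hk := hk'.ne'
  have hk'' : 1 - x 1 ^ 2 * k ≠ 0 := by rwa [mul_comm]
  have ha0 := (ha _ hJx).ne'
  have hF0 := (hF _ hJx).ne'
  have d1 := ha1 _ hJx
  have e1 := hF1 _ hJx
  have hsq : HasDerivAt (fun r : ℝ => r ^ 2) (2 * x 1) (x 1) := by
    simpa using hasDerivAt_pow 2 (x 1)
  have hq4 : HasDerivAt (fun r : ℝ => r ^ 4) (4 * x 1 ^ 3) (x 1) := by
    simpa using hasDerivAt_pow 4 (x 1)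
  have hasq : HasDerivAt (fun t : ℝ => a t ^ 2) (2 * a (x 0) * a₁ (x 0)) (x 0) := by
    simpa using d1.fun_pow 2
  have haq : HasDerivAt (fun t : ℝ => a t ^ 4) (4 * a (x 0) ^ 3 * a₁ (x 0)) (x 0) := by
    simpa using d1.fun_pow 4
  have hC := hasDerivAt_inv_sin_sq hs
  set S' := -(2 * Real.cos (x 2)) / Real.sin (x 2) ^ 3 with hS'
  set P' := -(2 * a₁ (x 0) * (q (x 0) - p (x 0)) / (4 * F (x 0) * a (x 0) ^ 3))
    + p (x 0) * F₁ (x 0) / (4 * F (x 0) ^ 2 * a (x 0) ^ 2)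
    + p (x 0) * a₁ (x 0) / (2 * F (x 0) * a (x 0) ^ 3) with hP'
  have tp : HasDerivAt (fun t => -(p t / (4 * (F t * a t ^ 2)))) P' (x 0) := by
    refine (((hp _ hJx).fun_div ((e1.fun_mul hasq).const_mul 4)
      (by simp [ha0, hF0])).fun_neg).congr_deriv ?_
    rw [hP']; field_simp; ring
  set Q' := q₁ (x 0) / (4 * a (x 0) ^ 4) - q (x 0) * a₁ (x 0) / a (x 0) ^ 5 with hQ'
  have tq : HasDerivAt (fun t => q t / (4 * a t ^ 4)) Q' (x 0) := by
    refine ((hq _ hJx).fun_div (haq.const_mul 4) (by simp [ha0])).congr_deriv ?_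
    rw [hQ']; field_simp
  have r1 : HasDerivAt (fun r : ℝ => 1 - k * r ^ 2) (-(k * (2 * x 1))) (x 1) :=
    (hsq.const_mul k).const_sub 1
  have r2 : HasDerivAt (fun r : ℝ => (r ^ 2)⁻¹) (-2 / x 1 ^ 3) (x 1) := by
    refine (hsq.fun_inv (by simp [hr])).congr_deriv ?_
    field_simp
  have r3 : HasDerivAt (fun r : ℝ => (r ^ 2)⁻¹ - k) (-2 / x 1 ^ 3) (x 1) := r2.sub_const k
  have r4 : HasDerivAt (fun r : ℝ => (r ^ 4)⁻¹) (-4 / x 1 ^ 5) (x 1) := by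
    refine (hq4.fun_inv (by simp [hr])).congr_deriv ?_
    field_simp
  set P := -(p (x 0) / (4 * (F (x 0) * a (x 0) ^ 2))) with hPdef
  set Q := q (x 0) / (4 * a (x 0) ^ 4) with hQdef
  set S := (Real.sin (x 2) ^ 2)⁻¹ with hS
  have hπ : ∀ i j, HasPD (flrwPi k a F p q i j) ((![![0,
        ![P' * (1 - k * x 1 ^ 2), P * -(k * (2 * x 1)), 0, 0],
        ![P' * (x 1 ^ 2)⁻¹, P * (-2 / x 1 ^ 3), 0, 0],
        ![P' * (x 1 ^ 2)⁻¹ * S, P * (-2 / x 1 ^ 3) * S, P * (x 1 ^ 2)⁻¹ * S', 0]],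
      ![![P' * (1 - k * x 1 ^ 2), P * -(k * (2 * x 1)), 0, 0], 0,
        ![Q' * ((x 1 ^ 2)⁻¹ - k), Q * (-2 / x 1 ^ 3), 0, 0],
        ![Q' * ((x 1 ^ 2)⁻¹ - k) * S, Q * (-2 / x 1 ^ 3) * S, Q * ((x 1 ^ 2)⁻¹ - k) * S', 0]],
      ![![P' * (x 1 ^ 2)⁻¹, P * (-2 / x 1 ^ 3), 0, 0],
        ![Q' * ((x 1 ^ 2)⁻¹ - k), Q * (-2 / x 1 ^ 3), 0, 0], 0,
        ![Q' * (x 1 ^ 4)⁻¹ * S, Q * (-4 / x 1 ^ 5) * S, Q * (x 1 ^ 4)⁻¹ * S', 0]],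
      ![![P' * (x 1 ^ 2)⁻¹ * S, P * (-2 / x 1 ^ 3) * S, P * (x 1 ^ 2)⁻¹ * S', 0],
        ![Q' * ((x 1 ^ 2)⁻¹ - k) * S, Q * (-2 / x 1 ^ 3) * S, Q * ((x 1 ^ 2)⁻¹ - k) * S', 0],
        ![Q' * (x 1 ^ 4)⁻¹ * S, Q * (-4 / x 1 ^ 5) * S, Q * (x 1 ^ 4)⁻¹ * S', 0], 0]] :
      Fin 4 → Fin 4 → Fin 4 → ℝ) i j) x := by
    intro i j
    have h01 := hasPD_coord_zero_mul_one tp r1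
    have h02 := hasPD_coord_zero_mul_one tp r2
    have h03 := hasPD_separable tp r2 hC
    have h12 := hasPD_coord_zero_mul_one tq r3
    have h13 := hasPD_separable tq r3 hC
    have h23 := hasPD_separable tq r4 hC
    fin_cases i <;> fin_cases j
    exacts [hasPD_zero, h01, h02, h03, h01, hasPD_zero, h12, h13, h02, h12, hasPD_zero, h23,
      h03, h13, h23, hasPD_zero]
  rw [divMomentum_diagonal (isOpen_flrwDom k hJ) hx hP hπ (flrwPi_symm k a F p q)
    (fun i => by fin_cases i <;> rfl)
    (christoffel_flrw ha0 hF0 hr hk hs d1 e1) (diagChr_symm _ _) (diagChr_of_ne _ _)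
    (v := fun _ _ => 0) ?_ b d c]
  · simp
  -- The time derivative of p occurs only for `i = 0`, where `hp` balances it. For spatial `i` the
  -- terms cancel identically, and the derivative of q is never needed.
  · intro i j hij
    fin_cases i <;> fin_cases j <;> first
      | exact absurd rfl hij
      | (simp [diagChr, Fin.sum_univ_four, flrwL, flrwM, flrwPi, hP', hQ', hPdef, hQdef, hS, hS'] <;>
          field_simp <;> ring)

end FLRWEquations

/-! ### The Cosmological Gravity property -/

section FLRWTheory

variable {k : ℝ} {a F : ℝ → ℝ} {J : Set ℝ} {x : Pt} {n : ℕ}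

/-- On FLRW metrics the field equations are algebraic in the sectional curvatures. -/
theorem fieldEq_flrw (hn : 1 ≤ n) (hJ : IsOpen J) (ha : ContDiffOn ℝ ∞ a J)
    (hF : ContDiffOn ℝ ∞ F J) (ha0 : ∀ t ∈ J, 0 < a t) (hF0 : ∀ t ∈ J, 0 < F t)
    (hx : x ∈ flrwDom k J) {α β : ℝ}
    (hα : α = flrwα (a (x 0)) (F (x 0)) (deriv a (x 0)) (deriv F (x 0)) (deriv (deriv a) (x 0)))
    (hβ : β = flrwβ k (a (x 0)) (F (x 0)) (deriv a (x 0))) (i j : Fin 4) :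
    fieldEq (theoryQ n) (flrw k a F) i j x =
      if i = j then (flrwG k a F i x)⁻¹ * (1 / 2 * ∑ c, secP n (secFLRW α β) i c * secFLRW α β i c
        - 1 / 2 * redQ n (secFLRW α β)) else 0 := by
  have hca1 := contDiffOn_deriv_of_isOpen hJ ha
  have hcF1 := contDiffOn_deriv_of_isOpen hJ hF
  have ha1 := hasDerivAt_of_contDiffOn hJ ha
  have ha2 := hasDerivAt_of_contDiffOn hJ hca1
  have hF1 := hasDerivAt_of_contDiffOn hJ hF
  have hF2 := hasDerivAt_of_contDiffOn hJ hcF1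
  set A : ℝ → ℝ := fun t => flrwα (a t) (F t) (deriv a t) (deriv F t) (deriv (deriv a) t) with hA
  set B : ℝ → ℝ := fun t => flrwβ k (a t) (F t) (deriv a t) with hB
  have hR : ∀ y ∈ flrwDom k J, riemann (flrw k a F) y =
      diagCurv (fun i => flrwG k a F i y) (secFLRW (A (y 0)) (B (y 0))) := fun y hy =>
    riemann_flrw hJ ha0 hF0 ha1 ha2 hF1 (hF2 _ hy.1) hy
  have hG : ∀ y ∈ flrwDom k J, ∀ i, flrwG k a F i y ≠ 0 := fun y hy =>
    flrwG_ne_zero (ha0 _ hy.1).ne' (hF0 _ hy.1).ne' hy.2.1.ne' hy.2.2.1.ne' hy.2.2.2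
  -- The relation β' = 2(a'/a)(α - β) is the FLRW counterpart of the relations for B' and D'; the
  -- lapse drops out of its form.
  have hB' : ∀ t ∈ J, HasDerivAt B (2 * (deriv a t / a t) * (A t - B t)) t := by
    intro t ht
    have h1 := (ha0 t ht).ne'
    have h2 := (hF0 t ht).ne'
    refine (((((ha2 t ht).fun_pow 2).fun_div (hF1 t ht) h2).add_const k).fun_div
      ((ha1 t ht).fun_pow 2) (pow_ne_zero 2 h1)).congr_deriv ?_
    simp only [hA, hB, flrwα, flrwβ]
    field_simp
    ring
  have hAc : ContDiffOn ℝ ∞ A J := by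
    refine ContDiffOn.div (ContDiffOn.sub (ContDiffOn.div
      (contDiffOn_deriv_of_isOpen hJ hca1) hF fun t ht => (hF0 t ht).ne')
      (ContDiffOn.div (hca1.mul hcF1) (contDiffOn_const.mul (hF.pow 2)) fun t ht => ?_)) ha
      fun t ht => (ha0 t ht).ne'
    have := (hF0 t ht).ne'
    simpa using this
  have hA' := hasDerivAt_of_contDiffOn hJ hAc
  -- Since q - p = (α-β)h''(β)/6, the chain rule for h'(β)/6 yields exactly the balance that makes P
  -- divergence free.
  have hp : ∀ t ∈ J, HasDerivAt (fun t => pot n 1 (B t) / 6) (2 * (deriv a t / a t) *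
      (qFLRW n (A t) (B t) - pot n 1 (B t) / 6)) t := by
    intro t ht
    refine ((hasDerivAt_pot_comp (hB' t ht) 1).div_const 6).congr_deriv ?_
    rw [qFLRW]
    ring
  have hq : ∀ t ∈ J, HasDerivAt (fun t => qFLRW n (A t) (B t))
      (deriv (fun t => qFLRW n (A t) (B t)) t) t := by
    intro t ht
    exact ((((hasDerivAt_pot_comp (hB' t ht) 1).div_const 6).fun_add
      ((((hA' t ht).fun_sub (hB' t ht)).fun_mul
        (hasDerivAt_pot_comp (hB' t ht) 2)).div_const 6)).differentiableAt).hasDerivAt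
  have hP : ∀ y ∈ flrwDom k J, ∀ b c d e, momentum (theoryQ n) (flrw k a F) b c d e y =
      flrwPi k a F (fun t => pot n 1 (B t) / 6) (fun t => qFLRW n (A t) (B t)) b c y *
        ((if b = d then if c = e then 1 else 0 else 0)
          - (if b = e then if c = d then 1 else 0 else 0)) := by
    intro y hy b c d e
    rw [momentum_diagCurv n (hG y hy) (flrw_eq_diagonal k a F y) (hR y hy) (isSec_secFLRW _ _),
      ← flrwPi_eq (ha0 _ hy.1).ne' (hF0 _ hy.1).ne' hy.2.1.ne' hy.2.2.1.ne' hy.2.2.2]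
    congr 1
    split_ifs with hbc
    · rfl
    · rw [secP_secFLRW hn _ _ hbc]
  have hV : ∀ y ∈ flrwDom k J, ∀ b d c, divMomentum (theoryQ n) (flrw k a F) b d c y =
      (if d = c then (fun _ _ _ => 0 : Fin 4 → Fin 4 → Pt → ℝ) b d y else 0)
        - (if b = c then (fun _ _ _ => 0 : Fin 4 → Fin 4 → Pt → ℝ) d b y else 0) := by
    intro y hy b d c
    rw [divMomentum_flrw hJ ha0 hF0 ha1 hF1 hp hq hP hy]
    simp
  rw [fieldEq_diagonal (flrw_eq_diagonal k a F x) (hG x hx) (isSec_secFLRW _ _) (hR x hx),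
    divDivMomentum_diagonal (isOpen_flrwDom k hJ) hx hV (fun _ _ => hasPD_zero)
      (christoffel_flrw (ha0 _ hx.1).ne' (hF0 _ hx.1).ne' hx.2.1.ne' hx.2.2.1.ne' hx.2.2.2
        (ha1 _ hx.1) (hF1 _ hx.1)) (diagChr_symm _ _), hα, hβ]
  simp [hA, hB]

/-- The components are functions of the metric entries and of α, β, which involve a up to second
order and F only up to first order. Constant functions serve to evaluate the metric entries at given
values of a and F. -/
theorem isCosmologicalGravity_theoryQ (hn : 1 ≤ n) : IsCosmologicalGravity (theoryQ n) := by
  intro k _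
  refine ⟨fun i j x a a₁ a₂ F F₁ _ => if i = j then (flrwG k (fun _ => a) (fun _ => F) i x)⁻¹ *
    (1 / 2 * ∑ c, secP n (secFLRW (flrwα a F a₁ F₁ a₂) (flrwβ k a F a₁)) i c *
        secFLRW (flrwα a F a₁ F₁ a₂) (flrwβ k a F a₁) i c
      - 1 / 2 * redQ n (secFLRW (flrwα a F a₁ F₁ a₂) (flrwβ k a F a₁))) else 0, ?_⟩
  intro a F J hJ ha hF ha0 hF0 x hx hr hk hs i j
  exact fieldEq_flrw hn hJ ha hF ha0 hF0 ⟨hx, hr, hk, hs⟩ rfl rfl i j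

end FLRWTheory

end CosmoGQTG

end

theorem mainTheorem7 (n : ℕ) (hn : 1 ≤ n) :
    CosmoGQTG.IsCosmologicalGQTG (CosmoGQTG.theoryQ n) ∧
    (3 ≤ n → ∀ (f : ℝ → ℝ) (I : Set ℝ), IsOpen I → I ⊆ Set.Ioi 0 →
      ContDiffOn ℝ (⊤ : ℕ∞) f I → (∀ r ∈ I, f r ≠ 0) →
      ∀ x : CosmoGQTG.Pt, x 1 ∈ I → Real.sin (x 2) ≠ 0 →
        CosmoGQTG.onMetric (CosmoGQTG.theoryT n) (CosmoGQTG.sss f) x = 0) := by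
  refine ⟨⟨CosmoGQTG.isCosmologicalGravity_theoryQ hn, CosmoGQTG.isGQTG_theoryQ hn⟩,
    fun _ f I hI hI0 hf hf0 x hx hs => ?_⟩
  rw [CosmoGQTG.onMetric, CosmoGQTG.riemann_sss_of_contDiffOn hI hI0 hf hf0 ⟨hx, hs⟩,
    CosmoGQTG.sss_eq_diagonal]
  exact CosmoGQTG.theoryT_secSSS n (CosmoGQTG.sssG_ne_zero (hI0 hx) (hf0 _ hx) hs) _ _ _
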